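/- Let $N\ge 2$, $\lambda<0$, and consider on an open set $U$ of coordinates $(u,v,z,x_\alpha,y_\alpha,z_\alpha)_{1\le\alpha\le N-1}$ with $z\neq 0$, $x_\alpha\ne 0$, $\sin y_\alpha\neq0$ the generalized Khlebnikov–Ghanam–Thompson metric built from $N$ 3-blocks, in dimension $n=3N$, $$ds^2 = 2\,du\,dv + H\,du^2 + \frac{4v}{z}\,du\,dz-\frac{2}{\lambda z^2}dz^2-\frac{2}{\lambda}\sum_{\alpha=1}^{N-1}\left[dx_\alpha^2+\sinh^2x_\alpha\,(dy_\alpha^2+\sin^2y_\alpha\,dz_\alpha^2)\right],$$ where $H=H(u,z,x_\alpha,y_\alpha,z_\alpha)$ is smooth and independent of $v$. Block $0$ has the coordinates $(u,v,z)$ and block $\alpha\ge1$ the coordinates $(x_\alpha,y_\alpha,z_\alpha)$; $\Box^{(\alpha)}=\nabla^{a_{(\alpha)}}\nabla_{a_{(\alpha)}}$ denotes the part of $\Box=\nabla^a\nabla_a$ that belongs to block $\alpha$. A metric is called $0$-universal if every conserved symmetric rank-2 tensor obtained as a contraction of a polynomial (with real coefficients) in the metric and the Riemann tensor, without covariant derivatives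 of the Riemann tensor, is a constant multiple of the metric. (1) At every point the Weyl tensor is of genuine type II (type D included; III, N and O excluded), and $\ell=\partial_v$ is a multiple Weyl aligned null direction (mWAND), i.e. $\ell$ is null and all Weyl components of positive boost weight with respect to $\ell$ vanish. This direction is not recurrent: at no point does any rescaling $k=f\ell$ with $f\ne0$ satisfy $k_{a;b}=L\,k_ak_b$. (2) If $$\sum_{\alpha=1}^{N-1}\Box^{(\alpha)}H=0\qquad\text{and}\qquad H=h_0+\frac{h_1}{z^2}$$ with $h_0,h_1$ functions of $u,x_\alpha,y_\alpha,z_\alpha$ only, then the Einstein condition $\Box H-2\lambda zH_{,z}=0$ holds, the metric is Einstein with $R_{ab}=\lambda g_{ab}$, and it is $0$-universal. (3) Conversely, if every line parallel to the $z$-axis meets $U$ in an interval (possibly empty) and the metric is $0$-universal, then $R_{ab}=\lambda g_{ab}$, $\Box H-2\lambda zH_{,z}=0$, $\sum_{\alpha=1}^{N-1}\Box^{(\alpha)}H=0$, and $H=h_0+h_1/z^2$ with $h_0,h_1$ functions of $u,x_\alpha,y_\alpha,z_\alpha$ only. -/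

import Mathlib

open scoped ContDiff

noncomputable section

namespace KGT

/-! ### Tensor calculus in one coordinate chart

`ι` is the finite set of coordinate labels, `ι → ℝ` the coordinate space, and a covariant tensor
field of rank `r` is given by its coordinate components. -/

section Calculus

variable {ι : Type} [Fintype ι] [DecidableEq ι]

/-- Covariant tensor fields of rank `r`, by components. -/
abbrev TField (ι : Type) (r : ℕ) : Type := (ι → ℝ) → (Fin r → ι) → ℝ

/-- Fields of symmetric matrices `g_{ab}` (metrics), by components. -/
abbrev MetricField (ι : Type) : Type := (ι → ℝ) → Matrix ι ι ℝ

/-- The partial derivative `∂_i f` at `p`. -/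
def pd (i : ι) (f : (ι → ℝ) → ℝ) (p : ι → ℝ) : ℝ := fderiv ℝ f p (Pi.single i 1)

/-- The Christoffel symbol `Γ^c_{ab}` of the Levi-Civita connection of `g`. -/
def christoffel (g : MetricField ι) (c a b : ι) (p : ι → ℝ) : ℝ :=
  (1 / 2) * ∑ d, (g p)⁻¹ c d *
    (pd a (fun q => g q d b) p + pd b (fun q => g q d a) p - pd d (fun q => g q a b) p)

/-- The metric as a tensor field of rank 2. -/
def metricT (g : MetricField ι) : TField ι 2 := fun p I => g p (I 0) (I 1)

/-- The covariant derivative; the index of differentiation is the last one: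
`(nabla g T)_{a₁…a_r b} = T_{a₁…a_r ; b}`. -/
def nabla (g : MetricField ι) {r : ℕ} (T : TField ι r) : TField ι (r + 1) := fun p I =>
  pd (I (Fin.last r)) (fun q => T q (Fin.init I)) p
    - ∑ j : Fin r, ∑ c, christoffel g c (I (Fin.last r)) (Fin.init I j) p
        * T p (Function.update (Fin.init I) j c)

/-- The iterated covariant derivative `∇^j T`. -/
def nablaIter (g : MetricField ι) {r : ℕ} (T : TField ι r) : (j : ℕ) → TField ι (r + j)
  | 0 => T
  | j + 1 => nabla g (nablaIter g T j)

/-- The curvature `R^a_{bcd}`. -/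
def riemannUp (g : MetricField ι) (a b c d : ι) (p : ι → ℝ) : ℝ :=
  pd c (christoffel g a d b) p - pd d (christoffel g a c b) p
    + ∑ e, (christoffel g a c e p * christoffel g e d b p
        - christoffel g a d e p * christoffel g e c b p)

/-- The Riemann tensor `R_{abcd} = g_{ae} R^e_{bcd}`. -/
def riemann (g : MetricField ι) : TField ι 4 := fun p I =>
  ∑ e, g p (I 0) e * riemannUp g e (I 1) (I 2) (I 3) p

/-- The Ricci tensor `R_{bd} = R^a_{bad}`. -/
def ricci (g : MetricField ι) (b d : ι) (p : ι → ℝ) : ℝ := ∑ a, riemannUp g a b a d p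

/-- The Ricci scalar. -/
def scalarCurv (g : MetricField ι) (p : ι → ℝ) : ℝ := ∑ a, ∑ b, (g p)⁻¹ a b * ricci g a b p

/-- The Weyl tensor `C_{abcd}`, in dimension `n = card ι`. -/
def weyl (g : MetricField ι) : TField ι 4 := fun p I =>
  riemann g p I
    - (1 / ((Fintype.card ι : ℝ) - 2)) *
        (g p (I 0) (I 2) * ricci g (I 1) (I 3) p - g p (I 0) (I 3) * ricci g (I 1) (I 2) p
          - g p (I 1) (I 2) * ricci g (I 0) (I 3) p + g p (I 1) (I 3) * ricci g (I 0) (I 2) p)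
    + (scalarCurv g p / (((Fintype.card ι : ℝ) - 1) * ((Fintype.card ι : ℝ) - 2))) *
        (g p (I 0) (I 2) * g p (I 1) (I 3) - g p (I 0) (I 3) * g p (I 1) (I 2))

/-- The second covariant derivative `∇_a ∇_b f` of a function. -/
def hess (g : MetricField ι) (f : (ι → ℝ) → ℝ) (a b : ι) (p : ι → ℝ) : ℝ :=
  pd a (pd b f) p - ∑ c, christoffel g c a b p * pd c f p

/-- The wave operator `□ f = g^{ab} ∇_a ∇_b f`. -/
def box (g : MetricField ι) (f : (ι → ℝ) → ℝ) (p : ι → ℝ) : ℝ :=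
  ∑ a, ∑ b, (g p)⁻¹ a b * hess g f a b p

/-! ### Conserved tensors and `k`-universality -/

/-- `CurvPoly g k r T`: the rank `r` tensor field `T` is a contraction of a polynomial, with real
coefficients, in the metric, the Riemann tensor and its covariant derivatives of order `≤ k`. -/
inductive CurvPoly (g : MetricField ι) (k : ℕ) : (r : ℕ) → TField ι r → Prop
  | metric : CurvPoly g k 2 (metricT g)
  | curv (j : ℕ) (hj : j ≤ k) : CurvPoly g k (4 + j) (nablaIter g (riemann g) j)
  | add {r : ℕ} {S T : TField ι r} (hS : CurvPoly g k r S) (hT : CurvPoly g k r T) :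
      CurvPoly g k r (fun p I => S p I + T p I)
  | smul {r : ℕ} (c : ℝ) {T : TField ι r} (hT : CurvPoly g k r T) :
      CurvPoly g k r (fun p I => c * T p I)
  | mul {r s : ℕ} {S : TField ι r} {T : TField ι s} (hS : CurvPoly g k r S)
      (hT : CurvPoly g k s T) :
      CurvPoly g k (r + s)
        (fun p I => S p (fun i => I (Fin.castAdd s i)) * T p (fun i => I (Fin.natAdd r i)))
  | perm {r : ℕ} (σ : Equiv.Perm (Fin r)) {T : TField ι r} (hT : CurvPoly g k r T) :
      CurvPoly g k r (fun p I => T p (fun i => I (σ i)))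
  | contract {r : ℕ} {T : TField ι (r + 2)} (hT : CurvPoly g k (r + 2) T) :
      CurvPoly g k r (fun p I => ∑ a, ∑ b, (g p)⁻¹ a b * T p (Fin.snoc (Fin.snoc I a) b))

/-- `T_{ab} = T_{ba}` on `U`. -/
def IsSymmOn (T : TField ι 2) (U : Set (ι → ℝ)) : Prop :=
  ∀ p ∈ U, ∀ a b, T p ![a, b] = T p ![b, a]

/-- `g^{bc} T_{ab;c} = 0` on `U`. -/
def IsConservedOn (g : MetricField ι) (T : TField ι 2) (U : Set (ι → ℝ)) : Prop :=
  ∀ p ∈ U, ∀ a, ∑ b, ∑ c, (g p)⁻¹ b c * nabla g T p ![a, b, c] = 0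

/-- The metric `g` on `U` is `k`-universal: every conserved symmetric rank 2 tensor constructed
from the metric, the Riemann tensor and its covariant derivatives up to order `k` is a (constant)
multiple of the metric. -/
def IsUniversalOn (g : MetricField ι) (k : ℕ) (U : Set (ι → ℝ)) : Prop :=
  ∀ T : TField ι 2, CurvPoly g k 2 T → IsSymmOn T U → IsConservedOn g T U →
    ∃ K : ℝ, ∀ p ∈ U, ∀ a b, T p ![a, b] = K * g p a b

/-! ### Null directions: boost order, mWANDs, Weyl type II, recurrence -/

/-- The scalar product `g_{ab} X^a Y^b` for the matrix `G` of the metric at a point. -/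
def ip (G : Matrix ι ι ℝ) (X Y : ι → ℝ) : ℝ := ∑ a, ∑ b, G a b * X a * Y b

/-- A nonzero null vector. -/
def IsNull (G : Matrix ι ι ℝ) (l : ι → ℝ) : Prop := l ≠ 0 ∧ ip G l l = 0

/-- The value `T(X₁, …, X_r)` of a covariant tensor on vectors. -/
def evalT {r : ℕ} (T : (Fin r → ι) → ℝ) (X : Fin r → ι → ℝ) : ℝ :=
  ∑ I : Fin r → ι, T I * ∏ j, X j (I j)

/-- `X` is a vector of boost weight `w` with respect to the null pair `(l, n)`: it is `l` for
`w = 1`, `n` for `w = -1`, and orthogonal to both (a combination of the spacelike frame vectors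
`m_(i)`) for `w = 0`. -/
def HasWeight (G : Matrix ι ι ℝ) (l n : ι → ℝ) (w : SignType) (X : ι → ℝ) : Prop :=
  match w with
  | SignType.pos => X = l
  | SignType.neg => X = n
  | SignType.zero => ip G X l = 0 ∧ ip G X n = 0

/-- The boost order of `T` along the null vector `l` is at most `k`: in every null frame
`(l, n, m_(i))` containing `l`, all components of `T` of boost weight `> k` vanish. -/
def BoostOrderLE (G : Matrix ι ι ℝ) {r : ℕ} (T : (Fin r → ι) → ℝ) (l : ι → ℝ) (k : ℤ) : Prop :=
  ∀ n : ι → ℝ, ip G n n = 0 → ip G l n = 1 →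
    ∀ (w : Fin r → SignType) (X : Fin r → ι → ℝ), (∀ j, HasWeight G l n (w j) (X j)) →
      k < ∑ j, (w j : ℤ) → evalT T X = 0

/-- `l` spans a multiple Weyl aligned null direction at `p`: the components of the Weyl tensor of
boost weight `+2` and `+1` vanish. -/
def IsMWAND (g : MetricField ι) (p : ι → ℝ) (l : ι → ℝ) : Prop :=
  IsNull (g p) l ∧ BoostOrderLE (g p) (weyl g p) l 0

/-- The Weyl tensor at `p` is of genuine type II: there is an mWAND (so that type D is included),
but no null direction along which the components of boost weight `≥ 0` all vanish (so that types
III, N and O are excluded). -/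
def IsTypeII (g : MetricField ι) (p : ι → ℝ) : Prop :=
  (∃ l, IsMWAND g p l) ∧ ∀ l, IsNull (g p) l → ¬ BoostOrderLE (g p) (weyl g p) l (-1)

/-- The covariant components `k_a = g_{ab} k^b` of a vector field. -/
def flat (g : MetricField ι) (k : (ι → ℝ) → ι → ℝ) : TField ι 1 := fun p I =>
  ∑ b, g p (I 0) b * k p b

/-- The vector field `k` is recurrent at `p`: `k_{a;b} = L k_a k_b` for some number `L`. -/
def IsRecurrentAt (g : MetricField ι) (k : (ι → ℝ) → ι → ℝ) (p : ι → ℝ) : Prop :=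
  ∃ L : ℝ, ∀ a b, nabla g (flat g k) p ![a, b] = L * flat g k p ![a] * flat g k p ![b]

end Calculus

/-! ### The generalized Khlebnikov–Ghanam–Thompson metric made of `N = m + 1` three-blocks -/

/-- The coordinate labels: block `0` carries `u = (0,0)`, `v = (0,1)`, `z = (0,2)`; block
`α ≥ 1` carries `x_α = (α,0)`, `y_α = (α,1)`, `z_α = (α,2)`. -/
abbrev Idx (m : ℕ) : Type := Fin (m + 1) × Fin 3

/-- `u` is the coordinate `(0,0)`. -/
abbrev iu (m : ℕ) : Idx m := (0, 0)

/-- `v` is the coordinate `(0,1)`. -/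
abbrev iv (m : ℕ) : Idx m := (0, 1)

/-- `z` is the coordinate `(0,2)`. -/
abbrev iz (m : ℕ) : Idx m := (0, 2)

/-- The region `z ≠ 0`, `sinh x_α ≠ 0`, `sin y_α ≠ 0` on which the coordinate expression of the
metric is defined and nondegenerate. -/
def chart (m : ℕ) : Set (Idx m → ℝ) :=
  {p | p (iz m) ≠ 0 ∧ ∀ α : Fin (m + 1), α ≠ 0 →
    Real.sinh (p (α, 0)) ≠ 0 ∧ Real.sin (p (α, 1)) ≠ 0}

/-- `2 du dv + h du² + 2 (2v/z) du dz - 2/(λ z²) dz²`. -/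
def lorentzBlock (lam h v z : ℝ) : Matrix (Fin 3) (Fin 3) ℝ :=
  !![h, 1, 2 * v / z; 1, 0, 0; 2 * v / z, 0, -2 / (lam * z ^ 2)]

/-- `-2/λ (dx² + sinh² x (dy² + sin² y dz²))`. -/
def hyperbolicBlock (lam x y : ℝ) : Matrix (Fin 3) (Fin 3) ℝ :=
  !![-2 / lam, 0, 0;
     0, -2 / lam * Real.sinh x ^ 2, 0;
     0, 0, -2 / lam * (Real.sinh x ^ 2 * Real.sin y ^ 2)]

/-- The metric
`2 du dv + H du² + 2 (2v/z) du dz - 2/(λ z²) dz²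
  - 2/λ ∑_{α ≥ 1} (dx_α² + sinh² x_α (dy_α² + sin² y_α dz_α²))`. -/
def kgt (m : ℕ) (lam : ℝ) (H : (Idx m → ℝ) → ℝ) : MetricField (Idx m) := fun p =>
  Matrix.of fun a b =>
    if a.1 = b.1 then
      if a.1 = 0 then lorentzBlock lam (H p) (p (iv m)) (p (iz m)) a.2 b.2
      else hyperbolicBlock lam (p (a.1, 0)) (p (a.1, 1)) a.2 b.2
    else 0

/-- The vector field `∂_v`. -/
def dv (m : ℕ) : (Idx m → ℝ) → Idx m → ℝ := fun _ => Pi.single (iv m) 1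

/-- The block operator `□^(α) f = ∇^{a_(α)} ∇_{a_(α)} f`. -/
def blockBox {m : ℕ} (g : MetricField (Idx m)) (α : Fin (m + 1)) (f : (Idx m → ℝ) → ℝ)
    (p : Idx m → ℝ) : ℝ :=
  ∑ i : Fin 3, ∑ j : Fin 3, (g p)⁻¹ (α, i) (α, j) * hess g f (α, i) (α, j) p

/-- On `U`, the function `f` does not depend on the coordinate `i`. -/
def IndepOn {m : ℕ} (i : Idx m) (f : (Idx m → ℝ) → ℝ) (U : Set (Idx m → ℝ)) : Prop :=
  ∀ p ∈ U, ∀ q ∈ U, (∀ j, j ≠ i → p j = q j) → f p = f q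

/-- On `U`, `H = h₀ + h₁ / z²` with `h₀`, `h₁` functions of `u, x_α, y_α, z_α` only. -/
def HasZForm {m : ℕ} (H : (Idx m → ℝ) → ℝ) (U : Set (Idx m → ℝ)) : Prop :=
  ∃ h₀ h₁ : (Idx m → ℝ) → ℝ,
    IndepOn (iv m) h₀ U ∧ IndepOn (iz m) h₀ U ∧ IndepOn (iv m) h₁ U ∧ IndepOn (iz m) h₁ U ∧
      ∀ p ∈ U, H p = h₀ p + h₁ p / p (iz m) ^ 2

end KGT

end

noncomputable section

namespace KGT

set_option linter.unusedSectionVars false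

open Filter Topology

/-! ### Coordinate calculus: partial derivatives, Christoffel symbols and the Riemann tensor -/

section General

variable {ι : Type} [Fintype ι] [DecidableEq ι]

/-! ### Partial derivatives -/

/-! For `H = 0` the metric is a product of `N` three-spaces, each of constant curvature λ/2, and `H`
enters only through `H du²` with `du` null and `∂_v H = 0`. All terms nonlinear in `H` therefore
drop out of the curvature, and `riemann_kgt` gives Riem = (block curvature λ/2) + du² ∧ Ω, where ∧
is the Kulkarni–Nomizu product. The form Ω is built from the Hessian of `H` and `dz dH`, and
annihilates both `∂_u` and `∂_v`. Contracting, Ric = λ g + (tr Ω) du². The trace splits into a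
block-0 part `tr0` = (λ/4)(z² H_zz + 3 z H_z) and the part `tr1` = -½ Σ □^(α) H of the other blocks;
their sum is -½(□H - 2λ z H_z).

Type II: all tensors in the Weyl tensor are Kulkarni–Nomizu products of forms whose only component
along `∂_v` is the one paired with `∂_u`, so the components of positive boost weight vanish.
Conversely, for any null vector a hyperbolic block contains a plane orthogonal to it on which the
Weyl tensor has a nonzero sectional value, so no null direction has all components of boost weight ≥
0 zero. Non-recurrence of `∂_v` is read off one component of its covariant derivative, equal to f/z.

The heart is `curvPoly_structure`: every rank-2 curvature polynomial without derivatives has the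
form K g + (a `tr0` + b `tr1`) du² with constants K, a, b. Such a polynomial is an equivariant
function of the metric and the curvature. It is evaluated over ℂ in a null frame in which metric and
curvature take a standard form depending on Ω alone. Boosts rescale Ω by t²; a component of boost
weight 0 is thus constant along the line through Ω and equals its value at Ω = 0, which sign changes
and permutations force to be proportional to the metric. The component along du² is homogeneous of
degree one and differentiable at the origin, hence linear in Ω, and all other components vanish.
Invariance of this linear functional under sign changes and permutations of the hyperbolic frame
vectors leaves only the two partial traces.

Sufficiency: the form h₀ + h₁/z² gives `tr0` = 0 and the block equation gives `tr1` = 0, so every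
rank-2 curvature polynomial is K g. Necessity: f du² is conserved for every `f` independent of `v`
(`isConservedOn_of_eq`), so universality makes the du² coefficient of any curvature polynomial
vanish. The Ricci tensor yields `tr0` + `tr1` = 0. The square of the Riemann tensor yields 2λ `tr0`
= 0, an Euler equation in z whose solutions are h₀ + h₁/z²; integrating it is where the z-lines of
`U` have to be intervals. -/

theorem pd_congr {i : ι} {f g : (ι → ℝ) → ℝ} {p : ι → ℝ} (h : f =ᶠ[𝓝 p] g) :
    pd i f p = pd i g p := by
  unfold pd; rw [h.fderiv_eq]

theorem pd_const (i : ι) (c : ℝ) (p : ι → ℝ) : pd i (fun _ => c) p = 0 := by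
  simp [pd]

theorem pd_add {i : ι} {f g : (ι → ℝ) → ℝ} {p : ι → ℝ} (hf : DifferentiableAt ℝ f p)
    (hg : DifferentiableAt ℝ g p) : pd i (fun q => f q + g q) p = pd i f p + pd i g p := by
  unfold pd; rw [fderiv_fun_add hf hg]; rfl

theorem pd_sub {i : ι} {f g : (ι → ℝ) → ℝ} {p : ι → ℝ} (hf : DifferentiableAt ℝ f p)
    (hg : DifferentiableAt ℝ g p) : pd i (fun q => f q - g q) p = pd i f p - pd i g p := by
  unfold pd; rw [fderiv_fun_sub hf hg]; rfl

theorem pd_mul {i : ι} {f g : (ι → ℝ) → ℝ} {p : ι → ℝ} (hf : DifferentiableAt ℝ f p)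
    (hg : DifferentiableAt ℝ g p) :
    pd i (fun q => f q * g q) p = pd i f p * g p + f p * pd i g p := by
  unfold pd; rw [fderiv_fun_mul hf hg]; simp [smul_eq_mul]; ring

theorem pd_const_mul {i : ι} {f : (ι → ℝ) → ℝ} {p : ι → ℝ} (c : ℝ)
    (hf : DifferentiableAt ℝ f p) : pd i (fun q => c * f q) p = c * pd i f p := by
  rw [pd_mul (by fun_prop) hf, pd_const]; ring

theorem pd_sum {i : ι} {κ : Type*} {s : Finset κ} {f : κ → (ι → ℝ) → ℝ} {p : ι → ℝ}
    (hf : ∀ k ∈ s, DifferentiableAt ℝ (f k) p) :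
    pd i (fun q => ∑ k ∈ s, f k q) p = ∑ k ∈ s, pd i (f k) p := by
  unfold pd; rw [fderiv_fun_sum hf]; simp

theorem pd_comp_coord {i j : ι} {F : ℝ → ℝ} {F' : ℝ} {p : ι → ℝ} (hF : HasDerivAt F F' (p j)) :
    pd i (fun q => F (q j)) p = if i = j then F' else 0 := by
  have h2 : HasFDerivAt (fun q : ι → ℝ => q j) (ContinuousLinearMap.proj j : (ι → ℝ) →L[ℝ] ℝ) p :=
    (ContinuousLinearMap.proj j : (ι → ℝ) →L[ℝ] ℝ).hasFDerivAt
  have h := hF.comp_hasFDerivAt p h2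
  unfold pd
  have h' : fderiv ℝ (fun q : ι → ℝ => F (q j)) p = _ := h.fderiv
  rw [h']
  simp [Pi.single_apply, eq_comm]

theorem contDiffAt_pd {i : ι} {f : (ι → ℝ) → ℝ} {p : ι → ℝ} {n : ℕ∞}
    (hf : ContDiffAt ℝ (n + 1) f p) : ContDiffAt ℝ n (pd i f) p := by
  have := hf.fderiv_right (m := n) le_rfl
  exact this.clm_apply contDiffAt_const

theorem differentiableAt_pd {i : ι} {f : (ι → ℝ) → ℝ} {p : ι → ℝ}
    (hf : ContDiffAt ℝ 2 f p) : DifferentiableAt ℝ (pd i f) p :=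
  (contDiffAt_pd (n := 1) (by simpa [one_add_one_eq_two] using hf)).differentiableAt (by simp)

theorem pd_comm {i j : ι} {f : (ι → ℝ) → ℝ} {p : ι → ℝ} (hf : ContDiffAt ℝ 2 f p) :
    pd i (pd j f) p = pd j (pd i f) p := by
  have hd : DifferentiableAt ℝ (fderiv ℝ f) p :=
    (hf.fderiv_right (m := 1) (by simp [one_add_one_eq_two])).differentiableAt (by simp)
  have key : ∀ a b : ι, pd a (pd b f) p
      = fderiv ℝ (fderiv ℝ f) p (Pi.single a 1) (Pi.single b 1) := by
    intro a b
    have h : pd b f = fun q => fderiv ℝ f q (Pi.single b 1) := rfl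
    rw [h]
    unfold pd
    rw [fderiv_clm_apply hd (by fun_prop)]
    simp
  rw [key, key]
  exact (hf.isSymmSndFDerivAt (by simp)) _ _

/-! ### Christoffel symbols of the first kind and the curvature -/

/-- The Christoffel symbol of the first kind `Γ_{e,ab}`. -/
def gam (g : MetricField ι) (a b : ι) (p : ι → ℝ) (e : ι) : ℝ :=
  (1 / 2) * (pd a (fun q => g q e b) p + pd b (fun q => g q e a) p - pd e (fun q => g q a b) p)

theorem christoffel_eq (g : MetricField ι) (c a b : ι) (p : ι → ℝ) :
    christoffel g c a b p = ∑ d, (g p)⁻¹ c d * gam g a b p d := by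
  simp only [christoffel, gam, Finset.mul_sum]
  exact Finset.sum_congr rfl fun d _ => by ring

/-- The hypotheses on a metric near a point. -/
structure RegularAt (g : MetricField ι) (p : ι → ℝ) : Prop where
  symm : ∀ᶠ q in 𝓝 p, ∀ a b, g q a b = g q b a
  det : ∀ᶠ q in 𝓝 p, IsUnit (g q).det
  smooth : ∀ a b, ContDiffAt ℝ 2 (fun q => g q a b) p

theorem sum_mul_christoffel {g : MetricField ι} {p : ι → ℝ} (h : IsUnit (g p).det) (e a b : ι) :
    ∑ c, g p e c * christoffel g c a b p = gam g a b p e := by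
  have h1 : ∑ c, g p e c * christoffel g c a b p = (g p).mulVec ((g p)⁻¹.mulVec (gam g a b p)) e := by
    simp only [christoffel_eq, Matrix.mulVec, dotProduct]
  rw [h1, Matrix.mulVec_mulVec, Matrix.mul_nonsing_inv _ h, Matrix.one_mulVec]

theorem differentiableAt_det {M : (ι → ℝ) → Matrix ι ι ℝ} {p : ι → ℝ}
    (h : ∀ a b, DifferentiableAt ℝ (fun q => M q a b) p) :
    DifferentiableAt ℝ (fun q => (M q).det) p := by
  simp only [Matrix.det_apply']
  refine DifferentiableAt.fun_sum fun σ _ => DifferentiableAt.const_mul ?_ _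
  exact (HasFDerivAt.finsetProd (g := fun i q => M q (σ i) i) fun i _ => (h (σ i) i).hasFDerivAt).differentiableAt

theorem differentiableAt_inv {M : (ι → ℝ) → Matrix ι ι ℝ} {p : ι → ℝ} (hd : IsUnit (M p).det)
    (h : ∀ a b, DifferentiableAt ℝ (fun q => M q a b) p) (a b : ι) :
    DifferentiableAt ℝ (fun q => (M q)⁻¹ a b) p := by
  simp only [Matrix.inv_def, Matrix.smul_apply, Ring.inverse_eq_inv', smul_eq_mul,
    Matrix.adjugate_apply]
  refine DifferentiableAt.mul ?_ ?_
  · exact DifferentiableAt.inv (differentiableAt_det h) hd.ne_zero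
  · refine differentiableAt_det fun i j => ?_
    simp only [Matrix.updateRow_apply]
    split_ifs
    · fun_prop
    · exact h _ _

namespace RegularAt

variable {g : MetricField ι} {p : ι → ℝ}

theorem diff (h : RegularAt g p) (a b : ι) : DifferentiableAt ℝ (fun q => g q a b) p :=
  (h.smooth a b).differentiableAt (by simp)

theorem diff_pd (h : RegularAt g p) (c a b : ι) :
    DifferentiableAt ℝ (pd c (fun q => g q a b)) p := differentiableAt_pd (h.smooth a b)

theorem diff_gam (h : RegularAt g p) (a b e : ι) :
    DifferentiableAt ℝ (fun q => gam g a b q e) p := by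
  unfold gam
  exact (((h.diff_pd _ _ _).add (h.diff_pd _ _ _)).sub (h.diff_pd _ _ _)).const_mul _

theorem diff_christoffel (h : RegularAt g p) (c a b : ι) :
    DifferentiableAt ℝ (christoffel g c a b) p := by
  have : christoffel g c a b = fun q => ∑ d, (g q)⁻¹ c d * gam g a b q d :=
    funext fun q => christoffel_eq g c a b q
  rw [this]
  exact DifferentiableAt.fun_sum fun d _ =>
    (differentiableAt_inv h.det.self_of_nhds h.diff _ _).mul (h.diff_gam _ _ _)

theorem pd_metric_symm (h : RegularAt g p) (c a b : ι) :
    pd c (fun q => g q a b) p = pd c (fun q => g q b a) p :=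
  pd_congr (h.symm.mono fun _ hq => hq a b)

/-- The Levi-Civita connection is compatible with the metric. -/
theorem pd_metric (h : RegularAt g p) (c a b : ι) :
    pd c (fun q => g q a b) p = gam g c b p a + gam g c a p b := by
  simp only [gam]
  rw [h.pd_metric_symm c b a, h.pd_metric_symm b a c, h.pd_metric_symm a c b]
  ring

theorem pd_gam (h : RegularAt g p) (c a b e : ι) :
    pd c (fun q => gam g a b q e) p = (1 / 2) * (pd c (pd a (fun q => g q e b)) p
      + pd c (pd b (fun q => g q e a)) p - pd c (pd e (fun q => g q a b)) p) := by
  unfold gam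
  rw [pd_const_mul, pd_sub, pd_add]
  · exact h.diff_pd _ _ _
  · exact h.diff_pd _ _ _
  · exact (h.diff_pd _ _ _).add (h.diff_pd _ _ _)
  · exact h.diff_pd _ _ _
  · exact ((h.diff_pd _ _ _).add (h.diff_pd _ _ _)).sub (h.diff_pd _ _ _)

theorem gam_symm (h : RegularAt g p) (a b e : ι) : gam g a b p e = gam g b a p e := by
  simp only [gam]; rw [h.pd_metric_symm e a b]; ring

theorem christoffel_symm (h : RegularAt g p) (c a b : ι) :
    christoffel g c a b p = christoffel g c b a p := by
  simp only [christoffel_eq, h.gam_symm a b]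

/-- Differentiating g_{ae} Γ^e_{db} = Γ_{a,db} avoids ever differentiating the inverse metric. -/
theorem sum_mul_pd_christoffel (h : RegularAt g p) (a b c d : ι) :
    ∑ e, g p a e * pd c (christoffel g e d b) p
      = pd c (fun q => gam g d b q a) p
        - ∑ e, (gam g c e p a + gam g c a p e) * christoffel g e d b p := by
  have h1 : pd c (fun q => gam g d b q a) p
      = pd c (fun q => ∑ e, g q a e * christoffel g e d b q) p :=
    pd_congr (h.det.mono fun q hq => (sum_mul_christoffel hq a d b).symm)
  rw [h1, pd_sum (f := fun e q => g q a e * christoffel g e d b q)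
    fun e _ => (h.diff a e).mul (h.diff_christoffel e d b), ← Finset.sum_sub_distrib]
  refine Finset.sum_congr rfl fun e _ => ?_
  rw [pd_mul (h.diff a e) (h.diff_christoffel e d b), h.pd_metric]
  ring

theorem ip_inv_eq (a b c d : ι) :
    ip (g p)⁻¹ (gam g a b p) (gam g c d p) = ∑ e, gam g a b p e * christoffel g e c d p := by
  simp only [ip, christoffel_eq, Finset.mul_sum]
  exact Finset.sum_congr rfl fun e _ => Finset.sum_congr rfl fun f _ => by ring

theorem inv_symm (h : RegularAt g p) (a b : ι) : (g p)⁻¹ a b = (g p)⁻¹ b a := by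
  have : (g p).transpose = g p := by
    ext a b; exact h.symm.self_of_nhds b a
  conv_rhs => rw [← this, ← Matrix.transpose_nonsing_inv]
  rfl

theorem ip_inv_symm (h : RegularAt g p) (X Y : ι → ℝ) : ip (g p)⁻¹ X Y = ip (g p)⁻¹ Y X := by
  unfold ip
  rw [Finset.sum_comm]
  refine Finset.sum_congr rfl fun a _ => Finset.sum_congr rfl fun b _ => ?_
  rw [h.inv_symm a b]; ring

/-- The Riemann tensor in terms of second derivatives of the metric and of the Christoffel
symbols of the first kind. -/
theorem riemann_eq (h : RegularAt g p) (I : Fin 4 → ι) :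
    riemann g p I
      = (1 / 2) * (pd (I 1) (pd (I 2) fun q => g q (I 0) (I 3)) p
          + pd (I 0) (pd (I 3) fun q => g q (I 1) (I 2)) p
          - pd (I 0) (pd (I 2) fun q => g q (I 1) (I 3)) p
          - pd (I 1) (pd (I 3) fun q => g q (I 0) (I 2)) p)
        + ip (g p)⁻¹ (gam g (I 1) (I 2) p) (gam g (I 0) (I 3) p)
        - ip (g p)⁻¹ (gam g (I 1) (I 3) p) (gam g (I 0) (I 2) p) := by
  unfold riemann riemannUp
  generalize I 0 = a, I 1 = b, I 2 = c, I 3 = d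
  have hq : ∀ c d, ∑ e, g p a e * ∑ f, christoffel g e c f p * christoffel g f d b p
      = ∑ f, gam g c f p a * christoffel g f d b p := by
    intro c d
    simp only [Finset.mul_sum]
    rw [Finset.sum_comm]
    refine Finset.sum_congr rfl fun f _ => ?_
    rw [← sum_mul_christoffel h.det.self_of_nhds, Finset.sum_mul]
    exact Finset.sum_congr rfl fun e _ => by ring
  have h1 : ∑ e, g p a e * (pd c (christoffel g e d b) p - pd d (christoffel g e c b) p
        + ∑ f, (christoffel g e c f p * christoffel g f d b p
          - christoffel g e d f p * christoffel g f c b p))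
      = ∑ e, g p a e * pd c (christoffel g e d b) p - ∑ e, g p a e * pd d (christoffel g e c b) p
        + ∑ e, g p a e * ∑ f, christoffel g e c f p * christoffel g f d b p
        - ∑ e, g p a e * ∑ f, christoffel g e d f p * christoffel g f c b p := by
    simp only [← Finset.sum_sub_distrib, ← Finset.sum_add_distrib, ← mul_sub, ← mul_add]
    refine Finset.sum_congr rfl fun e _ => ?_
    rw [Finset.sum_sub_distrib]; ring
  rw [h1, hq, hq, h.sum_mul_pd_christoffel, h.sum_mul_pd_christoffel, h.pd_gam, h.pd_gam,
    h.ip_inv_symm (gam g b c p), h.ip_inv_symm (gam g b d p), ip_inv_eq, ip_inv_eq]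
  simp only [add_mul, Finset.sum_add_distrib]
  -- Commuting partial derivatives makes the two terms in ∂_c ∂_d g_{ab} cancel and puts the other
  -- four in the order of the statement.
  rw [pd_comm (i := d) (j := c) (h.smooth a b), pd_comm (i := b) (j := c) (h.smooth a d),
    pd_comm (i := b) (j := d) (h.smooth a c), pd_comm (i := a) (j := c) (h.smooth b d),
    pd_comm (i := a) (j := d) (h.smooth b c)]
  have hs : ∀ c e, pd c (pd e fun q => g q d b) p = pd c (pd e fun q => g q b d) p := fun c e =>
    pd_congr (h.symm.eventually_nhds.mono fun q hq => pd_congr (hq.mono fun _ hq => hq d b))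
  have hs' : ∀ d e, pd d (pd e fun q => g q c b) p = pd d (pd e fun q => g q b c) p := fun d e =>
    pd_congr (h.symm.eventually_nhds.mono fun q hq => pd_congr (hq.mono fun _ hq => hq c b))
  rw [hs, hs']
  simp only [h.christoffel_symm _ d b, h.christoffel_symm _ c b, h.gam_symm c a, h.gam_symm d a]
  ring

end RegularAt

end General

/-! ### Constant curvature of the three-dimensional blocks -/

section BlockTables

/-! ### The blocks of the background metric, as products of functions of single coordinates -/

/-- Entries of the Lorentzian block for `H = 0`: the factor depending on `v`, and its derivatives. -/
def lorF (lam : ℝ) (n : ℕ) (v : ℝ) : Matrix (Fin 3) (Fin 3) ℝ :=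
  match n with
  | 0 => !![0, 1, 2 * v; 1, 0, 0; 2 * v, 0, -2 / lam]
  | 1 => !![0, 0, 2; 0, 0, 0; 2, 0, 0]
  | _ => 0

/-- Entries of the Lorentzian block for `H = 0`: the factor depending on `z`, and its derivatives. -/
def lorG (n : ℕ) (z : ℝ) : Matrix (Fin 3) (Fin 3) ℝ :=
  match n with
  | 0 => !![1, 1, 1 / z; 1, 1, 1; 1 / z, 1, 1 / z ^ 2]
  | 1 => !![0, 0, -1 / z ^ 2; 0, 0, 0; -1 / z ^ 2, 0, -2 / z ^ 3]
  | _ => !![0, 0, 2 / z ^ 3; 0, 0, 0; 2 / z ^ 3, 0, 6 / z ^ 4]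

/-- Entries of the hyperbolic block: the factor depending on `x`, and its derivatives. -/
def hypF (lam : ℝ) (n : ℕ) (x : ℝ) : Matrix (Fin 3) (Fin 3) ℝ :=
  match n with
  | 0 => !![-2 / lam, 0, 0; 0, -2 / lam * Real.sinh x ^ 2, 0; 0, 0, -2 / lam * Real.sinh x ^ 2]
  | 1 => !![0, 0, 0; 0, -2 / lam * (2 * Real.sinh x * Real.cosh x), 0;
      0, 0, -2 / lam * (2 * Real.sinh x * Real.cosh x)]
  | _ => !![0, 0, 0; 0, -2 / lam * (2 * (Real.cosh x ^ 2 + Real.sinh x ^ 2)), 0;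
      0, 0, -2 / lam * (2 * (Real.cosh x ^ 2 + Real.sinh x ^ 2))]

/-- Entries of the hyperbolic block: the factor depending on `y`, and its derivatives. -/
def hypG (n : ℕ) (y : ℝ) : Matrix (Fin 3) (Fin 3) ℝ :=
  match n with
  | 0 => !![1, 1, 1; 1, 1, 1; 1, 1, Real.sin y ^ 2]
  | 1 => !![0, 0, 0; 0, 0, 0; 0, 0, 2 * Real.sin y * Real.cos y]
  | _ => !![0, 0, 0; 0, 0, 0; 0, 0, 2 * (Real.cos y ^ 2 - Real.sin y ^ 2)]

theorem hasDerivAt_lorF (lam : ℝ) (n : ℕ) (v : ℝ) (i j : Fin 3) :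
    HasDerivAt (fun t => lorF lam n t i j) (lorF lam (n + 1) v i j) v := by
  have h2 : HasDerivAt (fun t : ℝ => 2 * t) 2 v := by
    simpa using (hasDerivAt_id v).const_mul (2 : ℝ)
  have hc := fun c : ℝ => hasDerivAt_const v c
  match n with
  | 0 => fin_cases i <;> fin_cases j <;> simp [lorF, h2, hc]
  | 1 => fin_cases i <;> fin_cases j <;> simp [lorF, hc]
  | n + 2 => simpa [lorF] using hc 0

/-- The last case of the table records the second derivative and no higher one, hence the bound on
`n`. -/
theorem hasDerivAt_lorG {n : ℕ} (hn : n < 2) {z : ℝ} (hz : z ≠ 0) (i j : Fin 3) :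
    HasDerivAt (fun t => lorG n t i j) (lorG (n + 1) z i j) z := by
  have hc := fun c : ℝ => hasDerivAt_const z c
  have hp : ∀ (c : ℝ) (k : ℕ), HasDerivAt (fun t : ℝ => c / t ^ (k + 1))
      (c * -((k + 1) / z ^ (k + 2))) z := by
    intro c k
    have := ((hasDerivAt_pow (k + 1) z).fun_inv (pow_ne_zero _ hz)).const_mul c
    refine (this.congr_deriv ?_).congr_of_eventuallyEq
      (Eventually.of_forall fun t => div_eq_mul_inv _ _)
    push_cast; field_simp; ring
  have h1 : HasDerivAt (fun t : ℝ => 1 / t) (-1 / z ^ 2) z :=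
    (hp 1 0).congr_deriv (by simp; ring) |>.congr_of_eventuallyEq (by simp)
  have h2 : HasDerivAt (fun t : ℝ => 1 / t ^ 2) (-2 / z ^ 3) z :=
    (hp 1 1).congr_deriv (by push_cast; ring)
  have h3 : HasDerivAt (fun t : ℝ => -1 / t ^ 2) (2 / z ^ 3) z :=
    (hp (-1) 1).congr_deriv (by push_cast; ring)
  have h4 : HasDerivAt (fun t : ℝ => -2 / t ^ 3) (6 / z ^ 4) z :=
    (hp (-2) 2).congr_deriv (by push_cast; ring)
  interval_cases n <;> fin_cases i <;> fin_cases j <;>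
    first | exact hc _ | exact h1 | exact h2 | exact h3 | exact h4

theorem hasDerivAt_hypF (lam : ℝ) {n : ℕ} (hn : n < 2) (x : ℝ) (i j : Fin 3) :
    HasDerivAt (fun t => hypF lam n t i j) (hypF lam (n + 1) x i j) x := by
  have hc := fun c : ℝ => hasDerivAt_const x c
  have h1 : HasDerivAt (fun t => -2 / lam * Real.sinh t ^ 2)
      (-2 / lam * (2 * Real.sinh x * Real.cosh x)) x :=
    (((Real.hasDerivAt_sinh x).fun_pow 2).const_mul _).congr_deriv (by push_cast; ring)
  have h2 : HasDerivAt (fun t => -2 / lam * (2 * Real.sinh t * Real.cosh t))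
      (-2 / lam * (2 * (Real.cosh x ^ 2 + Real.sinh x ^ 2))) x :=
    ((((Real.hasDerivAt_sinh x).const_mul 2).fun_mul (Real.hasDerivAt_cosh x)).const_mul _).congr_deriv
      (by ring)
  interval_cases n
  · fin_cases i <;> fin_cases j <;> simp [hypF, hc, h1]
  · fin_cases i <;> fin_cases j <;> simp [hypF, hc, h2]

theorem hasDerivAt_hypG {n : ℕ} (hn : n < 2) (y : ℝ) (i j : Fin 3) :
    HasDerivAt (fun t => hypG n t i j) (hypG (n + 1) y i j) y := by
  have hc := fun c : ℝ => hasDerivAt_const y c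
  have h1 : HasDerivAt (fun t => Real.sin t ^ 2) (2 * Real.sin y * Real.cos y) y :=
    ((Real.hasDerivAt_sin y).fun_pow 2).congr_deriv (by push_cast; ring)
  have h2 : HasDerivAt (fun t => 2 * Real.sin t * Real.cos t)
      (2 * (Real.cos y ^ 2 - Real.sin y ^ 2)) y :=
    (((Real.hasDerivAt_sin y).const_mul 2).fun_mul (Real.hasDerivAt_cos y)).congr_deriv (by ring)
  interval_cases n
  · fin_cases i <;> fin_cases j <;> simp [hypG, hc, h1]
  · fin_cases i <;> fin_cases j <;> simp [hypG, hc, h2]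

/-- The inverse of the Lorentzian block. -/
def lorInv (lam h v z : ℝ) : Matrix (Fin 3) (Fin 3) ℝ :=
  !![0, 1, 0; 1, -h - 2 * lam * v ^ 2, lam * v * z; 0, lam * v * z, -lam * z ^ 2 / 2]

/-- The inverse of the hyperbolic block. -/
def hypInv (lam x y : ℝ) : Matrix (Fin 3) (Fin 3) ℝ :=
  !![-lam / 2, 0, 0; 0, -lam / (2 * Real.sinh x ^ 2), 0;
    0, 0, -lam / (2 * Real.sinh x ^ 2 * Real.sin y ^ 2)]

theorem lorentzBlock_mul_inv {lam : ℝ} (hlam : lam ≠ 0) (h v : ℝ) {z : ℝ} (hz : z ≠ 0) :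
    lorentzBlock lam h v z * lorInv lam h v z = 1 := by
  ext i j
  fin_cases i <;> fin_cases j <;>
    simp [lorentzBlock, lorInv, Matrix.mul_apply, Fin.sum_univ_three] <;> field_simp <;> ring

theorem hyperbolicBlock_mul_inv {lam : ℝ} (hlam : lam ≠ 0) {x y : ℝ} (hx : Real.sinh x ≠ 0)
    (hy : Real.sin y ≠ 0) : hyperbolicBlock lam x y * hypInv lam x y = 1 := by
  ext i j
  fin_cases i <;> fin_cases j <;>
    simp [hyperbolicBlock, hypInv, Matrix.mul_apply, Fin.sum_univ_three] <;> field_simp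

/-- Partial derivatives of a block with entries `F(q_s) G(q_t)`. -/
def blockD (s t : Fin 3) (F G : ℕ → Matrix (Fin 3) (Fin 3) ℝ) (c i j : Fin 3) : ℝ :=
  (if c = s then F 1 i j else 0) * G 0 i j + F 0 i j * (if c = t then G 1 i j else 0)

/-- Second partial derivatives of a block with entries `F(q_s) G(q_t)`. -/
def blockDD (s t : Fin 3) (F G : ℕ → Matrix (Fin 3) (Fin 3) ℝ) (d c i j : Fin 3) : ℝ :=
  (if c = s then (if d = s then F 2 i j else 0) * G 0 i j
      + F 1 i j * (if d = t then G 1 i j else 0) else 0)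
    + (if c = t then (if d = s then F 1 i j else 0) * G 1 i j
      + F 0 i j * (if d = t then G 2 i j else 0) else 0)

/-- Christoffel symbols of the first kind of a block with entries `F(q_s) G(q_t)`. -/
def blockGam (s t : Fin 3) (F G : ℕ → Matrix (Fin 3) (Fin 3) ℝ) (a b e : Fin 3) : ℝ :=
  (1 / 2) * (blockD s t F G a e b + blockD s t F G b e a - blockD s t F G e a b)

/-- The curvature of a block, in terms of the inverse metric, of second derivatives of the metric
and of Christoffel symbols of the first kind. -/
def blockCurv (W : Matrix (Fin 3) (Fin 3) ℝ) (DD : Fin 3 → Fin 3 → Fin 3 → Fin 3 → ℝ)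
    (Γ : Fin 3 → Fin 3 → Fin 3 → ℝ) (a b c d : Fin 3) : ℝ :=
  (1 / 2) * (DD b c a d + DD a d b c - DD a c b d - DD b d a c)
    + ip W (Γ b c) (Γ a d) - ip W (Γ b d) (Γ a c)

theorem ip_comm_of_symm {ι : Type} [Fintype ι] {W : Matrix ι ι ℝ} (hW : ∀ i j, W i j = W j i)
    (X Y : ι → ℝ) : ip W X Y = ip W Y X := by
  unfold ip
  rw [Finset.sum_comm]
  refine Finset.sum_congr rfl fun a _ => Finset.sum_congr rfl fun b _ => ?_
  rw [hW]; ring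

theorem blockCurv_swap_left {W : Matrix (Fin 3) (Fin 3) ℝ} (hW : ∀ i j, W i j = W j i)
    {DD : Fin 3 → Fin 3 → Fin 3 → Fin 3 → ℝ} {Γ : Fin 3 → Fin 3 → Fin 3 → ℝ} (a b c d : Fin 3) :
    blockCurv W DD Γ b a c d = -blockCurv W DD Γ a b c d := by
  unfold blockCurv
  rw [ip_comm_of_symm hW (Γ a c), ip_comm_of_symm hW (Γ a d)]; ring

theorem blockCurv_swap_right {W : Matrix (Fin 3) (Fin 3) ℝ}
    {DD : Fin 3 → Fin 3 → Fin 3 → Fin 3 → ℝ} {Γ : Fin 3 → Fin 3 → Fin 3 → ℝ} (a b c d : Fin 3) :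
    blockCurv W DD Γ a b d c = -blockCurv W DD Γ a b c d := by
  unfold blockCurv
  ring

/-- In dimension three an antisymmetric pair has three independent values, so nine components
decide. -/
theorem eq_zero_of_antisymm {E : Fin 3 → Fin 3 → Fin 3 → Fin 3 → ℝ}
    (h₁ : ∀ a b c d, E b a c d = -E a b c d) (h₂ : ∀ a b c d, E a b d c = -E a b c d)
    (h : (E 0 1 0 1 = 0 ∧ E 0 1 0 2 = 0 ∧ E 0 1 1 2 = 0) ∧
      (E 0 2 0 1 = 0 ∧ E 0 2 0 2 = 0 ∧ E 0 2 1 2 = 0) ∧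
      (E 1 2 0 1 = 0 ∧ E 1 2 0 2 = 0 ∧ E 1 2 1 2 = 0)) (a b c d : Fin 3) : E a b c d = 0 := by
  have key : ∀ F : Fin 3 → Fin 3 → ℝ, (∀ i j, F j i = -F i j) → F 0 1 = 0 → F 0 2 = 0 →
      F 1 2 = 0 → ∀ i j, F i j = 0 := by
    intro F hF h01 h02 h12 i j
    have h := hF i j
    fin_cases i <;> fin_cases j <;> simp at h ⊢ <;> linarith
  have h' : ∀ a b, E a b 0 1 = 0 ∧ E a b 0 2 = 0 ∧ E a b 1 2 = 0 := fun a b =>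
    ⟨key (fun a b => E a b 0 1) (fun a b => h₁ a b 0 1) h.1.1 h.2.1.1 h.2.2.1 a b,
      key (fun a b => E a b 0 2) (fun a b => h₁ a b 0 2) h.1.2.1 h.2.1.2.1 h.2.2.2.1 a b,
      key (fun a b => E a b 1 2) (fun a b => h₁ a b 1 2) h.1.2.2 h.2.1.2.2 h.2.2.2.2 a b⟩
  exact key (E a b) (h₂ a b) (h' a b).1 (h' a b).2.1 (h' a b).2.2 c d

/-- Both sides are antisymmetric in each index pair; the nine remaining components are rational
identities in `v` and `z`. -/
theorem lorentz_curvature {lam : ℝ} (hlam : lam ≠ 0) (v : ℝ) {z : ℝ} (hz : z ≠ 0)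
    (a b c d : Fin 3) :
    blockCurv (lorInv lam 0 v z) (blockDD 1 2 (lorF lam · v) (lorG · z)) (blockGam 1 2 (lorF lam · v) (lorG · z)) a b c d
      = lam / 2 * (lorentzBlock lam 0 v z a c * lorentzBlock lam 0 v z b d - lorentzBlock lam 0 v z a d * lorentzBlock lam 0 v z b c) := by
  rw [← sub_eq_zero]
  have hs : ∀ i j, (lorInv lam 0 v z) i j = (lorInv lam 0 v z) j i := by
    intro i j; fin_cases i <;> fin_cases j <;> rfl
  revert a b c d
  refine eq_zero_of_antisymm (fun a b c d => ?_) (fun a b c d => ?_) ?_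
  · rw [blockCurv_swap_left hs]; ring
  · rw [blockCurv_swap_right]; ring
  · refine ⟨⟨?_, ?_, ?_⟩, ⟨?_, ?_, ?_⟩, ⟨?_, ?_, ?_⟩⟩ <;>
    simp [blockCurv, blockDD, blockGam, blockD, lorF, lorG, lorInv, lorentzBlock, ip, Fin.sum_univ_three] <;>
    (field_simp; ring)

/-- As for the Lorentzian block, with cosh² and cos² eliminated at the end. -/
theorem hyperbolic_curvature {lam : ℝ} (hlam : lam ≠ 0) {x y : ℝ} (hx : Real.sinh x ≠ 0)
    (hy : Real.sin y ≠ 0)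
    (a b c d : Fin 3) :
    blockCurv (hypInv lam x y) (blockDD 0 1 (hypF lam · x) (hypG · y)) (blockGam 0 1 (hypF lam · x) (hypG · y)) a b c d
      = lam / 2 * (hyperbolicBlock lam x y a c * hyperbolicBlock lam x y b d - hyperbolicBlock lam x y a d * hyperbolicBlock lam x y b c) := by
  rw [← sub_eq_zero]
  have hs : ∀ i j, (hypInv lam x y) i j = (hypInv lam x y) j i := by
    intro i j; fin_cases i <;> fin_cases j <;> rfl
  revert a b c d
  refine eq_zero_of_antisymm (fun a b c d => ?_) (fun a b c d => ?_) ?_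
  · rw [blockCurv_swap_left hs]; ring
  · rw [blockCurv_swap_right]; ring
  · refine ⟨⟨?_, ?_, ?_⟩, ⟨?_, ?_, ?_⟩, ⟨?_, ?_, ?_⟩⟩ <;>
    simp [blockCurv, blockDD, blockGam, blockD, hypF, hypG, hypInv, hyperbolicBlock, ip, Fin.sum_univ_three] <;>
    (field_simp; try simp only [Real.cosh_sq, Real.cos_sq']) <;> ring

end BlockTables

/-! ### The metric as background plus `H du²`, and the derivatives of the background -/

section Metric

variable {m : ℕ} {lam : ℝ}

/-! ### Block matrices -/

/-- The block diagonal matrix with the given blocks. -/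
def blk {R : Type} [Zero R] (A : Fin (m + 1) → Matrix (Fin 3) (Fin 3) R) :
    Matrix (Idx m) (Idx m) R :=
  Matrix.of fun a b => if a.1 = b.1 then A a.1 a.2 b.2 else 0

theorem sum_blk_mul {R : Type} [Semiring R] (A : Fin (m + 1) → Matrix (Fin 3) (Fin 3) R)
    (a : Idx m) (X : Idx m → R) :
    ∑ b, blk A a b * X b = ∑ j, A a.1 a.2 j * X (a.1, j) := by
  rw [Fintype.sum_prod_type, Finset.sum_eq_single a.1]
  · simp [blk]
  · intro β _ h
    simp [blk, h.symm]
  · simp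

theorem blk_mul {R : Type} [Semiring R] (A B : Fin (m + 1) → Matrix (Fin 3) (Fin 3) R) :
    blk A * blk B = blk fun α => A α * B α := by
  ext a b
  rw [Matrix.mul_apply, sum_blk_mul]
  by_cases h : a.1 = b.1
  · simp [blk, h, Matrix.mul_apply]
  · simp [blk, h]

theorem blk_one {R : Type} [Semiring R] :
    blk (m := m) (fun _ => (1 : Matrix (Fin 3) (Fin 3) R)) = 1 := by
  ext a b
  simp only [blk, Matrix.of_apply, Matrix.one_apply, Prod.ext_iff]
  split_ifs <;> simp_all

theorem ip_blk (A : Fin (m + 1) → Matrix (Fin 3) (Fin 3) ℝ) (X Y : Idx m → ℝ) :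
    ip (blk A) X Y = ∑ α, ip (A α) (fun i => X (α, i)) (fun j => Y (α, j)) := by
  unfold ip
  rw [Fintype.sum_prod_type]
  refine Finset.sum_congr rfl fun α _ => Finset.sum_congr rfl fun i _ => ?_
  simp only [mul_assoc]
  exact sum_blk_mul A (α, i) fun b => X (α, i) * Y b

theorem ip_add_left {ι : Type} [Fintype ι] (W : Matrix ι ι ℝ) (X X' Y : ι → ℝ) :
    ip W (X + X') Y = ip W X Y + ip W X' Y := by
  simp only [ip, Pi.add_apply, ← Finset.sum_add_distrib]
  exact Finset.sum_congr rfl fun _ _ => Finset.sum_congr rfl fun _ _ => by ring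

theorem ip_add_right {ι : Type} [Fintype ι] (W : Matrix ι ι ℝ) (X Y Y' : ι → ℝ) :
    ip W X (Y + Y') = ip W X Y + ip W X Y' := by
  simp only [ip, Pi.add_apply, ← Finset.sum_add_distrib]
  exact Finset.sum_congr rfl fun _ _ => Finset.sum_congr rfl fun _ _ => by ring

theorem ip_smul_left {ι : Type} [Fintype ι] (W : Matrix ι ι ℝ) (c : ℝ) (X Y : ι → ℝ) :
    ip W (c • X) Y = c * ip W X Y := by
  simp only [ip, Pi.smul_apply, smul_eq_mul, Finset.mul_sum]
  exact Finset.sum_congr rfl fun _ _ => Finset.sum_congr rfl fun _ _ => by ring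

theorem ip_smul_right {ι : Type} [Fintype ι] (W : Matrix ι ι ℝ) (c : ℝ) (X Y : ι → ℝ) :
    ip W X (c • Y) = c * ip W X Y := by
  simp only [ip, Pi.smul_apply, smul_eq_mul, Finset.mul_sum]
  exact Finset.sum_congr rfl fun _ _ => Finset.sum_congr rfl fun _ _ => by ring

/-! ### The metric and its inverse -/

/-- The components of the one-form `du`. -/
def ell (a : Idx m) : ℝ := if a = iu m then 1 else 0

/-- The components of the one-form `dz`. -/
def zet (a : Idx m) : ℝ := if a = iz m then 1 else 0

/-- The inverse metric. -/
def kgtInv (m : ℕ) (lam : ℝ) (H : (Idx m → ℝ) → ℝ) (p : Idx m → ℝ) : Matrix (Idx m) (Idx m) ℝ :=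
  blk fun α => if α = 0 then lorInv lam (H p) (p (iv m)) (p (iz m))
    else hypInv lam (p (α, 0)) (p (α, 1))

theorem kgt_eq_blk (H : (Idx m → ℝ) → ℝ) (p : Idx m → ℝ) :
    kgt m lam H p = blk fun α => if α = 0 then lorentzBlock lam (H p) (p (iv m)) (p (iz m))
      else hyperbolicBlock lam (p (α, 0)) (p (α, 1)) := by
  ext a b
  simp only [kgt, blk, Matrix.of_apply]
  split_ifs <;> rfl

theorem kgt_mul_kgtInv (hlam : lam ≠ 0) (H : (Idx m → ℝ) → ℝ) {p : Idx m → ℝ} (hp : p ∈ chart m) :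
    kgt m lam H p * kgtInv m lam H p = 1 := by
  rw [kgt_eq_blk, kgtInv, blk_mul, ← blk_one]
  congr 1
  funext α
  by_cases hα : α = 0
  · simp only [hα, if_true]
    exact lorentzBlock_mul_inv hlam _ _ hp.1
  · simp only [hα, if_false]
    exact hyperbolicBlock_mul_inv hlam (hp.2 α hα).1 (hp.2 α hα).2

theorem inv_kgt (hlam : lam ≠ 0) (H : (Idx m → ℝ) → ℝ) {p : Idx m → ℝ} (hp : p ∈ chart m) :
    (kgt m lam H p)⁻¹ = kgtInv m lam H p :=
  Matrix.inv_eq_right_inv (kgt_mul_kgtInv hlam H hp)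

theorem isUnit_det_kgt (hlam : lam ≠ 0) (H : (Idx m → ℝ) → ℝ) {p : Idx m → ℝ} (hp : p ∈ chart m) :
    IsUnit (kgt m lam H p).det :=
  Matrix.isUnit_det_of_right_inverse (kgt_mul_kgtInv hlam H hp)

theorem kgt_eq (H : (Idx m → ℝ) → ℝ) (p : Idx m → ℝ) (a b : Idx m) :
    kgt m lam H p a b = kgt m lam (fun _ => 0) p a b + H p * (ell a * ell b) := by
  obtain ⟨α, i⟩ := a
  obtain ⟨β, j⟩ := b
  by_cases h : α = β
  · subst h
    by_cases hα : α = 0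
    · subst hα
      fin_cases i <;> fin_cases j <;> simp [kgt, ell, lorentzBlock]
    · simp [kgt, ell, hα]
  · simp only [kgt, Matrix.of_apply, h, if_false, ell, Prod.mk.injEq]
    split_ifs <;> simp_all

theorem kgtInv_eq (H : (Idx m → ℝ) → ℝ) (p : Idx m → ℝ) (a b : Idx m) :
    kgtInv m lam H p a b = kgtInv m lam (fun _ => 0) p a b
      - H p * ((if a = iv m then 1 else 0) * (if b = iv m then 1 else 0)) := by
  obtain ⟨α, i⟩ := a
  obtain ⟨β, j⟩ := b
  by_cases h : α = β
  · subst h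
    by_cases hα : α = 0
    · subst hα
      fin_cases i <;> fin_cases j <;> simp [kgtInv, blk, lorInv]
      ring
    · simp [kgtInv, blk, hα]
  · simp only [kgtInv, blk, Matrix.of_apply, h, if_false, Prod.mk.injEq]
    split_ifs <;> simp_all

theorem kgt_symm (H : (Idx m → ℝ) → ℝ) (p : Idx m → ℝ) (a b : Idx m) :
    kgt m lam H p a b = kgt m lam H p b a := by
  obtain ⟨α, i⟩ := a
  obtain ⟨β, j⟩ := b
  by_cases h : α = β
  · subst h
    by_cases hα : α = 0
    · subst hα
      fin_cases i <;> fin_cases j <;> simp [kgt, lorentzBlock]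
    · fin_cases i <;> fin_cases j <;> simp [kgt, hα, hyperbolicBlock]
  · simp [kgt, h, Ne.symm h]

theorem ip_kgtInv_ell (H : (Idx m → ℝ) → ℝ) (p : Idx m → ℝ) (X : Idx m → ℝ) :
    ip (kgtInv m lam H p) ell X = X (iv m) := by
  rw [kgtInv, ip_blk, Finset.sum_eq_single 0]
  · simp [ip, Fin.sum_univ_three, lorInv, ell]
  · intro α _ hα
    simp [ip, ell, hα]
  · simp

/-- As `du` is null and dual to `∂_v`, adding `H du²` changes the inverse metric exactly by `-H ∂_v
⊗ ∂_v`. -/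
theorem ip_kgtInv_eq (H : (Idx m → ℝ) → ℝ) (p : Idx m → ℝ) (X Y : Idx m → ℝ) :
    ip (kgtInv m lam H p) X Y = ip (kgtInv m lam (fun _ => 0) p) X Y
      - H p * X (iv m) * Y (iv m) := by
  simp only [ip, kgtInv_eq H, sub_mul, Finset.sum_sub_distrib]
  congr 1
  simp [mul_ite, ite_mul]

theorem isOpen_chart (m : ℕ) : IsOpen (chart m) := by
  have : chart m = {p | p (iz m) ≠ 0} ∩ ⋂ α : Fin (m + 1), {p | α ≠ 0 →
      Real.sinh (p (α, 0)) ≠ 0 ∧ Real.sin (p (α, 1)) ≠ 0} := by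
    ext p; simp [chart]
  rw [this]
  refine (isOpen_ne_fun (by fun_prop) (by fun_prop)).inter (isOpen_iInter_of_finite fun α => ?_)
  by_cases hα : α = 0
  · simp [hα]
  · simp only [hα, ne_eq, not_false_eq_true, forall_true_left]
    exact (isOpen_ne_fun (by fun_prop) (by fun_prop)).inter
      (isOpen_ne_fun (by fun_prop) (by fun_prop))

theorem contDiffAt_kgt_zero {p : Idx m → ℝ} (hp : p ∈ chart m) (a b : Idx m) :
    ContDiffAt ℝ ∞ (fun q => kgt m lam (fun _ => 0) q a b) p := by
  have hz : p (0, 2) ≠ 0 := hp.1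
  obtain ⟨α, i⟩ := a
  obtain ⟨β, j⟩ := b
  by_cases h : α = β
  · subst h
    by_cases hα : α = 0
    · subst hα
      have h1 : ContDiffAt ℝ ∞ (fun q : Idx m → ℝ => 2 * q (0, 1) / q (0, 2)) p :=
        ContDiffAt.div (by fun_prop) (by fun_prop) hz
      have h2 : ContDiffAt ℝ ∞ (fun q : Idx m → ℝ => -2 / (lam * q (0, 2) ^ 2)) p := by
        simp only [← div_div]
        exact ContDiffAt.div (by fun_prop) (by fun_prop) (pow_ne_zero 2 hz)
      fin_cases i <;> fin_cases j <;>
        simp [kgt, lorentzBlock, contDiffAt_const, h1, h2]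
    · fin_cases i <;> fin_cases j <;> simp [kgt, hα, hyperbolicBlock, contDiffAt_const]
      · exact contDiffAt_const.mul ((Real.contDiff_sinh.contDiffAt.comp p (by fun_prop)).pow 2)
      · exact contDiffAt_const.mul (((Real.contDiff_sinh.contDiffAt.comp p (by fun_prop)).pow 2).mul
          ((Real.contDiff_sin.contDiffAt.comp p (by fun_prop)).pow 2))
  · simp [kgt, h, contDiffAt_const]

theorem contDiffAt_kgt {H : (Idx m → ℝ) → ℝ} {p : Idx m → ℝ} (hp : p ∈ chart m)
    (hH : ContDiffAt ℝ ∞ H p) (a b : Idx m) :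
    ContDiffAt ℝ ∞ (fun q => kgt m lam H q a b) p := by
  have : (fun q => kgt m lam H q a b)
      = fun q => kgt m lam (fun _ => 0) q a b + H q * (ell a * ell b) := funext fun q => kgt_eq H q a b
  rw [this]
  exact (contDiffAt_kgt_zero hp a b).add (hH.mul contDiffAt_const)

theorem regularAt_kgt (hlam : lam ≠ 0) {H : (Idx m → ℝ) → ℝ} {p : Idx m → ℝ} (hp : p ∈ chart m)
    (hH : ContDiffAt ℝ ∞ H p) : RegularAt (kgt m lam H) p where
  symm := Eventually.of_forall fun q a b => kgt_symm H q a b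
  det := ((isOpen_chart m).mem_nhds hp |> Filter.mem_of_superset) fun _ hq => isUnit_det_kgt hlam H hq
  smooth a b := (contDiffAt_kgt hp hH a b).of_le (by norm_cast)

/-! ### Derivatives of the metric -/

/-- The first factor of the entries of block `α`. -/
def tabF (lam : ℝ) (α : Fin (m + 1)) (x : ℝ) (n : ℕ) : Matrix (Fin 3) (Fin 3) ℝ :=
  if α = 0 then lorF lam n x else hypF lam n x

/-- The second factor of the entries of block `α`. -/
def tabG (α : Fin (m + 1)) (y : ℝ) (n : ℕ) : Matrix (Fin 3) (Fin 3) ℝ :=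
  if α = 0 then lorG n y else hypG n y

/-- The coordinate on which the first factor of the entries of block `α` depends. -/
def crdF (α : Fin (m + 1)) : Fin 3 := if α = 0 then 1 else 0

/-- The coordinate on which the second factor of the entries of block `α` depends. -/
def crdG (α : Fin (m + 1)) : Fin 3 := if α = 0 then 2 else 1

theorem kgt_zero_apply (p : Idx m → ℝ) (a b : Idx m) :
    kgt m lam (fun _ => 0) p a b = if a.1 = b.1 then
      tabF lam a.1 (p (a.1, crdF a.1)) 0 a.2 b.2 * tabG a.1 (p (a.1, crdG a.1)) 0 a.2 b.2 else 0 := by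
  obtain ⟨α, i⟩ := a
  obtain ⟨β, j⟩ := b
  by_cases h : α = β
  · subst h
    by_cases hα : α = 0
    · subst hα
      fin_cases i <;> fin_cases j <;>
        simp [kgt, lorentzBlock, tabF, tabG, crdF, crdG, lorF, lorG, div_eq_mul_inv]
      ring
    · fin_cases i <;> fin_cases j <;>
        simp [kgt, hα, hyperbolicBlock, tabF, tabG, crdF, crdG, hypF, hypG, mul_assoc]
  · simp [kgt, h]

theorem hasDerivAt_tabF (α : Fin (m + 1)) {n : ℕ} (hn : n < 2) (x : ℝ) (i j : Fin 3) :
    HasDerivAt (fun t => tabF lam α t n i j) (tabF lam α x (n + 1) i j) x := by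
  by_cases hα : α = 0
  · simpa [tabF, hα] using hasDerivAt_lorF lam n x i j
  · simpa [tabF, hα] using hasDerivAt_hypF lam hn x i j

theorem hasDerivAt_tabG {p : Idx m → ℝ} (hp : p ∈ chart m) (α : Fin (m + 1)) {n : ℕ} (hn : n < 2)
    (i j : Fin 3) :
    HasDerivAt (fun t => tabG α t n i j) (tabG α (p (α, crdG α)) (n + 1) i j) (p (α, crdG α)) := by
  by_cases hα : α = 0
  · subst hα
    simpa [tabG, crdG] using hasDerivAt_lorG hn hp.1 i j
  · simpa [tabG, hα] using hasDerivAt_hypG hn _ i j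

/-- Every entry of a background block is a product of two one-variable functions, so this rule
yields all first and second derivatives of the background from the tables. -/
theorem pd_mul_coord {α : Fin (m + 1)} {i j : Fin 3} {F G : ℝ → ℝ} {F' G' : ℝ} {p : Idx m → ℝ}
    (hF : HasDerivAt F F' (p (α, i))) (hG : HasDerivAt G G' (p (α, j))) (c : Idx m) :
    pd c (fun q => F (q (α, i)) * G (q (α, j))) p = if c.1 = α then
      (if c.2 = i then F' else 0) * G (p (α, j)) + F (p (α, i)) * (if c.2 = j then G' else 0)
      else 0 := by
  have h1 : ∀ k : Fin 3, DifferentiableAt ℝ (fun q : Idx m → ℝ => q (α, k)) p := fun k => by fun_prop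
  rw [pd_mul (f := fun q => F (q (α, i))) (g := fun q => G (q (α, j)))
    (hF.differentiableAt.comp p (h1 i)) (hG.differentiableAt.comp p (h1 j)),
    pd_comp_coord hF, pd_comp_coord hG]
  by_cases h : c.1 = α <;> simp [h, Prod.ext_iff]

/-- First derivatives of the background metric. -/
def bgD (lam : ℝ) (p : Idx m → ℝ) (c a b : Idx m) : ℝ :=
  if a.1 = b.1 ∧ c.1 = a.1 then blockD (crdF a.1) (crdG a.1) (tabF lam a.1 (p (a.1, crdF a.1)))
    (tabG a.1 (p (a.1, crdG a.1))) c.2 a.2 b.2 else 0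

/-- Second derivatives of the background metric. -/
def bgDD (lam : ℝ) (p : Idx m → ℝ) (d c a b : Idx m) : ℝ :=
  if a.1 = b.1 ∧ c.1 = a.1 ∧ d.1 = a.1 then
    blockDD (crdF a.1) (crdG a.1) (tabF lam a.1 (p (a.1, crdF a.1)))
      (tabG a.1 (p (a.1, crdG a.1))) d.2 c.2 a.2 b.2 else 0

theorem pd_kgt_zero {p : Idx m → ℝ} (hp : p ∈ chart m) (c a b : Idx m) :
    pd c (fun q => kgt m lam (fun _ => 0) q a b) p = bgD lam p c a b := by
  simp only [kgt_zero_apply, bgD]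
  by_cases h : a.1 = b.1
  · simp only [h, if_true, true_and]
    rw [pd_mul_coord (F := fun x => tabF lam b.1 x 0 a.2 b.2) (G := fun x => tabG b.1 x 0 a.2 b.2)
      (hasDerivAt_tabF _ (by norm_num) _ _ _) (hasDerivAt_tabG hp _ (by norm_num) _ _)]
    rfl
  · simp [h, pd_const]

theorem pd_pd_kgt_zero {p : Idx m → ℝ} (hp : p ∈ chart m) (d c a b : Idx m) :
    pd d (pd c (fun q => kgt m lam (fun _ => 0) q a b)) p = bgDD lam p d c a b := by
  rw [pd_congr (((isOpen_chart m).mem_nhds hp |> Filter.mem_of_superset)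
    fun q hq => pd_kgt_zero hq c a b)]
  simp only [bgD, bgDD]
  by_cases h : a.1 = b.1
  swap
  · simp [h, pd_const]
  by_cases hc : c.1 = b.1
  swap
  · simp [h, hc, pd_const]
  simp only [h, hc, and_self, if_true, true_and, blockD]
  have hne : crdF b.1 ≠ crdG b.1 := by unfold crdF crdG; split_ifs <;> decide
  by_cases hF : c.2 = crdF b.1
  · simp only [hF, if_true, hne, if_false, mul_zero, add_zero, blockDD]
    rw [pd_mul_coord (F := fun x => tabF lam b.1 x 1 a.2 b.2) (G := fun x => tabG b.1 x 0 a.2 b.2)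
      (hasDerivAt_tabF _ (by norm_num) _ _ _) (hasDerivAt_tabG hp _ (by norm_num) _ _)]
  by_cases hG : c.2 = crdG b.1
  · simp only [hG, if_true, hne.symm, if_false, zero_mul, zero_add, blockDD]
    rw [pd_mul_coord (F := fun x => tabF lam b.1 x 0 a.2 b.2) (G := fun x => tabG b.1 x 1 a.2 b.2)
      (hasDerivAt_tabF _ (by norm_num) _ _ _) (hasDerivAt_tabG hp _ (by norm_num) _ _)]
  · simp [hF, hG, blockDD, pd_const]

end Metric

/-! ### The Riemann tensor as block curvature plus a null part -/

section Curvature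

variable {m : ℕ} {lam : ℝ}

/-- The Kulkarni–Nomizu product of two bilinear forms. -/
def KN {ι R : Type} [CommRing R] (P Q : Matrix ι ι R) (I : Fin 4 → ι) : R :=
  P (I 0) (I 2) * Q (I 1) (I 3) - P (I 0) (I 3) * Q (I 1) (I 2)
    - P (I 1) (I 2) * Q (I 0) (I 3) + P (I 1) (I 3) * Q (I 0) (I 2)

/-- The curvature tensor of a product of three-spaces of constant curvature `K`. -/
def bcurv {R : Type} [CommRing R] (K : R) (G : Matrix (Idx m) (Idx m) R) (I : Fin 4 → Idx m) : R :=
  if (I 0).1 = (I 1).1 ∧ (I 2).1 = (I 0).1 ∧ (I 3).1 = (I 0).1 then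
    K * (G (I 0) (I 2) * G (I 1) (I 3) - G (I 0) (I 3) * G (I 1) (I 2)) else 0

/-- The inverse of block `α` for `H = 0`. -/
def invBlock (lam : ℝ) (p : Idx m → ℝ) (α : Fin (m + 1)) : Matrix (Fin 3) (Fin 3) ℝ :=
  if α = 0 then lorInv lam 0 (p (iv m)) (p (iz m)) else hypInv lam (p (α, 0)) (p (α, 1))

/-- Christoffel symbols of the first kind of the background metric. -/
def bgGam (lam : ℝ) (p : Idx m → ℝ) (a b e : Idx m) : ℝ :=
  (1 / 2) * (bgD lam p a e b + bgD lam p b e a - bgD lam p e a b)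

theorem bgGam_eq (p : Idx m → ℝ) (a b e : Idx m) :
    bgGam lam p a b e = if a.1 = b.1 ∧ e.1 = b.1 then
      blockGam (crdF b.1) (crdG b.1) (tabF lam b.1 (p (b.1, crdF b.1)))
        (tabG b.1 (p (b.1, crdG b.1))) a.2 b.2 e.2 else 0 := by
  obtain ⟨α, i⟩ := a
  obtain ⟨β, j⟩ := b
  obtain ⟨γ, k⟩ := e
  simp only [bgGam, bgD, blockGam]
  by_cases h : α = β
  · subst h
    by_cases h' : γ = α
    · subst h'; simp
    · simp [h', Ne.symm h']
  · by_cases h' : γ = β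
    · subst h'; simp [h, Ne.symm h]
    · simp only [h, h', Ne.symm h', false_and, and_false, if_false]; ring

/-- These are the only background symbols seen by the correction `-H ∂_v ⊗ ∂_v` of the inverse
metric and by contraction with `du`. -/
theorem bgGam_iv {p : Idx m → ℝ} (a b : Idx m) :
    bgGam lam p a b (iv m) = -(1 / p (iz m)) * (ell a * zet b + zet a * ell b) := by
  obtain ⟨α, i⟩ := a
  obtain ⟨β, j⟩ := b
  rw [bgGam_eq]
  by_cases h : α = 0 ∧ β = 0
  · obtain ⟨rfl, rfl⟩ := h
    fin_cases i <;> fin_cases j <;>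
      simp [blockGam, blockD, tabF, tabG, crdF, crdG, lorF, lorG, ell, zet]
  · have h1 : ¬ (α = β ∧ (0 : Fin (m + 1)) = β) := fun ⟨h1, h2⟩ => h ⟨h1.trans h2.symm, h2.symm⟩
    simp only [ell, zet, Prod.mk.injEq, h1, if_false]
    by_cases hα : α = 0
    · have hβ : β ≠ 0 := fun h' => h ⟨hα, h'⟩
      simp [hα, hβ]
    · simp [hα]

theorem ip_bgGam (p : Idx m → ℝ) (a b c d : Idx m) :
    ip (kgtInv m lam (fun _ => 0) p) (bgGam lam p a b) (bgGam lam p c d)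
      = if a.1 = b.1 ∧ c.1 = d.1 ∧ b.1 = d.1 then
        ip (invBlock lam p b.1)
          (blockGam (crdF b.1) (crdG b.1) (tabF lam b.1 (p (b.1, crdF b.1)))
            (tabG b.1 (p (b.1, crdG b.1))) a.2 b.2)
          (blockGam (crdF b.1) (crdG b.1) (tabF lam b.1 (p (b.1, crdF b.1)))
            (tabG b.1 (p (b.1, crdG b.1))) c.2 d.2) else 0 := by
  obtain ⟨α, i⟩ := a
  obtain ⟨β, j⟩ := b
  obtain ⟨γ, k⟩ := c
  obtain ⟨δ, l⟩ := d
  rw [kgtInv, ip_blk, Finset.sum_eq_single β]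
  · simp only [bgGam_eq, invBlock]
    by_cases h : α = β
    · by_cases h' : β = δ
      · subst h h'; by_cases h'' : γ = α
        · subst h''; simp
        · simp [h'', ip]
      · simp [h', ip]
    · simp [h, ip]
  · intro ε _ hε
    simp [bgGam_eq, ip, hε]
  · simp

theorem bg_curvature (hlam : lam ≠ 0) {p : Idx m → ℝ} (hp : p ∈ chart m) (a b c d : Idx m) :
    (1 / 2) * (bgDD lam p b c a d + bgDD lam p a d b c - bgDD lam p a c b d - bgDD lam p b d a c)
      + ip (kgtInv m lam (fun _ => 0) p) (bgGam lam p b c) (bgGam lam p a d)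
      - ip (kgtInv m lam (fun _ => 0) p) (bgGam lam p b d) (bgGam lam p a c)
    = bcurv (lam / 2) (kgt m lam (fun _ => 0) p) ![a, b, c, d] := by
  obtain ⟨α, i⟩ := a
  obtain ⟨β, j⟩ := b
  obtain ⟨γ, k⟩ := c
  obtain ⟨δ, l⟩ := d
  simp only [ip_bgGam, bgDD, bcurv, Matrix.cons_val]
  by_cases h : α = β ∧ γ = α ∧ δ = α
  · obtain ⟨rfl, rfl, rfl⟩ := h
    simp only [true_and, if_true]
    by_cases hα : δ = 0
    · subst hα
      have e1 : tabF (m := m) lam 0 (p (0, 1)) = (lorF lam · (p (iv m))) := by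
        funext n; simp [tabF]
      have e2 : tabG (m := m) 0 (p (0, 2)) = (lorG · (p (iz m))) := by
        funext n; simp [tabG]
      have := lorentz_curvature hlam (p (iv m)) hp.1 i j k l
      simpa [blockCurv, invBlock, kgt, crdF, crdG, e1, e2] using this
    · have e1 : tabF lam δ (p (δ, 0)) = (hypF lam · (p (δ, 0))) := by
        funext n; simp [tabF, hα]
      have e2 : tabG δ (p (δ, 1)) = (hypG · (p (δ, 1))) := by
        funext n; simp [tabG, hα]
      have := hyperbolic_curvature hlam (hp.2 δ hα).1 (hp.2 δ hα).2 i j k l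
      simpa [blockCurv, invBlock, kgt, crdF, crdG, e1, e2, hα] using this
  · have h1 : ¬ (α = δ ∧ γ = α ∧ β = α) := by rintro ⟨rfl, rfl, rfl⟩; simp at h
    have h2 : ¬ (β = γ ∧ δ = β ∧ α = β) := by rintro ⟨rfl, rfl, rfl⟩; simp at h
    have h3 : ¬ (β = δ ∧ γ = β ∧ α = β) := by rintro ⟨rfl, rfl, rfl⟩; simp at h
    have h4 : ¬ (α = γ ∧ δ = α ∧ β = α) := by rintro ⟨rfl, rfl, rfl⟩; simp at h
    have h5 : ¬ (β = γ ∧ α = δ ∧ γ = δ) := by rintro ⟨rfl, rfl, rfl⟩; simp at h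
    have h6 : ¬ (β = δ ∧ α = γ ∧ δ = γ) := by rintro ⟨rfl, rfl, rfl⟩; simp at h
    simp [h, h1, h2, h3, h4, h5, h6]

theorem ip_kgtInv_comm (H : (Idx m → ℝ) → ℝ) (p : Idx m → ℝ) (X Y : Idx m → ℝ) :
    ip (kgtInv m lam H p) X Y = ip (kgtInv m lam H p) Y X := by
  refine ip_comm_of_symm (fun a b => ?_) X Y
  obtain ⟨α, i⟩ := a
  obtain ⟨β, j⟩ := b
  by_cases h : α = β
  · subst h
    by_cases hα : α = 0
    · subst hα
      fin_cases i <;> fin_cases j <;> simp [kgtInv, blk, lorInv]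
    · fin_cases i <;> fin_cases j <;> simp [kgtInv, blk, hα, hypInv]
  · simp [kgtInv, blk, h, Ne.symm h]

/-! ### The profile function -/

/-- The hypotheses on the profile `H` near a point. -/
structure Admissible (H : (Idx m → ℝ) → ℝ) (p : Idx m → ℝ) : Prop where
  chart : p ∈ chart m
  smooth : ∀ᶠ q in 𝓝 p, ContDiffAt ℝ ∞ H q
  pd_v : ∀ᶠ q in 𝓝 p, pd (iv m) H q = 0

theorem Admissible.eventually {H : (Idx m → ℝ) → ℝ} {p : Idx m → ℝ} (h : Admissible H p) :
    ∀ᶠ q in 𝓝 p, Admissible H q := by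
  filter_upwards [(isOpen_chart m).mem_nhds h.chart, h.smooth.eventually_nhds,
    h.pd_v.eventually_nhds] with q h1 h2 h3
  exact ⟨h1, h2, h3⟩

theorem pd_eq_zero_of_indep {i : Idx m} {f : (Idx m → ℝ) → ℝ} {U : Set (Idx m → ℝ)}
    (hU : IsOpen U) (hf : IndepOn i f U) {p : Idx m → ℝ} (hp : p ∈ U)
    (hd : DifferentiableAt ℝ f p) : pd i f p = 0 := by
  have h1 : HasLineDerivAt ℝ f (pd i f p) p (Pi.single i 1) := hd.hasFDerivAt.hasLineDerivAt _
  have h2 : HasLineDerivAt ℝ f 0 p (Pi.single i 1) := by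
    have hc : (fun _ : ℝ => f p) =ᶠ[𝓝 0] fun t : ℝ => f (p + t • Pi.single i (1 : ℝ)) := by
      have hcont : ContinuousAt (fun t : ℝ => p + t • (Pi.single i (1 : ℝ) : Idx m → ℝ)) 0 := by
        fun_prop
      have hev := hcont.preimage_mem_nhds (by simpa using hU.mem_nhds hp)
      filter_upwards [hev] with t ht
      refine hf p hp _ ht fun j hj => ?_
      simp [hj]
    exact (hasDerivAt_const (0 : ℝ) (f p)).congr_of_eventuallyEq hc.symm
  exact h1.unique h2

theorem admissible {U : Set (Idx m → ℝ)} (hU : IsOpen U) (hUc : U ⊆ KGT.chart m)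
    {H : (Idx m → ℝ) → ℝ} (hH : ContDiffOn ℝ ∞ H U) (hHv : IndepOn (iv m) H U)
    {p : Idx m → ℝ} (hp : p ∈ U) : Admissible H p where
  chart := hUc hp
  smooth := (hU.mem_nhds hp |> Filter.mem_of_superset) fun _ hq => hH.contDiffAt (hU.mem_nhds hq)
  pd_v := (hU.mem_nhds hp |> Filter.mem_of_superset) fun _ hq =>
    pd_eq_zero_of_indep hU hHv hq ((hH.contDiffAt (hU.mem_nhds hq)).differentiableAt (by simp))

/-- The form `ell ⊗ ell`. -/
def ellell : Matrix (Idx m) (Idx m) ℝ := Matrix.of fun a b => ell a * ell b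

/-- The form `Ω` before the removal of its components along `du`. -/
def preOm (lam : ℝ) (H : (Idx m → ℝ) → ℝ) (p : Idx m → ℝ) : Matrix (Idx m) (Idx m) ℝ :=
  Matrix.of fun b d => -(1 / 2) * (hess (kgt m lam H) H b d p
    + 1 / p (iz m) * (zet b * pd d H p + pd b H p * zet d))

theorem kgt_zero_block_zero (p : Idx m → ℝ) (i j : Fin 3) :
    kgt m lam (fun _ => 0) p (0, i) (0, j)
      = ell (m := m) (0, i) * (if j = 1 then 1 else 0)
        + (if i = 1 then 1 else 0) * ell (m := m) (0, j)
        + 2 * p (iv m) / p (iz m) *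
          (ell (m := m) (0, i) * zet (m := m) (0, j) + zet (m := m) (0, i) * ell (m := m) (0, j))
        - 2 / (lam * p (iz m) ^ 2) * (zet (m := m) (0, i) * zet (m := m) (0, j)) := by
  fin_cases i <;> fin_cases j <;> simp [kgt, lorentzBlock, ell, zet]
  ring

/-- The Kulkarni–Nomizu product of `du²` with any form having a factor `du` vanishes. Of the block-0
metric only the term -2/(λ z²) dz² survives against `H du²`, and nothing quadratic in `H` appears.
-/
theorem bcurv_kgt {K : ℝ} (hK : K = lam / 2) (hlam : lam ≠ 0) (H : (Idx m → ℝ) → ℝ) (p : Idx m → ℝ)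
    (hz : p (iz m) ≠ 0) (a b c d : Idx m) :
    bcurv K (kgt m lam H p) ![a, b, c, d]
      = bcurv K (kgt m lam (fun _ => 0) p) ![a, b, c, d] - H p / p (iz m) ^ 2 *
        (ell b * ell d * zet a * zet c + zet b * zet d * ell a * ell c
          - ell b * ell c * zet a * zet d - zet b * zet c * ell a * ell d) := by
  subst hK
  obtain ⟨α, i⟩ := a
  obtain ⟨β, j⟩ := b
  obtain ⟨γ, k⟩ := c
  obtain ⟨δ, l⟩ := d
  simp only [bcurv, Matrix.cons_val]
  by_cases h : α = β ∧ γ = α ∧ δ = α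
  · obtain ⟨rfl, rfl, rfl⟩ := h
    simp only [true_and, if_true]
    rw [kgt_eq H, kgt_eq H, kgt_eq H, kgt_eq H]
    by_cases hα : δ = 0
    · subst hα
      simp only [kgt_zero_block_zero]
      field_simp
      ring
    · simp [ell, hα]
  · have : ∀ x : Fin (m + 1), ¬ (α = x ∧ β = x ∧ γ = x ∧ δ = x) := by
      rintro x ⟨rfl, rfl, rfl, rfl⟩; simp at h
    have h0 := this 0
    simp only [h, if_false, ell, zet, Prod.mk.injEq]
    by_cases h1 : α = 0 <;> by_cases h2 : β = 0 <;> by_cases h3 : γ = 0 <;> by_cases h4 : δ = 0 <;>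
      simp [h1, h2, h3, h4] at h0 ⊢

namespace Admissible

variable {H : (Idx m → ℝ) → ℝ} {p : Idx m → ℝ}

theorem contDiffAt (h : Admissible H p) : ContDiffAt ℝ ∞ H p := h.smooth.self_of_nhds

theorem contDiffAt_two (h : Admissible H p) : ContDiffAt ℝ 2 H p :=
  h.contDiffAt.of_le (by norm_cast)

theorem diff (h : Admissible H p) : DifferentiableAt ℝ H p :=
  h.contDiffAt.differentiableAt (by simp)

theorem contDiffAt_pd (h : Admissible H p) (i : Idx m) : ContDiffAt ℝ ∞ (pd i H) p :=
  KGT.contDiffAt_pd (n := ⊤) (by simpa using h.contDiffAt)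

theorem pd_iv (h : Admissible H p) : pd (iv m) H p = 0 := h.pd_v.self_of_nhds

theorem pd_pd_iv (h : Admissible H p) (i : Idx m) : pd i (pd (iv m) H) p = 0 := by
  rw [pd_congr (g := fun _ => 0) h.pd_v, pd_const]

theorem pd_iv_pd (h : Admissible H p) (i : Idx m) : pd (iv m) (pd i H) p = 0 := by
  rw [pd_comm h.contDiffAt_two, h.pd_pd_iv]

theorem regularAt (h : Admissible H p) (hlam : lam ≠ 0) : RegularAt (kgt m lam H) p :=
  regularAt_kgt hlam h.chart h.contDiffAt

theorem pd_kgt (h : Admissible H p) (c a b : Idx m) :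
    pd c (fun q => kgt m lam H q a b) p = bgD lam p c a b + pd c H p * (ell a * ell b) := by
  have : (fun q => kgt m lam H q a b)
      = fun q => kgt m lam (fun _ => 0) q a b + H q * (ell a * ell b) := funext fun q => kgt_eq H q a b
  rw [this, pd_add ((contDiffAt_kgt_zero h.chart a b).differentiableAt (by simp))
    (h.diff.mul_const _), pd_kgt_zero h.chart]
  simp_rw [mul_comm (H _)]
  rw [pd_const_mul _ h.diff, mul_comm]

theorem pd_pd_kgt (h : Admissible H p) (d c a b : Idx m) :
    pd d (pd c (fun q => kgt m lam H q a b)) p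
      = bgDD lam p d c a b + pd d (pd c H) p * (ell a * ell b) := by
  have h1 : pd c (fun q => kgt m lam H q a b) =ᶠ[𝓝 p]
      fun q => pd c (fun q => kgt m lam (fun _ => 0) q a b) q + (ell a * ell b) * pd c H q := by
    filter_upwards [h.eventually] with q hq
    rw [hq.pd_kgt, pd_kgt_zero hq.chart, mul_comm (pd c H q)]
  have h2 := differentiableAt_pd (i := c) h.contDiffAt_two
  rw [pd_congr h1, pd_add, pd_pd_kgt_zero h.chart, pd_const_mul _ h2, mul_comm (pd d (pd c H) p)]
  · exact differentiableAt_pd ((contDiffAt_kgt_zero h.chart a b).of_le (by norm_cast))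
  · exact h2.const_mul _

theorem gam_kgt (h : Admissible H p) (a b : Idx m) :
    gam (kgt m lam H) a b p = bgGam lam p a b
      + (1 / 2 * (pd a H p * ell b + pd b H p * ell a)) • ell
      + (-(1 / 2 * (ell a * ell b))) • fun e => pd e H p := by
  funext e
  simp only [gam, h.pd_kgt, bgGam, Pi.add_apply, Pi.smul_apply, smul_eq_mul]
  ring

theorem hess_eq (h : Admissible H p) (hlam : lam ≠ 0) (b c : Idx m) :
    hess (kgt m lam H) H b c p = pd b (pd c H) p
      - ip (kgtInv m lam H p) (bgGam lam p b c) (fun e => pd e H p)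
      + 1 / 2 * (ell b * ell c) * ip (kgtInv m lam H p) (fun e => pd e H p) (fun e => pd e H p) := by
  have h1 : ∑ e, christoffel (kgt m lam H) e b c p * pd e H p
      = ip (kgtInv m lam H p) (gam (kgt m lam H) b c p) (fun e => pd e H p) := by
    rw [← inv_kgt hlam H h.chart, (h.regularAt hlam).ip_inv_symm]
    simp only [ip, christoffel_eq, Finset.sum_mul]
    exact Finset.sum_congr rfl fun _ _ => Finset.sum_congr rfl fun _ _ => by ring
  rw [hess, h1, h.gam_kgt, ip_add_left, ip_add_left, ip_smul_left, ip_smul_left, ip_kgtInv_ell,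
    h.pd_iv]
  ring

/-- The symbols of the first kind differ from the background ones by multiples of `du` and by `-½
du² dH`. Since `du` is null and `∂_v H = 0`, what remains is linear in `H`: second derivatives and
contractions of background symbols with `dH` assemble into the Hessian, and the products of `dH`
with `bgGam_iv` give the `dz dH` terms. -/
theorem riemann_kgt_pre (h : Admissible H p) (hlam : lam ≠ 0) (I : Fin 4 → Idx m) :
    riemann (kgt m lam H) p I
      = bcurv (lam / 2) (kgt m lam H p) I + KN ellell (preOm lam H p) I := by
  have hI : I = ![I 0, I 1, I 2, I 3] := by ext i <;> fin_cases i <;> rfl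
  rw [(h.regularAt hlam).riemann_eq, hI]
  generalize I 0 = a, I 1 = b, I 2 = c, I 3 = d
  rw [bcurv_kgt rfl hlam H p h.chart.1, ← bg_curvature hlam h.chart]
  simp only [KN, preOm, ellell, Matrix.of_apply, Matrix.cons_val, h.hess_eq hlam]
  rw [inv_kgt hlam H h.chart]
  simp only [h.gam_kgt, h.pd_pd_kgt, ip_add_left, ip_add_right, ip_smul_left, ip_smul_right,
    ip_kgtInv_ell]
  have hell : ∀ X, ip (kgtInv m lam H p) X ell = X (iv m) := fun X => by
    rw [ip_kgtInv_comm, ip_kgtInv_ell]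
  have hbg : ∀ b c, ip (kgtInv m lam H p) (fun e => pd e H p) (bgGam lam p b c)
      = ip (kgtInv m lam H p) (bgGam lam p b c) (fun e => pd e H p) := fun b c => ip_kgtInv_comm ..
  have hv : ell (iv m) = 0 := by simp [ell]
  -- The terms in undifferentiated `H`, from the inverse metric here and from `bcurv_kgt` above,
  -- cancel.
  simp only [hell, hbg, ip_kgtInv_eq H p (bgGam lam p _ _) (bgGam lam p _ _), bgGam_iv, h.pd_iv, hv]
  ring

end Admissible

end Curvature

/-! ### Ricci and Weyl tensors, and the trace of `Om` -/

section Ricci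

variable {m : ℕ} {lam : ℝ}

theorem bgGam_symm (p : Idx m → ℝ) (a b : Idx m) : bgGam lam p a b = bgGam lam p b a := by
  have hs : ∀ c a b, bgD lam p c a b = bgD lam p c b a := by
    rintro ⟨γ, k⟩ ⟨α, i⟩ ⟨β, j⟩
    by_cases h : α = β
    · subst h
      simp only [bgD, blockD, true_and]
      by_cases hα : α = 0
      · fin_cases i <;> fin_cases j <;> simp [tabF, tabG, lorF, lorG, hα]
      · fin_cases i <;> fin_cases j <;> simp [tabF, tabG, hypF, hypG, hα]
    · simp [bgD, h, Ne.symm h]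
  funext e
  simp only [bgGam, hs e a b]
  ring

theorem bgGam_iv_left (p : Idx m → ℝ) (b : Idx m) :
    bgGam lam p (iv m) b = (zet b / p (iz m)) • ell + (ell b / p (iz m)) • zet := by
  funext e
  obtain ⟨β, j⟩ := b
  obtain ⟨γ, k⟩ := e
  rw [bgGam_eq]
  simp only [Pi.add_apply, Pi.smul_apply, smul_eq_mul]
  by_cases h : β = 0
  · subst h
    by_cases h' : γ = 0
    · subst h'
      fin_cases j <;> fin_cases k <;>
        simp [blockGam, blockD, tabF, tabG, crdF, crdG, lorF, lorG, ell, zet]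
    · simp [h', ell, zet]
  · simp [h, Ne.symm h, ell, zet]

theorem ip_kgtInv_zet (H : (Idx m → ℝ) → ℝ) (p X : Idx m → ℝ) :
    ip (kgtInv m lam H p) zet X
      = lam * p (iv m) * p (iz m) * X (iv m) - lam * p (iz m) ^ 2 / 2 * X (iz m) := by
  rw [kgtInv, ip_blk, Finset.sum_eq_single 0]
  · simp [ip, Fin.sum_univ_three, lorInv, zet]
    ring
  · intro α _ hα
    simp [ip, zet, hα]
  · simp

/-- The trace of a bilinear form. -/
def trF (W Q : Matrix (Idx m) (Idx m) ℝ) : ℝ := ∑ a, ∑ e, W a e * Q e a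

theorem ip_ellell (X Y : Idx m → ℝ) : ip ellell X Y = X (iu m) * Y (iu m) := by
  simp [ip, ellell, ell]

/-- The symmetric form `Ω` entering the curvature. -/
def Om (lam : ℝ) (H : (Idx m → ℝ) → ℝ) (p : Idx m → ℝ) : Matrix (Idx m) (Idx m) ℝ :=
  Matrix.of fun b d => if b = iu m ∨ d = iu m then 0 else preOm lam H p b d

namespace Admissible

variable {H : (Idx m → ℝ) → ℝ} {p : Idx m → ℝ}

theorem hess_symm (h : Admissible H p) (hlam : lam ≠ 0) (b c : Idx m) :
    hess (kgt m lam H) H b c p = hess (kgt m lam H) H c b p := by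
  rw [h.hess_eq hlam, h.hess_eq hlam, pd_comm h.contDiffAt_two, bgGam_symm]
  ring

/-- Because `∂_v H = 0`, only the symbols with an index `v` contribute; they combine `du` and `dz`,
and `du` pairs to zero with `dH`. Being proportional to `du`, this row of the Hessian is removed in
`Om`, which therefore annihilates `∂_v`. -/
theorem hess_iv (h : Admissible H p) (hlam : lam ≠ 0) (b : Idx m) :
    hess (kgt m lam H) H (iv m) b p = lam * p (iz m) / 2 * pd (iz m) H p * ell b := by
  have hz := h.chart.1
  rw [h.hess_eq hlam, h.pd_iv_pd, bgGam_iv_left, ip_add_left, ip_smul_left, ip_smul_left,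
    ip_kgtInv_ell, ip_kgtInv_zet, h.pd_iv]
  have : ell (iv m) = 0 := by simp [ell]
  rw [this]
  field_simp
  ring

theorem Om_iv_left (h : Admissible H p) (hlam : lam ≠ 0) (b : Idx m) : Om lam H p (iv m) b = 0 := by
  simp only [Om, preOm, Matrix.of_apply, h.hess_iv hlam, h.pd_iv]
  by_cases hb : b = iu m
  · simp [hb]
  · simp [ell, zet, hb]

theorem Om_iv_right (h : Admissible H p) (hlam : lam ≠ 0) (b : Idx m) : Om lam H p b (iv m) = 0 := by
  simp only [Om, preOm, Matrix.of_apply, h.hess_symm hlam b, h.hess_iv hlam, h.pd_iv]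
  by_cases hb : b = iu m
  · simp [hb]
  · simp [ell, zet, hb]

theorem Om_iu_left (b : Idx m) : Om lam H p (iu m) b = 0 := by simp [Om]

theorem Om_iu_right (b : Idx m) : Om lam H p b (iu m) = 0 := by simp [Om]

theorem riemann_kgt (h : Admissible H p) (hlam : lam ≠ 0) (I : Fin 4 → Idx m) :
    riemann (kgt m lam H) p I
      = bcurv (lam / 2) (kgt m lam H p) I + KN ellell (Om lam H p) I := by
  rw [h.riemann_kgt_pre hlam]
  congr 1
  -- The product of `du²` with a form having a factor `du` is zero, so deleting the `du` row and
  -- column of `preOm` changes nothing.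
  simp only [KN, ellell, Om, ell, Matrix.of_apply]
  by_cases h0 : I 0 = iu m <;> by_cases h1 : I 1 = iu m <;> by_cases h2 : I 2 = iu m <;>
    by_cases h3 : I 3 = iu m <;> simp [h0, h1, h2, h3]

theorem kgtInv_mul (h : Admissible H p) (hlam : lam ≠ 0) :
    kgtInv m lam H p * kgt m lam H p = 1 :=
  mul_eq_one_comm.mp (kgt_mul_kgtInv hlam H h.chart)

theorem ricci_eq (h : Admissible H p) (hlam : lam ≠ 0) (b d : Idx m) :
    ricci (kgt m lam H) b d p
      = ∑ a, ∑ e, kgtInv m lam H p a e * riemann (kgt m lam H) p ![e, b, a, d] := by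
  unfold ricci
  refine Finset.sum_congr rfl fun a _ => ?_
  have h1 : ∀ e, riemann (kgt m lam H) p ![e, b, a, d]
      = (kgt m lam H p).mulVec (fun f => riemannUp (kgt m lam H) f b a d p) e := fun e => rfl
  simp only [h1]
  change _ = (kgtInv m lam H p).mulVec _ a
  rw [Matrix.mulVec_mulVec, h.kgtInv_mul hlam, Matrix.one_mulVec]

/-- Each block has dimension three, and tracing constant curvature `K` gives the factor 3 - 1 = 2.
-/
theorem contract_bcurv (h : Admissible H p) (hlam : lam ≠ 0) (K : ℝ) (b d : Idx m) :
    ∑ a, ∑ e, kgtInv m lam H p a e * bcurv K (kgt m lam H p) ![e, b, a, d]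
      = 2 * K * kgt m lam H p b d := by
  by_cases hbd : b.1 = d.1
  swap
  · rw [Finset.sum_eq_zero]
    · simp [kgt, hbd]
    · refine fun a _ => Finset.sum_eq_zero fun e _ => ?_
      have : ¬ (e.1 = b.1 ∧ a.1 = e.1 ∧ d.1 = e.1) := fun h => hbd (h.1 ▸ h.2.2.symm)
      simp [bcurv, this]
  have hWG : ∀ a c, ∑ e, kgtInv m lam H p a e * kgt m lam H p e c = if a = c then 1 else 0 := by
    intro a c
    rw [← Matrix.mul_apply, h.kgtInv_mul hlam, Matrix.one_apply]
  have key : ∀ a e, kgtInv m lam H p a e * bcurv K (kgt m lam H p) ![e, b, a, d]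
      = (if a.1 = b.1 then K * kgt m lam H p b d else 0) *
          (kgtInv m lam H p a e * kgt m lam H p e a)
        - (if a.1 = b.1 then K * kgt m lam H p b a else 0) *
          (kgtInv m lam H p a e * kgt m lam H p e d) := by
    intro a e
    by_cases hae : a.1 = e.1
    · by_cases hab : a.1 = b.1
      · have h1 : e.1 = b.1 ∧ a.1 = e.1 ∧ d.1 = e.1 :=
          ⟨hae.symm.trans hab, hae, hbd.symm.trans (hab.symm.trans hae)⟩
        simp only [bcurv, Matrix.cons_val, hab, if_true]
        rw [if_pos ⟨hae.symm.trans hab, hab.symm.trans hae, hbd.symm.trans (hab.symm.trans hae)⟩]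
        ring
      · have h1 : ¬ (e.1 = b.1 ∧ a.1 = e.1 ∧ d.1 = e.1) := fun h => hab (hae.trans h.1)
        simp only [bcurv, Matrix.cons_val, hab, h1, if_false]
        ring
    · simp [kgtInv, blk, hae]
  simp only [key, Finset.sum_sub_distrib, ← Finset.mul_sum, hWG]
  have h3 : ∑ a : Idx m, (if a.1 = b.1 then K * kgt m lam H p b d else 0)
      = 3 * (K * kgt m lam H p b d) := by
    rw [Fintype.sum_prod_type, Finset.sum_comm]
    simp [← mul_assoc]
  simp only [if_true, mul_one]
  rw [h3]
  simp [hbd]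
  ring

theorem contract_KN (W P Q : Matrix (Idx m) (Idx m) ℝ) (b d : Idx m) :
    ∑ a, ∑ e, W a e * KN P Q ![e, b, a, d]
      = trF W P * Q b d - ∑ a, ∑ e, W a e * (P e d * Q b a)
        - ∑ a, ∑ e, W a e * (P b a * Q e d) + P b d * trF W Q := by
  simp only [trF, Finset.sum_mul, Finset.mul_sum, ← Finset.sum_sub_distrib,
    ← Finset.sum_add_distrib]
  refine Finset.sum_congr rfl fun a _ => Finset.sum_congr rfl fun e _ => ?_
  simp only [KN, Matrix.cons_val]
  ring

/-- Of the four traces of the null part, that of `du²` vanishes as `du` is null, and the two mixed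
ones vanish as `Om` annihilates `∂_v`. -/
theorem ricci_kgt (h : Admissible H p) (hlam : lam ≠ 0) (b d : Idx m) :
    ricci (kgt m lam H) b d p = lam * kgt m lam H p b d
      + trF (kgtInv m lam H p) (Om lam H p) * (ell b * ell d) := by
  have h1 : trF (kgtInv m lam H p) ellell = 0 := by
    have := ip_kgtInv_ell (lam := lam) H p ell
    simp only [ip, ell] at this
    rw [trF]
    simpa [ellell, ell] using this
  have h2 : ∀ X : Idx m → ℝ, X (iv m) = 0 → ∑ a, ∑ e, kgtInv m lam H p a e * (ell a * X e) = 0 := by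
    intro X hX
    rw [← hX, ← ip_kgtInv_ell (lam := lam) H p X]
    simp only [ip, mul_assoc]
  have h3 : ∀ X : Idx m → ℝ, X (iv m) = 0 → ∑ a, ∑ e, kgtInv m lam H p a e * (X a * ell e) = 0 := by
    intro X hX
    rw [← hX, ← ip_kgtInv_ell (lam := lam) H p X, ip_kgtInv_comm]
    simp only [ip, mul_assoc]
  have h4 : ∑ a, ∑ e, kgtInv m lam H p a e * (ellell e d * Om lam H p b a) = 0 := by
    have := h3 (fun a => ell d * Om lam H p b a) (by simp [h.Om_iv_right hlam])
    rw [← this]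
    exact Finset.sum_congr rfl fun _ _ => Finset.sum_congr rfl fun _ _ => by
      simp only [ellell, Matrix.of_apply]; ring
  have h5 : ∑ a, ∑ e, kgtInv m lam H p a e * (ellell b a * Om lam H p e d) = 0 := by
    have := h2 (fun e => ell b * Om lam H p e d) (by simp [h.Om_iv_left hlam])
    rw [← this]
    exact Finset.sum_congr rfl fun _ _ => Finset.sum_congr rfl fun _ _ => by
      simp only [ellell, Matrix.of_apply]; ring
  rw [h.ricci_eq hlam]
  simp only [h.riemann_kgt hlam, mul_add, Finset.sum_add_distrib]
  rw [h.contract_bcurv hlam, contract_KN, h1, h4, h5]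
  simp only [ellell, Matrix.of_apply]
  ring

theorem scalarCurv_kgt (h : Admissible H p) (hlam : lam ≠ 0) :
    scalarCurv (kgt m lam H) p = lam * Fintype.card (Idx m) := by
  have h1 : ∑ a, ∑ b, kgtInv m lam H p a b * kgt m lam H p a b = Fintype.card (Idx m) := by
    have : ∀ a, ∑ b, kgtInv m lam H p a b * kgt m lam H p a b = 1 := by
      intro a
      simp_rw [kgt_symm H p a]
      rw [← Matrix.mul_apply, h.kgtInv_mul hlam, Matrix.one_apply_eq]
    simp [this]
  have h2 : ∑ a, ∑ b, kgtInv m lam H p a b * (ell a * ell b) = 0 := by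
    have := ip_kgtInv_ell (lam := lam) H p ell
    simp only [ip, mul_assoc] at this
    rw [this]; simp [ell]
  unfold scalarCurv
  rw [inv_kgt hlam H h.chart, ← h1]
  simp only [h.ricci_kgt hlam, mul_add, Finset.sum_add_distrib, mul_left_comm _ lam,
    mul_left_comm _ (trF _ _), ← Finset.mul_sum, h2]
  ring

theorem weyl_kgt (hm : 1 ≤ m) (h : Admissible H p) (hlam : lam ≠ 0) (I : Fin 4 → Idx m) :
    weyl (kgt m lam H) p I = bcurv (lam / 2) (kgt m lam H p) I + KN ellell (Om lam H p) I
      - (trF (kgtInv m lam H p) (Om lam H p) / ((Fintype.card (Idx m) : ℝ) - 2)) *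
        KN (kgt m lam H p) ellell I
      - (lam / (2 * ((Fintype.card (Idx m) : ℝ) - 1))) * KN (kgt m lam H p) (kgt m lam H p) I := by
  have hc : (Fintype.card (Idx m) : ℝ) = 3 * m + 3 := by simp; ring
  have hm' : (1 : ℝ) ≤ m := by exact_mod_cast hm
  have h1 : (Fintype.card (Idx m) : ℝ) - 1 ≠ 0 := by rw [hc]; linarith
  have h2 : (Fintype.card (Idx m) : ℝ) - 2 ≠ 0 := by rw [hc]; linarith
  simp only [weyl, h.riemann_kgt hlam, h.ricci_kgt hlam, h.scalarCurv_kgt hlam]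
  generalize (Fintype.card (Idx m) : ℝ) = N at *
  simp only [KN, ellell, Matrix.of_apply]
  field_simp
  ring

theorem trF_eq (Q : Matrix (Idx m) (Idx m) ℝ) :
    trF (kgtInv m lam H p) Q
      = ∑ α, ∑ i, ∑ j, kgtInv m lam H p (α, i) (α, j) * Q (α, j) (α, i) := by
  rw [trF, Fintype.sum_prod_type]
  refine Finset.sum_congr rfl fun α _ => Finset.sum_congr rfl fun i _ => ?_
  rw [kgtInv, sum_blk_mul]
  simp [blk]

/-- The part of the trace of `Ω` belonging to block `0`. -/
def tr0 (lam : ℝ) (H : (Idx m → ℝ) → ℝ) (p : Idx m → ℝ) : ℝ :=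
  -lam * p (iz m) ^ 2 / 2 * Om lam H p (iz m) (iz m)

theorem trF_Om (h : Admissible H p) (hlam : lam ≠ 0) :
    trF (kgtInv m lam H p) (Om lam H p) = tr0 lam H p
      - 1 / 2 * ∑ α ∈ Finset.univ.erase (0 : Fin (m + 1)), blockBox (kgt m lam H) α H p := by
  rw [trF_eq, ← Finset.add_sum_erase _ _ (Finset.mem_univ (0 : Fin (m + 1))), sub_eq_add_neg,
    Finset.mul_sum, ← Finset.sum_neg_distrib]
  congr 1
  · have h1 := h.Om_iv_left hlam
    have h2 := h.Om_iv_right hlam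
    have h3 := Om_iu_left (lam := lam) (H := H) (p := p)
    have h4 := Om_iu_right (lam := lam) (H := H) (p := p)
    simp only [Fin.sum_univ_three, h1, h2, h3, h4, tr0]
    simp [kgtInv, blk, lorInv]
  · refine Finset.sum_congr rfl fun α hα => ?_
    have hα : α ≠ 0 := Finset.ne_of_mem_erase hα
    simp only [blockBox, inv_kgt hlam H h.chart, Finset.mul_sum, ← Finset.sum_neg_distrib]
    refine Finset.sum_congr rfl fun i _ => Finset.sum_congr rfl fun j _ => ?_
    rw [h.hess_symm hlam]
    simp [Om, preOm, zet, hα]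
    ring

/-- The trace of `preOm` gives the wave operator and one term in `H_z`. Passing to `Om` removes the
(u,v) and (v,u) components, which by `hess_iv` supply the rest of that term. -/
theorem trF_Om_eq_box (h : Admissible H p) (hlam : lam ≠ 0) :
    trF (kgtInv m lam H p) (Om lam H p) = -(1 / 2) * (box (kgt m lam H) H p
      - 2 * lam * p (iz m) * pd (iz m) H p) := by
  have hz := h.chart.1
  have h1 : trF (kgtInv m lam H p) (preOm lam H p)
      = -(1 / 2) * (box (kgt m lam H) H p - lam * p (iz m) * pd (iz m) H p) := by
    have e1 : ip (kgtInv m lam H p) zet (fun e => pd e H p)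
        = - (lam * p (iz m) ^ 2 / 2) * pd (iz m) H p := by
      rw [ip_kgtInv_zet, h.pd_iv]; ring
    have e2 : ip (kgtInv m lam H p) (fun e => pd e H p) zet
        = - (lam * p (iz m) ^ 2 / 2) * pd (iz m) H p := by
      rw [ip_kgtInv_comm, e1]
    have e3 : trF (kgtInv m lam H p) (preOm lam H p) = -(1 / 2) * (box (kgt m lam H) H p
        + 1 / p (iz m) * (ip (kgtInv m lam H p) zet (fun e => pd e H p)
          + ip (kgtInv m lam H p) (fun e => pd e H p) zet)) := by
      simp only [box, ip, trF, inv_kgt hlam H h.chart, mul_add, Finset.mul_sum,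
        ← Finset.sum_add_distrib]
      refine Finset.sum_congr rfl fun a _ => Finset.sum_congr rfl fun e _ => ?_
      rw [h.hess_symm hlam a e]
      simp only [preOm, Matrix.of_apply]
      ring
    rw [e3, e1, e2]
    field_simp
    ring
  have h2 : trF (kgtInv m lam H p) (Om lam H p) = trF (kgtInv m lam H p) (preOm lam H p)
      - preOm lam H p (iu m) (iv m) - preOm lam H p (iv m) (iu m) := by
    rw [trF_eq, trF_eq, ← Finset.add_sum_erase _ _ (Finset.mem_univ (0 : Fin (m + 1))),
      ← Finset.add_sum_erase _ _ (Finset.mem_univ (0 : Fin (m + 1)))]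
    have e1 : ∑ α ∈ Finset.univ.erase (0 : Fin (m + 1)), ∑ i, ∑ j,
          kgtInv m lam H p (α, i) (α, j) * Om lam H p (α, j) (α, i)
        = ∑ α ∈ Finset.univ.erase (0 : Fin (m + 1)), ∑ i, ∑ j,
          kgtInv m lam H p (α, i) (α, j) * preOm lam H p (α, j) (α, i) := by
      refine Finset.sum_congr rfl fun α hα => ?_
      have hα : α ≠ 0 := Finset.ne_of_mem_erase hα
      simp [Om, hα]
    rw [e1]
    simp [Fin.sum_univ_three, kgtInv, blk, lorInv, Om]
    ring
  rw [h2, h1]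
  simp only [preOm, Matrix.of_apply, h.hess_symm hlam (iu m), h.hess_iv hlam, h.pd_iv]
  simp [ell, zet]
  ring

/-- Of the coefficient 3/z, one unit comes from the Christoffel symbols in the Hessian and two from
the `dz dH` terms. -/
theorem Om_iz_iz (h : Admissible H p) (hlam : lam ≠ 0) :
    Om lam H p (iz m) (iz m)
      = -(1 / 2) * (pd (iz m) (pd (iz m) H) p + 3 / p (iz m) * pd (iz m) H p) := by
  have hz := h.chart.1
  have e1 : bgGam lam p (iz m) (iz m) = (-2 * p (iv m) / p (iz m) ^ 2) • ell
      + (2 / (lam * p (iz m) ^ 3)) • zet := by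
    funext e
    obtain ⟨γ, k⟩ := e
    rw [bgGam_eq]
    simp only [Pi.add_apply, Pi.smul_apply, smul_eq_mul]
    by_cases h' : γ = 0
    · subst h'
      fin_cases k <;>
        simp [blockGam, blockD, tabF, tabG, crdF, crdG, lorF, lorG, ell, zet] <;>
        field_simp ; ring
    · simp [h', ell, zet]
  have : Om lam H p (iz m) (iz m) = preOm lam H p (iz m) (iz m) := by simp [Om]
  rw [this]
  simp only [preOm, Matrix.of_apply, h.hess_eq hlam]
  rw [e1, ip_add_left, ip_smul_left, ip_smul_left, ip_kgtInv_ell, ip_kgtInv_zet, h.pd_iv]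
  simp [ell, zet]
  field_simp
  ring

end Admissible

end Ricci

/-! ### Algebraic type of the Weyl tensor and non-recurrence of `∂_v` -/

section Algebraic

variable {m : ℕ} {lam : ℝ}

/-- Quadruples of indices. -/
def finFourEquiv (ι : Type) : (Fin 4 → ι) ≃ ι × ι × ι × ι where
  toFun I := (I 0, I 1, I 2, I 3)
  invFun x := ![x.1, x.2.1, x.2.2.1, x.2.2.2]
  left_inv I := by ext i; fin_cases i <;> rfl
  right_inv x := rfl

theorem sum_fin_four {ι R : Type} [Fintype ι] [AddCommMonoid R] (f : (Fin 4 → ι) → R) :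
    ∑ I, f I = ∑ a, ∑ b, ∑ c, ∑ d, f ![a, b, c, d] := by
  rw [← (finFourEquiv ι).symm.sum_comp f, Fintype.sum_prod_type]
  simp only [Fintype.sum_prod_type]
  rfl

theorem evalT_four {ι : Type} [Fintype ι] (T : (Fin 4 → ι) → ℝ) (X : Fin 4 → ι → ℝ) :
    evalT T X = ∑ a, ∑ b, ∑ c, ∑ d, T ![a, b, c, d] * (X 0 a * X 1 b * X 2 c * X 3 d) := by
  rw [evalT, sum_fin_four]
  simp [Fin.prod_univ_four]

/-- The value of a bilinear form. -/
def bil {ι R : Type} [Fintype ι] [CommRing R] (P : Matrix ι ι R) (X Y : ι → R) : R :=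
  ∑ a, ∑ b, P a b * X a * Y b

theorem sum_KN_mul_prod {ι R : Type} [Fintype ι] [CommRing R] (P Q : Matrix ι ι R)
    (X : Fin 4 → ι → R) : ∑ I, KN P Q I * ∏ j, X j (I j)
      = bil P (X 0) (X 2) * bil Q (X 1) (X 3) - bil P (X 0) (X 3) * bil Q (X 1) (X 2)
        - bil P (X 1) (X 2) * bil Q (X 0) (X 3) + bil P (X 1) (X 3) * bil Q (X 0) (X 2) := by
  have h1 : bil P (X 0) (X 2) * bil Q (X 1) (X 3) = ∑ a, ∑ b, ∑ c, ∑ d,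
      P a c * Q b d * (X 0 a * X 1 b * X 2 c * X 3 d) := by
    rw [bil, bil, Finset.sum_mul_sum]
    refine Finset.sum_congr rfl fun a _ => Finset.sum_congr rfl fun b _ => ?_
    rw [Finset.sum_mul_sum]
    exact Finset.sum_congr rfl fun c _ => Finset.sum_congr rfl fun d _ => by ring
  have h2 : bil P (X 0) (X 3) * bil Q (X 1) (X 2) = ∑ a, ∑ b, ∑ c, ∑ d,
      P a d * Q b c * (X 0 a * X 1 b * X 2 c * X 3 d) := by
    rw [bil, bil, Finset.sum_mul_sum]
    refine Finset.sum_congr rfl fun a _ => Finset.sum_congr rfl fun b _ => ?_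
    rw [Finset.sum_mul_sum, Finset.sum_comm]
    exact Finset.sum_congr rfl fun c _ => Finset.sum_congr rfl fun d _ => by ring
  have h3 : bil P (X 1) (X 2) * bil Q (X 0) (X 3) = ∑ a, ∑ b, ∑ c, ∑ d,
      P b c * Q a d * (X 0 a * X 1 b * X 2 c * X 3 d) := by
    rw [mul_comm, bil, bil, Finset.sum_mul_sum]
    refine Finset.sum_congr rfl fun a _ => Finset.sum_congr rfl fun b _ => ?_
    rw [Finset.sum_mul_sum, Finset.sum_comm]
    exact Finset.sum_congr rfl fun c _ => Finset.sum_congr rfl fun d _ => by ring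
  have h4 : bil P (X 1) (X 3) * bil Q (X 0) (X 2) = ∑ a, ∑ b, ∑ c, ∑ d,
      P b d * Q a c * (X 0 a * X 1 b * X 2 c * X 3 d) := by
    rw [mul_comm, bil, bil, Finset.sum_mul_sum]
    refine Finset.sum_congr rfl fun a _ => Finset.sum_congr rfl fun b _ => ?_
    rw [Finset.sum_mul_sum]
    exact Finset.sum_congr rfl fun c _ => Finset.sum_congr rfl fun d _ => by ring
  rw [sum_fin_four, h1, h2, h3, h4]
  simp only [← Finset.sum_sub_distrib, ← Finset.sum_add_distrib, Fin.prod_univ_four]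
  refine Finset.sum_congr rfl fun a _ => Finset.sum_congr rfl fun b _ =>
      Finset.sum_congr rfl fun c _ => Finset.sum_congr rfl fun d _ => ?_
  simp only [KN, Matrix.cons_val]
  ring

theorem evalT_KN {ι : Type} [Fintype ι] (P Q : Matrix ι ι ℝ) (X : Fin 4 → ι → ℝ) :
    evalT (KN P Q) X = ip P (X 0) (X 2) * ip Q (X 1) (X 3) - ip P (X 0) (X 3) * ip Q (X 1) (X 2)
      - ip P (X 1) (X 2) * ip Q (X 0) (X 3) + ip P (X 1) (X 3) * ip Q (X 0) (X 2) :=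
  sum_KN_mul_prod P Q X

/-- The part of a bilinear form belonging to block `α`. -/
def maskBlock (α : Fin (m + 1)) (G : Matrix (Idx m) (Idx m) ℝ) : Matrix (Idx m) (Idx m) ℝ :=
  Matrix.of fun a c => if a.1 = α ∧ c.1 = α then G a c else 0

/-- This brings the block curvature into the form to which `evalT_KN` applies; the factor 1/2
compensates that `KN P P` counts each term twice. -/
theorem bcurv_eq_sum (K : ℝ) (G : Matrix (Idx m) (Idx m) ℝ) (I : Fin 4 → Idx m) :
    bcurv K G I = ∑ α, K / 2 * KN (maskBlock α G) (maskBlock α G) I := by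
  rw [Finset.sum_eq_single (I 0).1]
  · simp only [bcurv, KN, maskBlock, Matrix.of_apply]
    by_cases h1 : (I 1).1 = (I 0).1 <;> by_cases h2 : (I 2).1 = (I 0).1 <;>
      by_cases h3 : (I 3).1 = (I 0).1 <;>
      simp [h1, h2, h3, eq_comm (a := (I 0).1) (b := (I 1).1)]
    ring
  · intro α _ hα
    simp [KN, maskBlock, Ne.symm hα]
  · simp

theorem evalT_lin {ι : Type} [Fintype ι] {r : ℕ} {κ : Type} (s : Finset κ) (c : κ → ℝ)
    (T : κ → (Fin r → ι) → ℝ) (X : Fin r → ι → ℝ) :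
    evalT (fun I => ∑ k ∈ s, c k * T k I) X = ∑ k ∈ s, c k * evalT (T k) X := by
  simp only [evalT, Finset.mul_sum, Finset.sum_mul]
  rw [Finset.sum_comm]
  exact Finset.sum_congr rfl fun _ _ => Finset.sum_congr rfl fun _ _ => by ring

theorem evalT_weyl (hm : 1 ≤ m) {H : (Idx m → ℝ) → ℝ} {p : Idx m → ℝ} (h : Admissible H p)
    (hlam : lam ≠ 0) (X : Fin 4 → Idx m → ℝ) :
    evalT (weyl (kgt m lam H) p) X
      = ∑ α, lam / 2 / 2 * evalT (KN (maskBlock α (kgt m lam H p)) (maskBlock α (kgt m lam H p))) X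
      + evalT (KN ellell (Om lam H p)) X
      - (trF (kgtInv m lam H p) (Om lam H p) / ((Fintype.card (Idx m) : ℝ) - 2)) *
        evalT (KN (kgt m lam H p) ellell) X
      - (lam / (2 * ((Fintype.card (Idx m) : ℝ) - 1))) *
        evalT (KN (kgt m lam H p) (kgt m lam H p)) X := by
  rw [← evalT_lin]
  simp only [evalT, h.weyl_kgt hm hlam, bcurv_eq_sum, Finset.mul_sum, ← Finset.sum_add_distrib,
    ← Finset.sum_sub_distrib]
  exact Finset.sum_congr rfl fun I _ => by ring

/-! ### The multiple Weyl aligned null direction -/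

theorem ip_dv {P : Matrix (Idx m) (Idx m) ℝ} (hP : ∀ b, b ≠ iu m → P (iv m) b = 0)
    (p Y : Idx m → ℝ) : ip P (dv m p) Y = P (iv m) (iu m) * Y (iu m) := by
  simp only [ip, dv]
  rw [Finset.sum_eq_single (iv m), Finset.sum_eq_single (iu m)]
  · simp
  · intro b _ hb; simp [hP b hb]
  · simp
  · intro a _ ha; simp [ha]
  · simp

theorem ip_dv_right {P : Matrix (Idx m) (Idx m) ℝ} (hP : ∀ b, b ≠ iu m → P b (iv m) = 0)
    (p Y : Idx m → ℝ) : ip P Y (dv m p) = P (iu m) (iv m) * Y (iu m) := by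
  simp only [ip, dv]
  rw [Finset.sum_eq_single (iu m), Finset.sum_eq_single (iv m)]
  · simp
  · intro a _ ha; simp [ha]
  · simp
  · intro b _ hb
    rw [Finset.sum_eq_zero]; intro a _
    by_cases ha : a = iv m
    · simp [ha, hP b hb]
    · simp [ha]
  · simp

theorem kgt_iv (H : (Idx m → ℝ) → ℝ) (p : Idx m → ℝ) (b : Idx m) (hb : b ≠ iu m) :
    kgt m lam H p (iv m) b = 0 := by
  obtain ⟨β, j⟩ := b
  by_cases h : β = 0
  · subst h
    fin_cases j <;> simp [kgt, lorentzBlock] at hb ⊢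
  · simp [kgt, Ne.symm h]

theorem kgt_iv_iu (H : (Idx m → ℝ) → ℝ) (p : Idx m → ℝ) : kgt m lam H p (iv m) (iu m) = 1 := by
  simp [kgt, lorentzBlock]

/-- A bilinear form whose components along `∂_v` vanish, except for those with `∂_u`. -/
def LowOrder (P : Matrix (Idx m) (Idx m) ℝ) : Prop :=
  (∀ b, b ≠ iu m → P (iv m) b = 0) ∧ ∀ b, b ≠ iu m → P b (iv m) = 0

/-- In each product of two pairings the four weights are shared out, so a positive total forces one
pair to have positive weight. That pair consists of `∂_v` and a vector without `u`-component (a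
weight-0 vector is orthogonal to `∂_v`), and a form of low order vanishes on it. -/
theorem evalT_KN_eq_zero {P Q : Matrix (Idx m) (Idx m) ℝ} (hP : LowOrder P) (hQ : LowOrder Q)
    {H : (Idx m → ℝ) → ℝ} {p n : Idx m → ℝ} {w : Fin 4 → SignType} {X : Fin 4 → Idx m → ℝ}
    (hX : ∀ j, HasWeight (kgt m lam H p) (dv m p) n (w j) (X j)) (hw : 0 < ∑ j, (w j : ℤ)) :
    evalT (KN P Q) X = 0 := by
  have hz : ∀ j, w j = SignType.zero → X j (iu m) = 0 := by
    intro j hj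
    have := hX j
    rw [hj] at this
    have h1 := this.1
    rw [ip_dv_right fun b hb => by rw [kgt_symm, kgt_iv H p b hb], kgt_symm, kgt_iv_iu] at h1
    simpa using h1
  have hp : ∀ j, w j = SignType.pos → X j = dv m p := by
    intro j hj
    have := hX j
    rwa [hj] at this
  have hpu : ∀ j, w j = SignType.pos → X j (iu m) = 0 := by
    intro j hj; rw [hp j hj]; simp [dv]
  have key : ∀ R : Matrix (Idx m) (Idx m) ℝ, LowOrder R → ∀ i j, (0 : ℤ) < w i + w j →
      ip R (X i) (X j) = 0 := by
    intro R hR i j hij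
    rcases hi : w i with _ | _ | _ <;> rcases hj : w j with _ | _ | _ <;> rw [hi, hj] at hij
    all_goals first
      | (exfalso; revert hij; decide)
      | (rw [hp i hi, ip_dv hR.1, hpu j hj, mul_zero])
      | (rw [hp i hi, ip_dv hR.1, hz j hj, mul_zero])
      | (rw [hp j hj, ip_dv_right hR.2, hz i hi, mul_zero])
  rw [Fin.sum_univ_four] at hw
  have h1 : ∀ i j k l, (0 : ℤ) < w i + w j + (w k + w l) → ip P (X i) (X j) * ip Q (X k) (X l) = 0 := by
    intro i j k l h
    by_cases hij : (0 : ℤ) < w i + w j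
    · rw [key P hP i j hij, zero_mul]
    · rw [key Q hQ k l (by omega), mul_zero]
  rw [evalT_KN, h1 0 2 1 3 (by omega), h1 0 3 1 2 (by omega), h1 1 2 0 3 (by omega),
    h1 1 3 0 2 (by omega)]
  simp

theorem isMWAND_dv (hm : 1 ≤ m) {H : (Idx m → ℝ) → ℝ} {p : Idx m → ℝ} (h : Admissible H p)
    (hlam : lam ≠ 0) : IsMWAND (kgt m lam H) p (dv m p) := by
  have hg : LowOrder (kgt m lam H p) :=
    ⟨fun b hb => kgt_iv H p b hb, fun b hb => by rw [kgt_symm, kgt_iv H p b hb]⟩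
  have hell : LowOrder (ellell (m := m)) := by
    constructor <;> intro b _ <;> simp [ellell, ell]
  have hOm : LowOrder (Om lam H p) :=
    ⟨fun b _ => h.Om_iv_left hlam b, fun b _ => h.Om_iv_right hlam b⟩
  have hmask : ∀ α, LowOrder (maskBlock α (kgt m lam H p)) := by
    intro α
    constructor <;> intro b hb <;> simp [maskBlock, hg.1 b hb, hg.2 b hb]
  refine ⟨⟨fun h0 => ?_, ?_⟩, ?_⟩
  · have := congrFun h0 (iv m); simp [dv] at this
  · rw [ip_dv hg.1]; simp [dv]
  · intro n _ _ w X hX hw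
    rw [evalT_weyl hm h hlam, evalT_KN_eq_zero hell hOm hX hw, evalT_KN_eq_zero hg hell hX hw,
      evalT_KN_eq_zero hg hg hX hw]
    simp only [evalT_KN_eq_zero (hmask _) (hmask _) hX hw]
    simp

/-! ### Exclusion of the types III, N and O -/

/-- `BoostOrderLE` quantifies over the partners `n` and would be vacuous without one. Nondegeneracy
gives `Y` with product 1 with `l`, and subtracting half of its square times `l` makes it null. -/
theorem exists_null_partner {ι : Type} [Fintype ι] [DecidableEq ι] {G : Matrix ι ι ℝ}
    (hs : ∀ a b, G a b = G b a) (hd : IsUnit G.det) {l : ι → ℝ} (hl : IsNull G l) :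
    ∃ n, ip G n n = 0 ∧ ip G l n = 1 := by
  have h1 : ∃ X, ip G l X ≠ 0 := by
    by_contra! hcon
    apply hl.1
    have h2 : Matrix.vecMul l G = 0 := by
      funext b
      have := hcon (Pi.single b 1)
      simp only [ip] at this
      rw [Finset.sum_congr rfl fun a _ => Finset.sum_eq_single b (by simp +contextual) (by simp)] at this
      simpa [Matrix.vecMul, dotProduct, mul_comm] using this
    have h3 : Matrix.vecMul (Matrix.vecMul l G) G⁻¹ = l := by
      rw [Matrix.vecMul_vecMul, Matrix.mul_nonsing_inv _ hd, Matrix.vecMul_one]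
    rw [← h3, h2, Matrix.zero_vecMul]
  obtain ⟨X, hX⟩ := h1
  obtain ⟨Y, hlY⟩ : ∃ Y, ip G l Y = 1 :=
    ⟨(ip G l X)⁻¹ • X, by rw [ip_smul_right, inv_mul_cancel₀ hX]⟩
  refine ⟨Y + (-(1 / 2) * ip G Y Y) • l, ?_, ?_⟩
  · rw [ip_add_left, ip_add_right, ip_add_right, ip_smul_left, ip_smul_left, ip_smul_right,
      ip_smul_right, hl.2, hlY, ip_comm_of_symm hs Y l, hlY]
    ring
  · rw [ip_add_right, ip_smul_right, hl.2, hlY]; ring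

/-- A vector orthogonal to `l` is a weight-0 vector plus a multiple of `l`. Expanding multilinearly
leaves sixteen components of boost weight ≥ 0, all zero. -/
theorem evalT_eq_zero_of_orthogonal {ι : Type} [Fintype ι] {G : Matrix ι ι ℝ}
    {T : (Fin 4 → ι) → ℝ} {l n : ι → ℝ} (hl : ip G l l = 0)
    (hn : ip G n n = 0) (hln : ip G l n = 1) (hT : BoostOrderLE G T l (-1)) {X Y : ι → ℝ}
    (hX : ip G X l = 0) (hY : ip G Y l = 0) : evalT T ![X, Y, X, Y] = 0 := by
  set A := X + (-ip G X n) • l with hA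
  set B := Y + (-ip G Y n) • l with hB
  have hAl : ip G A l = 0 := by rw [hA, ip_add_left, ip_smul_left, hX, hl]; ring
  have hBl : ip G B l = 0 := by rw [hB, ip_add_left, ip_smul_left, hY, hl]; ring
  have hAn : ip G A n = 0 := by rw [hA, ip_add_left, ip_smul_left, hln]; ring
  have hBn : ip G B n = 0 := by rw [hB, ip_add_left, ip_smul_left, hln]; ring
  have key : ∀ Z : Fin 4 → ι → ℝ, (∀ j, Z j = l ∨ (ip G (Z j) l = 0 ∧ ip G (Z j) n = 0)) →
      evalT T Z = 0 := by
    intro Z hZ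
    have : ∀ j, ∃ w : SignType, HasWeight G l n w (Z j) ∧ (0 : ℤ) ≤ w := by
      intro j
      rcases hZ j with h | h
      · exact ⟨SignType.pos, h, by decide⟩
      · exact ⟨SignType.zero, h, by decide⟩
    choose w hw hw0 using this
    exact hT n hn hln w Z hw (lt_of_lt_of_le (by norm_num) (Finset.sum_nonneg fun j _ => hw0 j))
  have hXA : X = A + (ip G X n) • l := by rw [hA]; simp
  have hYB : Y = B + (ip G Y n) • l := by rw [hB]; simp
  have hadd : ∀ (a b c d : ℝ), evalT T ![A + a • l, B + b • l, A + c • l, B + d • l]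
      = evalT T ![A, B, A, B] + a * evalT T ![l, B, A, B] + b * evalT T ![A, l, A, B]
      + c * evalT T ![A, B, l, B] + d * evalT T ![A, B, A, l]
      + a * b * evalT T ![l, l, A, B] + a * c * evalT T ![l, B, l, B]
      + a * d * evalT T ![l, B, A, l] + b * c * evalT T ![A, l, l, B]
      + b * d * evalT T ![A, l, A, l] + c * d * evalT T ![A, B, l, l]
      + a * b * c * evalT T ![l, l, l, B] + a * b * d * evalT T ![l, l, A, l]
      + a * c * d * evalT T ![l, B, l, l] + b * c * d * evalT T ![A, l, l, l]
      + a * b * c * d * evalT T ![l, l, l, l] := by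
    intro a b c d
    simp only [evalT_four, Finset.mul_sum, ← Finset.sum_add_distrib, Matrix.cons_val, Pi.add_apply,
      Pi.smul_apply, smul_eq_mul]
    refine Finset.sum_congr rfl fun _ _ => Finset.sum_congr rfl fun _ _ =>
      Finset.sum_congr rfl fun _ _ => Finset.sum_congr rfl fun _ _ => ?_
    ring
  have h4 : ∀ Z₀ Z₁ Z₂ Z₃ : ι → ℝ, (Z₀ = l ∨ (ip G Z₀ l = 0 ∧ ip G Z₀ n = 0)) →
      (Z₁ = l ∨ (ip G Z₁ l = 0 ∧ ip G Z₁ n = 0)) → (Z₂ = l ∨ (ip G Z₂ l = 0 ∧ ip G Z₂ n = 0)) →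
      (Z₃ = l ∨ (ip G Z₃ l = 0 ∧ ip G Z₃ n = 0)) → evalT T ![Z₀, Z₁, Z₂, Z₃] = 0 := by
    intro Z₀ Z₁ Z₂ Z₃ h0 h1 h2 h3
    refine key _ fun j => ?_
    fin_cases j
    · exact h0
    · exact h1
    · exact h2
    · exact h3
  have cA : A = l ∨ (ip G A l = 0 ∧ ip G A n = 0) := Or.inr ⟨hAl, hAn⟩
  have cB : B = l ∨ (ip G B l = 0 ∧ ip G B n = 0) := Or.inr ⟨hBl, hBn⟩
  rw [hXA, hYB, hadd]
  simp [h4, cA, cB]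

/-- The kernel of a linear form on a three-space has dimension at least two, and Gram determinants
of a positive definite form are nonzero on independent vectors. -/
theorem exists_plane (c d : Fin 3 → ℝ) (hd : ∀ i, 0 < d i) : ∃ X Y : Fin 3 → ℝ,
    ∑ i, c i * X i = 0 ∧ ∑ i, c i * Y i = 0 ∧
      (∑ i, d i * X i * X i) * (∑ i, d i * Y i * Y i) - (∑ i, d i * X i * Y i) ^ 2 ≠ 0 := by
  have h0 := hd 0
  have h1 := hd 1
  have h2 := hd 2
  by_cases hc2 : c 2 = 0
  · by_cases hc1 : c 1 = 0
    · refine ⟨![0, 1, 0], ![0, 0, 1], ?_, ?_, ?_⟩ <;> simp [Fin.sum_univ_three, hc1, hc2]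
      exact ⟨h1.ne', h2.ne'⟩
    · refine ⟨![c 1, -c 0, 0], ![0, 0, 1], ?_, ?_, ?_⟩ <;> simp [Fin.sum_univ_three, hc2]
      · ring
      · refine ⟨ne_of_gt ?_, h2.ne'⟩
        have : 0 < c 1 * c 1 := mul_self_pos.mpr hc1
        nlinarith [mul_pos h0 this, mul_nonneg h1.le (mul_self_nonneg (c 0))]
  · refine ⟨![c 2, 0, -c 0], ![0, c 2, -c 1], ?_, ?_, ?_⟩
    · simp [Fin.sum_univ_three]; ring
    · simp [Fin.sum_univ_three]; ring
    · simp only [Fin.sum_univ_three, Matrix.cons_val]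
      apply ne_of_gt
      have e : (d 0 * c 2 * c 2 + d 1 * 0 * 0 + d 2 * -c 0 * -c 0) *
          (d 0 * 0 * 0 + d 1 * c 2 * c 2 + d 2 * -c 1 * -c 1) -
          (d 0 * c 2 * 0 + d 1 * 0 * c 2 + d 2 * -c 0 * -c 1) ^ 2
        = c 2 ^ 2 * (d 0 * d 1 * c 2 ^ 2 + d 0 * d 2 * c 1 ^ 2 + d 1 * d 2 * c 0 ^ 2) := by ring
      rw [e]
      positivity

/-- The vector with the given components in block `α`. -/
def inBlock (α : Fin (m + 1)) (X : Fin 3 → ℝ) : Idx m → ℝ := fun a => if a.1 = α then X a.2 else 0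

theorem ip_inBlock (P : Matrix (Idx m) (Idx m) ℝ) (α : Fin (m + 1)) (X : Fin 3 → ℝ)
    (Y : Idx m → ℝ) : ip P (inBlock α X) Y = ∑ i, X i * ∑ b, P (α, i) b * Y b := by
  rw [ip, Fintype.sum_prod_type, Finset.sum_eq_single α]
  · simp only [inBlock, if_true, Finset.mul_sum]
    exact Finset.sum_congr rfl fun i _ => Finset.sum_congr rfl fun b _ => by ring
  · intro β _ hβ; simp [inBlock, hβ]
  · simp

theorem kgt_of_ne {α : Fin (m + 1)} (hα : α ≠ 0) (H : (Idx m → ℝ) → ℝ) (p : Idx m → ℝ) (i : Fin 3)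
    (b : Idx m) : kgt m lam H p (α, i) b
      = if b = (α, i) then hyperbolicBlock lam (p (α, 0)) (p (α, 1)) i i else 0 := by
  obtain ⟨β, j⟩ := b
  by_cases h : β = α
  · subst h
    fin_cases i <;> fin_cases j <;> simp [kgt, hα, hyperbolicBlock]
  · simp [kgt, h, Ne.symm h]

theorem hyperbolicBlock_pos (hlam : lam < 0) {p : Idx m → ℝ} (hp : p ∈ chart m) {α : Fin (m + 1)}
    (hα : α ≠ 0) (i : Fin 3) : 0 < hyperbolicBlock lam (p (α, 0)) (p (α, 1)) i i := by
  have h1 := (hp.2 α hα).1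
  have h2 := (hp.2 α hα).2
  have h3 : 0 < -2 / lam := div_pos_of_neg_of_neg (by norm_num) hlam
  fin_cases i <;> simp only [hyperbolicBlock, Fin.reduceFinMk, Fin.zero_eta, Fin.mk_one,
    Matrix.of_apply, Matrix.cons_val] <;> positivity

/-- For a null `l`, a plane orthogonal to `l` is chosen inside a positive definite hyperbolic block.
There the `du²` terms vanish, and the Weyl tensor has the value λ(1/2 - 1/(n-1)) times the Gram
determinant, with n = 3m + 3. -/
theorem isTypeII_kgt (hm : 1 ≤ m) {H : (Idx m → ℝ) → ℝ} {p : Idx m → ℝ} (h : Admissible H p)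
    (hlam : lam < 0) : IsTypeII (kgt m lam H) p := by
  refine ⟨⟨_, isMWAND_dv hm h hlam.ne⟩, fun l hl hT => ?_⟩
  obtain ⟨n, hn, hln⟩ := exists_null_partner (fun a b => kgt_symm H p a b)
    (isUnit_det_kgt hlam.ne H h.chart) hl
  obtain ⟨α, hα⟩ : ∃ α : Fin (m + 1), α ≠ 0 := ⟨Fin.last m, by
    intro h0; have := congrArg Fin.val h0; simp at this; omega⟩
  set D : Fin 3 → ℝ := fun i => hyperbolicBlock lam (p (α, 0)) (p (α, 1)) i i with hD
  have hg : ∀ (X : Fin 3 → ℝ) (Y : Idx m → ℝ), ip (kgt m lam H p) (inBlock α X) Y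
      = ∑ i, D i * X i * Y (α, i) := by
    intro X Y
    rw [ip_inBlock]
    refine Finset.sum_congr rfl fun i _ => ?_
    simp [kgt_of_ne hα, hD]
    ring
  obtain ⟨X, Y, hX, hY, hXY⟩ := exists_plane (fun i => D i * l (α, i)) D
    fun i => hyperbolicBlock_pos hlam h.chart hα i
  have h0 := evalT_eq_zero_of_orthogonal (X := inBlock α X) (Y := inBlock α Y) hl.2 hn hln hT
    (by rw [hg, ← hX]; exact Finset.sum_congr rfl fun i _ => by ring)
    (by rw [hg, ← hY]; exact Finset.sum_congr rfl fun i _ => by ring)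
  have hell : ∀ X Y, ip ellell (inBlock α X) Y = 0 := by
    intro X Y; rw [ip_ellell]; simp [inBlock, Ne.symm hα]
  have hmask : ∀ β X Y, ip (maskBlock β (kgt m lam H p)) (inBlock α X) (inBlock α Y)
      = if β = α then ∑ i, D i * X i * Y i else 0 := by
    intro β X Y
    rw [ip_inBlock]
    by_cases hβ : β = α
    · subst hβ
      simp only [if_true]
      refine Finset.sum_congr rfl fun i _ => ?_
      rw [Finset.sum_eq_single (β, i)]
      · simp [maskBlock, inBlock, kgt_of_ne hα, hD]; ring
      · intro b _ hb; simp [maskBlock, kgt_of_ne hα, hb]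
      · simp
    · simp [maskBlock, hβ, Ne.symm hβ]
  have hgg : ∀ X Y, ip (kgt m lam H p) (inBlock α X) (inBlock α Y) = ∑ i, D i * X i * Y i := by
    intro X Y; rw [hg]; simp [inBlock]
  rw [evalT_weyl hm h hlam.ne] at h0
  simp only [evalT_KN, Matrix.cons_val, hell, hmask, hgg] at h0
  rw [Finset.sum_eq_single α (fun β _ hβ => by simp [hβ]) (by simp)] at h0
  have hc : (Fintype.card (Idx m) : ℝ) = 3 * m + 3 := by simp; ring
  have hm' : (1 : ℝ) ≤ m := by exact_mod_cast hm
  have hs : ∑ i, D i * Y i * X i = ∑ i, D i * X i * Y i := Finset.sum_congr rfl fun i _ => by ring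
  rw [hc, hs] at h0
  have h1 : lam * (1 / 2 - 1 / (3 * m + 2)) * ((∑ i, D i * X i * X i) * (∑ i, D i * Y i * Y i)
      - (∑ i, D i * X i * Y i) ^ 2) = 0 := by
    rw [← h0]
    have : (3 * m + 3 - 1 : ℝ) = 3 * m + 2 := by ring
    rw [this]
    have : (3 * m + 2 : ℝ) ≠ 0 := by linarith
    simp only [if_true]
    field_simp
    ring
  -- The coefficient is positive exactly because there is more than one block: it vanishes at `m =
  -- 0`.
  refine (mul_ne_zero (mul_ne_zero hlam.ne ?_) hXY) h1
  have : (3 * m + 2 : ℝ) ≠ 0 := by linarith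
  have h3 : (1 / 2 - 1 / (3 * m + 2) : ℝ) = 3 * m / (2 * (3 * m + 2)) := by field_simp; ring
  rw [h3]
  positivity

/-! ### Non-recurrence -/

/-- The row `u` of the inverse metric is `∂_v`, so raising to an upper `u` amounts to taking the
lower index `v`, where `H` does not contribute. -/
theorem christoffel_iu {H : (Idx m → ℝ) → ℝ} {p : Idx m → ℝ} (h : Admissible H p) (hlam : lam ≠ 0)
    (a b : Idx m) : christoffel (kgt m lam H) (iu m) a b p
      = -(1 / p (iz m)) * (ell a * zet b + zet a * ell b) := by
  have h1 := ip_kgtInv_ell (lam := lam) H p (gam (kgt m lam H) a b p)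
  have h0 : ell (iv m) = 0 := by simp [ell]
  have h2 : gam (kgt m lam H) a b p (iv m) = bgGam lam p a b (iv m) := by
    rw [h.gam_kgt]
    simp only [Pi.add_apply, Pi.smul_apply, smul_eq_mul, h.pd_iv, h0]
    ring
  rw [ip, Finset.sum_eq_single (iu m)] at h1
  · rw [christoffel_eq, inv_kgt hlam H h.chart, ← bgGam_iv (lam := lam), ← h2, ← h1]
    simp [ell]
  · intro c _ hc; simp [ell, hc]
  · simp

theorem flat_smul_dv (H f : (Idx m → ℝ) → ℝ) :
    flat (kgt m lam H) (fun q => f q • dv m q) = fun q I => f q * ell (I 0) := by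
  funext q I
  simp only [flat]
  rw [Finset.sum_eq_single (iv m)]
  · by_cases hI : I 0 = iu m
    · rw [hI, kgt_symm, kgt_iv_iu]; simp [dv, ell]
    · rw [kgt_symm, kgt_iv H q _ hI]; simp [ell, hI]
  · intro b _ hb; simp [dv, hb]
  · simp

theorem not_isRecurrentAt {H : (Idx m → ℝ) → ℝ} {p : Idx m → ℝ} (h : Admissible H p)
    (hlam : lam ≠ 0) {f : (Idx m → ℝ) → ℝ} (hf : f p ≠ 0) :
    ¬ IsRecurrentAt (kgt m lam H) (fun q => f q • dv m q) p := by
  rintro ⟨L, hL⟩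
  -- In this component no derivative of `f` occurs, since the covector has no `z`-component. The
  -- left side is f/z and the right side is zero.
  have h1 := hL (iz m) (iu m)
  rw [flat_smul_dv] at h1
  have e1 : Fin.init ![iz m, iu m] = ![iz m] := by funext i; fin_cases i; rfl
  have e2 : ![iz m, iu m] (Fin.last 1) = iu m := rfl
  simp only [nabla, e1, e2] at h1
  have hz := h.chart.1
  simp [ell, pd_const] at h1
  rw [christoffel_iu h hlam] at h1
  simp [ell, zet, hf, hz] at h1

end Algebraic

/-! ### Curvature polynomials as equivariant functions over ℂ -/

section Naturality

variable {ι : Type} [Fintype ι] [DecidableEq ι]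

/-- The action of a matrix on covariant tensors. -/
def act (A : Matrix ι ι ℂ) {r : ℕ} (T : (Fin r → ι) → ℂ) : (Fin r → ι) → ℂ :=
  fun I => ∑ J, T J * ∏ j, A (I j) (J j)

/-- Tensors of rank 2 as functions of a multi-index. -/
def matT (G : Matrix ι ι ℂ) : (Fin 2 → ι) → ℂ := fun I => G (I 0) (I 1)

theorem bil_rows (A P : Matrix ι ι ℂ) (i j : ι) : bil P (A i) (A j) = (A * P * A.transpose) i j := by
  simp only [bil, Matrix.mul_apply, Matrix.transpose_apply, Finset.sum_mul]
  rw [Finset.sum_comm]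
  exact Finset.sum_congr rfl fun _ _ => Finset.sum_congr rfl fun _ _ => by ring

theorem act_matT (A G : Matrix ι ι ℂ) : act A (matT G) = matT (A * G * A.transpose) := by
  funext I
  rw [matT, ← bil_rows, act, bil, ← (finTwoArrowEquiv ι).symm.sum_comp, Fintype.sum_prod_type]
  refine Finset.sum_congr rfl fun a _ => Finset.sum_congr rfl fun b _ => ?_
  simp [matT, Fin.prod_univ_two, mul_assoc]

theorem act_KN (A P Q : Matrix ι ι ℂ) :
    act A (KN P Q) = KN (A * P * A.transpose) (A * Q * A.transpose) := by
  funext I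
  simp only [act]
  rw [sum_KN_mul_prod P Q fun j => A (I j)]
  simp only [KN, bil_rows]

theorem act_add (A : Matrix ι ι ℂ) {r : ℕ} (S T : (Fin r → ι) → ℂ) :
    act A (S + T) = act A S + act A T := by
  funext I
  simp [act, add_mul, Finset.sum_add_distrib]

theorem act_smul (A : Matrix ι ι ℂ) {r : ℕ} (c : ℂ) (T : (Fin r → ι) → ℂ) :
    act A (c • T) = c • act A T := by
  funext I
  simp [act, Finset.mul_sum, mul_assoc]

theorem act_mul (A : Matrix ι ι ℂ) {r s : ℕ} (S : (Fin r → ι) → ℂ) (T : (Fin s → ι) → ℂ) :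
    act A (fun I : Fin (r + s) → ι =>
        S (fun i => I (Fin.castAdd s i)) * T (fun i => I (Fin.natAdd r i)))
      = fun I => act A S (fun i => I (Fin.castAdd s i)) * act A T (fun i => I (Fin.natAdd r i)) := by
  funext I
  simp only [act]
  rw [← (Fin.appendEquiv r s).sum_comp, Fintype.sum_prod_type, Finset.sum_mul_sum]
  refine Finset.sum_congr rfl fun J _ => Finset.sum_congr rfl fun K _ => ?_
  simp only [Fin.appendEquiv, Equiv.coe_fn_mk, Fin.prod_univ_add, Fin.append_left, Fin.append_right]
  ring

theorem act_perm (A : Matrix ι ι ℂ) {r : ℕ} (σ : Equiv.Perm (Fin r)) (T : (Fin r → ι) → ℂ) :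
    act A (fun I => T (fun i => I (σ i))) = fun I => act A T (fun i => I (σ i)) := by
  funext I
  simp only [act]
  rw [← (Equiv.arrowCongr σ (Equiv.refl ι)).sum_comp]
  refine Finset.sum_congr rfl fun J _ => ?_
  rw [← Equiv.prod_comp σ]
  simp

/-- Equivariance of contractions rests on Aᵀ (A G Aᵀ)⁻¹ A = G⁻¹. -/
theorem act_contract {A G : Matrix ι ι ℂ} (hA : IsUnit A.det) {r : ℕ} (T : (Fin (r + 2) → ι) → ℂ) :
    (fun I : Fin r → ι => ∑ a, ∑ b, (A * G * A.transpose)⁻¹ a b *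
        act A T (Fin.snoc (Fin.snoc I a : Fin (r + 1) → ι) b))
      = act A fun I => ∑ a, ∑ b, G⁻¹ a b * T (Fin.snoc (Fin.snoc I a : Fin (r + 1) → ι) b) := by
  funext I
  have hW : A.transpose * (A * G * A.transpose)⁻¹ * A = G⁻¹ := by
    rw [Matrix.mul_inv_rev, Matrix.mul_inv_rev, ← Matrix.mul_assoc, ← Matrix.mul_assoc,
      Matrix.mul_nonsing_inv _ (by rwa [Matrix.det_transpose]), Matrix.one_mul, Matrix.mul_assoc,
      Matrix.nonsing_inv_mul _ hA, Matrix.mul_one]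
  have hW' : ∀ c d, ∑ a, ∑ b, (A * G * A.transpose)⁻¹ a b * A a c * A b d = G⁻¹ c d := by
    intro c d
    rw [← hW]
    simp only [Matrix.mul_apply, Matrix.transpose_apply, Finset.sum_mul]
    rw [Finset.sum_comm]
    exact Finset.sum_congr rfl fun _ _ => Finset.sum_congr rfl fun _ _ => by ring
  have hs : ∀ {n : ℕ} (f : (Fin (n + 1) → ι) → ℂ), ∑ J, f J = ∑ J, ∑ c, f (Fin.snoc J c) := by
    intro n f
    rw [← (Fin.snocEquiv fun _ => ι).sum_comp, Fintype.sum_prod_type, Finset.sum_comm]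
    rfl
  simp only [act]
  have h1 : ∀ a b, ∑ J, T J * ∏ j, A ((Fin.snoc (Fin.snoc I a : Fin (r + 1) → ι) b : Fin (r + 2) → ι) j) (J j)
      = ∑ J, ∑ c, ∑ d, T (Fin.snoc (Fin.snoc J c : Fin (r + 1) → ι) d) * (∏ j, A (I j) (J j))
        * (A a c * A b d) := by
    intro a b
    rw [hs, hs]
    refine Finset.sum_congr rfl fun J _ => Finset.sum_congr rfl fun c _ =>
      Finset.sum_congr rfl fun d _ => ?_
    simp only [Fin.prod_univ_castSucc, Fin.snoc_castSucc, Fin.snoc_last]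
    ring
  simp only [h1, Finset.mul_sum]
  calc _ = ∑ J, ∑ c, ∑ d, ∑ a, ∑ b, (A * G * A.transpose)⁻¹ a b *
        (T (Fin.snoc (Fin.snoc J c : Fin (r + 1) → ι) d) * (∏ j, A (I j) (J j)) * (A a c * A b d)) := by
        rw [Finset.sum_congr rfl fun a _ => Finset.sum_comm, Finset.sum_comm]
        refine Finset.sum_congr rfl fun J _ => ?_
        rw [Finset.sum_congr rfl fun a _ => Finset.sum_comm, Finset.sum_comm]
        refine Finset.sum_congr rfl fun c _ => ?_
        rw [Finset.sum_congr rfl fun a _ => Finset.sum_comm, Finset.sum_comm]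
    _ = _ := by
        refine Finset.sum_congr rfl fun J _ => ?_
        rw [Finset.sum_mul]
        refine Finset.sum_congr rfl fun c _ => ?_
        rw [Finset.sum_mul]
        refine Finset.sum_congr rfl fun d _ => ?_
        rw [← hW']
        simp only [Finset.sum_mul]
        exact Finset.sum_congr rfl fun _ _ => Finset.sum_congr rfl fun _ _ => by ring

theorem map_inv_complex (M : Matrix ι ι ℝ) :
    (M⁻¹).map Complex.ofReal = (M.map Complex.ofReal)⁻¹ := by
  have h1 : M.map Complex.ofReal = Complex.ofRealHom.mapMatrix M := rfl
  have h2 : (M⁻¹).map Complex.ofReal = Complex.ofRealHom.mapMatrix M⁻¹ := rfl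
  rw [h1, h2, Matrix.inv_def, Matrix.inv_def, ← RingHom.map_det, ← RingHom.map_adjugate]
  ext a b
  simp

/-- A tensor-valued function of a metric and a curvature tensor at a point that is equivariant and
depends differentiably on the curvature. -/
structure IsNatural {r : ℕ} (F : Matrix ι ι ℂ → ((Fin 4 → ι) → ℂ) → (Fin r → ι) → ℂ) : Prop where
  equivariant : ∀ A G R, IsUnit A.det → F (A * G * A.transpose) (act A R) = act A (F G R)
  differentiable : ∀ G I, Differentiable ℂ fun R => F G R I

/-- Contractions of polynomials in the metric and the curvature are natural. -/
theorem CurvPoly.exists_natural {g : MetricField ι} {r : ℕ} {T : TField ι r}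
    (hT : CurvPoly g 0 r T) : ∃ F, IsNatural F ∧
      ∀ p I, F ((g p).map Complex.ofReal) (fun J => (riemann g p J : ℂ)) I = T p I := by
  induction hT with
  | metric =>
    exact ⟨fun G _ => matT G, ⟨fun A G R _ => (act_matT A G).symm, fun G I => by fun_prop⟩,
      fun p I => rfl⟩
  | curv j hj =>
    obtain rfl : j = 0 := by omega
    exact ⟨fun _ R => R, ⟨fun A G R _ => rfl, fun G I => by fun_prop⟩, fun p I => rfl⟩
  | add hS hT ihS ihT =>
    obtain ⟨F, hF, hF'⟩ := ihS
    obtain ⟨F₂, hF₂, hF₂'⟩ := ihT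
    refine ⟨fun G R => F G R + F₂ G R, ⟨fun A G R hA => ?_, fun G I => ?_⟩, fun p I => ?_⟩
    · rw [hF.1 A G R hA, hF₂.1 A G R hA, act_add]
    · exact (hF.2 G I).add (hF₂.2 G I)
    · simp [hF', hF₂']
  | smul c hT ih =>
    obtain ⟨F, hF, hF'⟩ := ih
    refine ⟨fun G R => (c : ℂ) • F G R, ⟨fun A G R hA => ?_, fun G I => ?_⟩, fun p I => ?_⟩
    · rw [hF.1 A G R hA, act_smul]
    · exact (hF.2 G I).const_smul _
    · simp [hF']
  | mul hS hT ihS ihT =>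
    obtain ⟨F, hF, hF'⟩ := ihS
    obtain ⟨F₂, hF₂, hF₂'⟩ := ihT
    refine ⟨fun G R I => F G R (fun i => I (Fin.castAdd _ i)) * F₂ G R (fun i => I (Fin.natAdd _ i)),
      ⟨fun A G R hA => ?_, fun G I => ?_⟩, fun p I => ?_⟩
    · rw [act_mul, hF.1 A G R hA, hF₂.1 A G R hA]
    · exact (hF.2 G _).mul (hF₂.2 G _)
    · simp [hF', hF₂']
  | perm σ hT ih =>
    obtain ⟨F, hF, hF'⟩ := ih
    refine ⟨fun G R I => F G R (fun i => I (σ i)), ⟨fun A G R hA => ?_, fun G I => ?_⟩,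
      fun p I => ?_⟩
    · rw [act_perm, hF.1 A G R hA]
    · exact hF.2 G _
    · simp [hF']
  | contract hT ih =>
    obtain ⟨F, hF, hF'⟩ := ih
    refine ⟨fun G R I => ∑ a, ∑ b, G⁻¹ a b * F G R (Fin.snoc (Fin.snoc I a) b),
      ⟨fun A G R hA => ?_, fun G I => ?_⟩, fun p I => ?_⟩
    · rw [← act_contract hA]
      simp only [hF.1 A G R hA]
    · exact Differentiable.fun_sum fun a _ => Differentiable.fun_sum fun b _ =>
        (hF.2 G _).const_mul _
    · simp only [hF', ← map_inv_complex, Matrix.map_apply]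
      push_cast
      rfl

/-- A function on a complex normed space that is homogeneous of degree one and differentiable at
the origin is linear. -/
theorem eq_fderiv_of_homogeneous {E : Type} [NormedAddCommGroup E] [NormedSpace ℂ E] {f : E → ℂ}
    (hf : DifferentiableAt ℂ f 0) (h : ∀ (s : ℂ) x, f (s • x) = s * f x) (x : E) :
    f x = fderiv ℂ f 0 x := by
  have h1 : HasLineDerivAt ℂ f (fderiv ℂ f 0 x) 0 x := hf.hasFDerivAt.hasLineDerivAt _
  have h2 : HasLineDerivAt ℂ f (f x) 0 x := by
    unfold HasLineDerivAt
    simp only [zero_add, h]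
    simpa using (hasDerivAt_id (0 : ℂ)).mul_const (f x)
  exact h2.unique h1

end Naturality

/-! ### Equivariant rank-2 tensors in the standard null frame -/

section Structure

variable {m : ℕ}

/-! ### Monomial matrices -/

/-- The monomial matrix with `e_{σ i} ↦ d i`. -/
def mono (d : Idx m → ℂ) (σ : Equiv.Perm (Idx m)) : Matrix (Idx m) (Idx m) ℂ :=
  Matrix.of fun i j => if σ i = j then d i else 0

theorem isUnit_det_mono {d : Idx m → ℂ} (hd : ∀ i, d i ≠ 0) (σ : Equiv.Perm (Idx m)) :
    IsUnit (mono d σ).det := by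
  refine Matrix.isUnit_det_of_right_inverse (B := mono (fun i => (d (σ.symm i))⁻¹) σ.symm) ?_
  ext i j
  rw [Matrix.mul_apply, Finset.sum_eq_single (σ i)]
  · simp [mono, Matrix.one_apply, hd]
  · intro k _ hk; simp [mono, hk.symm]
  · simp

theorem mono_sandwich (d : Idx m → ℂ) (σ : Equiv.Perm (Idx m)) (G : Matrix (Idx m) (Idx m) ℂ)
    (i j : Idx m) : (mono d σ * G * (mono d σ).transpose) i j = d i * d j * G (σ i) (σ j) := by
  simp [mono, Matrix.mul_apply]
  ring

theorem act_mono (d : Idx m → ℂ) (σ : Equiv.Perm (Idx m)) {r : ℕ} (T : (Fin r → Idx m) → ℂ)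
    (I : Fin r → Idx m) : act (mono d σ) T I = (∏ j, d (I j)) * T fun j => σ (I j) := by
  rw [act, Finset.sum_eq_single fun j => σ (I j)]
  · simp [mono, mul_comm]
  · intro J _ hJ
    obtain ⟨j, hj⟩ : ∃ j, J j ≠ σ (I j) := by
      by_contra! h; exact hJ (funext h)
    rw [Finset.prod_eq_zero (Finset.mem_univ j), mul_zero]
    simp [mono, hj.symm]
  · simp

/-- A matrix that maps blocks to blocks injectively preserves the condition that all four indices
lie in one block; inside a block the curvature is a Kulkarni–Nomizu square. -/
theorem act_bcurv {A : Matrix (Idx m) (Idx m) ℂ} {τ : Fin (m + 1) → Fin (m + 1)}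
    (hτ : Function.Injective τ) (hA : ∀ i j, A i j ≠ 0 → j.1 = τ i.1) (κ : ℂ)
    (G : Matrix (Idx m) (Idx m) ℂ) :
    act A (bcurv κ G) = bcurv κ (A * G * A.transpose) := by
  have hb : ∀ (G : Matrix (Idx m) (Idx m) ℂ) I, bcurv κ G I
      = if (I 0).1 = (I 1).1 ∧ (I 2).1 = (I 0).1 ∧ (I 3).1 = (I 0).1 then κ / 2 * KN G G I else 0 := by
    intro G I
    simp only [bcurv, KN]
    split_ifs <;> ring
  funext I
  have h1 : ∀ J, bcurv κ G J * ∏ j, A (I j) (J j)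
      = (if (I 0).1 = (I 1).1 ∧ (I 2).1 = (I 0).1 ∧ (I 3).1 = (I 0).1 then κ / 2 else 0) *
        (KN G G J * ∏ j, A (I j) (J j)) := by
    intro J
    by_cases h0 : ∏ j, A (I j) (J j) = 0
    · simp [h0]
    · have h2 : ∀ j, (J j).1 = τ (I j).1 := fun j =>
        hA _ _ (Finset.prod_ne_zero_iff.mp h0 j (Finset.mem_univ j))
      rw [hb]
      simp only [h2, hτ.eq_iff]
      split_ifs <;> ring
  rw [hb, ← act_KN]
  simp only [act, h1, ← Finset.mul_sum]
  split_ifs <;> simp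

/-! ### The standard frame -/

/-- The matrix of the metric in a null frame adapted to the blocks. -/
def eta (m : ℕ) : Matrix (Idx m) (Idx m) ℂ :=
  blk fun α => if α = 0 then !![0, 1, 0; 1, 0, 0; 0, 0, 1] else 1

/-- A complex block diagonal matrix that carries the unit matrix to `eta`. -/
def toNull (m : ℕ) : Matrix (Idx m) (Idx m) ℂ :=
  blk fun α => if α = 0 then !![1, Complex.I, 0; 1 / 2, -Complex.I / 2, 0; 0, 0, 1] else 1

theorem blk_transpose {R : Type} [Zero R] (A : Fin (m + 1) → Matrix (Fin 3) (Fin 3) R) :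
    (blk A).transpose = blk fun α => (A α).transpose := by
  ext i j
  simp only [blk, Matrix.transpose_apply, Matrix.of_apply]
  by_cases h : i.1 = j.1
  · simp [h]
  · simp [h, Ne.symm h]

theorem toNull_mul : toNull m * 1 * (toNull m).transpose = eta m := by
  rw [Matrix.mul_one, toNull, blk_transpose, blk_mul, eta]
  congr 1
  funext α
  by_cases hα : α = 0
  · simp only [hα, if_true]
    ext i j
    fin_cases i <;> fin_cases j <;> simp [Matrix.mul_apply, Fin.sum_univ_three] <;> ring_nf <;>
      simp <;> ring
  · simp [hα]

theorem eta_mul_eta : eta m * eta m = 1 := by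
  rw [eta, blk_mul, ← blk_one]
  congr 1
  funext α
  by_cases hα : α = 0
  · simp only [hα, if_true]
    ext i j
    fin_cases i <;> fin_cases j <;> simp [Matrix.mul_apply, Fin.sum_univ_three]
  · simp [hα]

theorem isUnit_det_toNull : IsUnit (toNull m).det := by
  have h : IsUnit (eta m).det := Matrix.isUnit_det_of_right_inverse eta_mul_eta
  rw [← toNull_mul, Matrix.mul_one, Matrix.det_mul] at h
  exact isUnit_of_mul_isUnit_left h

theorem blk_ne_zero {A : Fin (m + 1) → Matrix (Fin 3) (Fin 3) ℂ} (i j : Idx m)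
    (h : blk A i j ≠ 0) : j.1 = id i.1 := by
  by_contra hne
  exact h (by simp only [blk, Matrix.of_apply]; rw [if_neg fun h' => hne h'.symm])

variable {F : Matrix (Idx m) (Idx m) ℂ → ((Fin 4 → Idx m) → ℂ) → (Fin 2 → Idx m) → ℂ}

/-- The signed permutations respecting the blocks fix both arguments, hence the value. -/
theorem isotropic_one (hF : IsNatural F) (κ : ℂ) : ∃ K : ℂ, F 1 (bcurv κ 1) = K • matT 1 := by
  set X := F 1 (bcurv κ 1) with hX
  have key : ∀ (d : Idx m → ℂ) (σ : Equiv.Perm (Idx m)) (τ : Fin (m + 1) → Fin (m + 1)),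
      (∀ i, d i * d i = 1) → Function.Injective τ → (∀ i, (σ i).1 = τ i.1) → ∀ I,
      X I = (∏ j, d (I j)) * X fun j => σ (I j) := by
    intro d σ τ hd hτ hσ I
    have hd0 : ∀ i, d i ≠ 0 := fun i h => by simpa [h] using hd i
    have h1 : mono d σ * 1 * (mono d σ).transpose = 1 := by
      ext i j
      rw [mono_sandwich]
      by_cases h : i = j
      · subst h; simp [hd]
      · simp [h]
    have h2 := hF.equivariant (mono d σ) 1 (bcurv κ 1) (isUnit_det_mono hd0 σ)
    rw [act_bcurv hτ, h1] at h2
    · rw [← act_mono, hX, ← h2]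
    · intro i j hij
      have : σ i = j := by
        by_contra h; exact hij (by simp [mono, h])
      rw [← this, hσ]
  have hoff : ∀ i j, i ≠ j → X ![i, j] = 0 := by
    -- Flipping the sign of the single basis vector `i` negates this component.
    intro i j hij
    have := key (fun a => if a = i then -1 else 1) 1 id (fun a => by split_ifs <;> norm_num)
      Function.injective_id (fun _ => rfl) ![i, j]
    have e : (fun k => (1 : Equiv.Perm (Idx m)) (![i, j] k)) = ![i, j] := rfl
    rw [e] at this
    simp [Fin.prod_univ_two, hij.symm] at this
    linear_combination (1 / 2) * this
  have hdiag : ∀ i j, X ![i, i] = X ![j, j] := by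
    -- Swapping the two blocks and the two positions within blocks carries `i` to `j`.
    intro i j
    have := key (fun _ => 1) (Equiv.prodCongr (Equiv.swap i.1 j.1) (Equiv.swap i.2 j.2))
      (Equiv.swap i.1 j.1) (fun a => by norm_num) (Equiv.injective _) (fun _ => rfl) ![i, i]
    rw [this]
    simp only [Finset.prod_const_one, one_mul]
    congr 1
    funext k
    fin_cases k <;> exact Prod.ext (by simp) (by simp)
  refine ⟨X ![iu m, iu m], ?_⟩
  funext I
  have hI : I = ![I 0, I 1] := by funext k; fin_cases k <;> rfl
  by_cases h : I 0 = I 1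
  · rw [hI, ← h, hdiag (I 0) (iu m)]; simp [matT, Matrix.one_apply]
  · rw [hI, hoff _ _ h]; simp [matT, Matrix.one_apply, h]

/-- Over ℂ the signature plays no role: `toNull` carries the unit matrix to `eta` and preserves the
blocks. -/
theorem isotropic_eta (hF : IsNatural F) (κ : ℂ) :
    ∃ K : ℂ, F (eta m) (bcurv κ (eta m)) = K • matT (eta m) := by
  obtain ⟨K, hK⟩ := isotropic_one hF κ
  refine ⟨K, ?_⟩
  have hb := act_bcurv (A := toNull m) Function.injective_id blk_ne_zero κ 1
  rw [← toNull_mul, ← hb, hF.equivariant _ _ _ isUnit_det_toNull, hK, act_smul, act_matT]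

/-- The square of the null covector of the standard frame. -/
def nullSq (m : ℕ) : Matrix (Idx m) (Idx m) ℂ :=
  Matrix.of fun i j => if i = iu m ∧ j = iu m then 1 else 0

/-- The part of a bilinear form transversal to the null directions of the standard frame. -/
def mask (Ω : Idx m → Idx m → ℂ) : Matrix (Idx m) (Idx m) ℂ :=
  Matrix.of fun i j => if (i ≠ iu m ∧ i ≠ iv m) ∧ (j ≠ iu m ∧ j ≠ iv m) then Ω i j else 0

/-- The curvature tensor in the standard frame. -/
def stdCurv (κ : ℂ) (Ω : Idx m → Idx m → ℂ) : (Fin 4 → Idx m) → ℂ :=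
  bcurv κ (eta m) + KN (nullSq m) (mask Ω)

theorem stdCurv_zero (κ : ℂ) : stdCurv κ 0 = bcurv κ (eta m) := by
  funext I
  simp [stdCurv, KN, mask]

theorem differentiable_stdCurv (hF : IsNatural F) (κ : ℂ) (I : Fin 2 → Idx m) :
    Differentiable ℂ fun Ω => F (eta m) (stdCurv κ Ω) I := by
  have h1 : ∀ i j, Differentiable ℂ fun Ω : Idx m → Idx m → ℂ => mask Ω i j := by
    intro i j
    simp only [mask, Matrix.of_apply]
    split_ifs <;> fun_prop
  have h2 : Differentiable ℂ fun Ω : Idx m → Idx m → ℂ => stdCurv κ Ω := by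
    rw [differentiable_pi]
    intro J
    simp only [stdCurv, Pi.add_apply, KN]
    exact (differentiable_const _).add (((((h1 _ _).const_mul _).sub ((h1 _ _).const_mul _)).sub
      ((h1 _ _).const_mul _)).add ((h1 _ _).const_mul _))
  exact (hF.differentiable (eta m) I).comp h2

/-- The extra factor `d (iu m) ^ 2` is the scaling of the null square, moved onto `Ω`. -/
theorem act_stdCurv {d : Idx m → ℂ} {σ : Equiv.Perm (Idx m)} {τ : Fin (m + 1) → Fin (m + 1)}
    (hτ : Function.Injective τ) (hσ : ∀ i, (σ i).1 = τ i.1)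
    (he : mono d σ * eta m * (mono d σ).transpose = eta m) (hu : ∀ i, σ i = iu m ↔ i = iu m)
    (hv : ∀ i, σ i = iv m ↔ i = iv m) (κ : ℂ) (Ω : Idx m → Idx m → ℂ) :
    act (mono d σ) (stdCurv κ Ω)
      = stdCurv κ (fun i j => d (iu m) ^ 2 * (d i * d j * Ω (σ i) (σ j))) := by
  rw [stdCurv, act_add, act_bcurv hτ, he, act_KN, stdCurv]
  · congr 1
    funext I
    simp only [KN, mono_sandwich, mask, nullSq, Matrix.of_apply, hu, hv, ne_eq]
    have h1 : ∀ i j : Idx m, d i * d j * (if i = iu m ∧ j = iu m then 1 else 0)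
        = d (iu m) ^ 2 * if i = iu m ∧ j = iu m then 1 else 0 := by
      intro i j
      split_ifs with h
      · rw [h.1, h.2]; ring
      · ring
    have h2 : ∀ (i j : Idx m) (P : Prop) [Decidable P],
        (if P then d (iu m) ^ 2 * (d i * d j * Ω (σ i) (σ j)) else 0)
        = d (iu m) ^ 2 * (d i * d j * if P then Ω (σ i) (σ j) else 0) := by
      intro i j P _
      split_ifs <;> ring
    simp only [h1, h2]
    ring
  · intro i j hij
    have : σ i = j := by
      by_contra h; exact hij (by simp [mono, h])
    rw [← this, hσ]

/-- The invariance of the frame components under monomial changes of the standard frame. -/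
theorem natural_mono (hF : IsNatural F) {d : Idx m → ℂ} (hd : ∀ i, d i ≠ 0)
    {σ : Equiv.Perm (Idx m)} {τ : Fin (m + 1) → Fin (m + 1)}
    (hτ : Function.Injective τ) (hσ : ∀ i, (σ i).1 = τ i.1)
    (he : mono d σ * eta m * (mono d σ).transpose = eta m) (hu : ∀ i, σ i = iu m ↔ i = iu m)
    (hv : ∀ i, σ i = iv m ↔ i = iv m) (κ : ℂ) (Ω : Idx m → Idx m → ℂ) (i j : Idx m) :
    F (eta m) (stdCurv κ fun i j => d (iu m) ^ 2 * (d i * d j * Ω (σ i) (σ j))) ![i, j]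
      = d i * d j * F (eta m) (stdCurv κ Ω) ![σ i, σ j] := by
  have h := hF.equivariant (mono d σ) (eta m) (stdCurv κ Ω) (isUnit_det_mono hd σ)
  rw [he, act_stdCurv hτ hσ he hu hv] at h
  rw [h, act_mono, Fin.prod_univ_two]
  simp only [Matrix.cons_val]
  congr 2
  funext k
  fin_cases k <;> rfl

/-- The weights of a boost. -/
def boost (m : ℕ) (t : ℂ) (i : Idx m) : ℂ := if i = iu m then t else if i = iv m then t⁻¹ else 1

theorem mask_boost (t : ℂ) (Ω : Idx m → Idx m → ℂ) :
    mask (fun i j => t ^ 2 * (boost m t i * boost m t j * Ω i j)) = mask (t ^ 2 • Ω) := by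
  ext i j
  simp only [mask, Matrix.of_apply]
  split_ifs with h
  · simp [boost, h]
  · rfl

/-- A boost fixes `eta` and the transversal directions and multiplies the null square by `t ^ 2`,
which is the same as rescaling `Ω`. -/
theorem natural_boost (hF : IsNatural F) {t : ℂ} (ht : t ≠ 0) (κ : ℂ) (Ω : Idx m → Idx m → ℂ)
    (i j : Idx m) : F (eta m) (stdCurv κ (t ^ 2 • Ω)) ![i, j]
      = boost m t i * boost m t j * F (eta m) (stdCurv κ Ω) ![i, j] := by
  have h := natural_mono hF (d := boost m t) (σ := 1) (τ := id)
    (fun i => by unfold boost; split_ifs <;> simp [ht]) Function.injective_id (fun _ => rfl)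
    (by
      ext ⟨α, i⟩ ⟨β, j⟩
      rw [mono_sandwich]
      by_cases hαβ : α = β
      · subst hαβ
        by_cases hα : α = 0
        · subst hα
          fin_cases i <;> fin_cases j <;> simp [boost, eta, blk, ht]
        · simp [boost, hα]
      · simp [eta, blk, hαβ]) (fun _ => Iff.rfl) (fun _ => Iff.rfl) κ Ω i j
  have e : boost m t (iu m) = t := by simp [boost]
  rw [e] at h
  simp only [Equiv.Perm.coe_one, id_eq] at h
  rw [← h]
  simp only [stdCurv, mask_boost]

/-- Components of the standard tensor other than the one of lowest boost weight. -/
theorem natural_std (hF : IsNatural F) (κ : ℂ) : ∃ K : ℂ, ∃ φ : (Idx m → Idx m → ℂ) →L[ℂ] ℂ,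
    (∀ Ω, φ Ω = F (eta m) (stdCurv κ Ω) ![iu m, iu m]) ∧
    ∀ Ω i j, F (eta m) (stdCurv κ Ω) ![i, j] = K * eta m i j + φ Ω * nullSq m i j := by
  obtain ⟨K, hK⟩ := isotropic_eta hF κ
  have h0 : ∀ i j, F (eta m) (stdCurv κ 0) ![i, j] = K * eta m i j := by
    intro i j; rw [stdCurv_zero, hK]; simp [matT]
  have hcont : ∀ Ω i j, Continuous fun s : ℂ => F (eta m) (stdCurv κ (s • Ω)) ![i, j] := by
    intro Ω i j
    exact ((differentiable_stdCurv hF κ ![i, j]).continuous).comp (by fun_prop)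
  -- Identities valid for `s ≠ 0` extend by continuity to `s = 0`, where the curvature is isotropic.
  have hext : ∀ f g : ℂ → ℂ, Continuous f → Continuous g → (∀ s, s ≠ 0 → f s = g s) → f = g :=
    fun f g hf hg h => Continuous.ext_on (dense_compl_singleton (0 : ℂ)) hf hg fun s hs => h s hs
  have huv : iv m ≠ iu m := by simp
  have bu : ∀ t, boost m t (iu m) = t := by intro t; simp [boost]
  have bv : ∀ t, boost m t (iv m) = t⁻¹ := by intro t; simp [boost]
  have b1 : ∀ t i, i ≠ iu m → i ≠ iv m → boost m t i = 1 := by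
    intro t i h1 h2; simp [boost, h1, h2]
  -- Boosts rescale by squares; complex square roots make every nonzero factor available.
  have hsq : ∀ s : ℂ, s ≠ 0 → ∃ t, t ≠ 0 ∧ t ^ 2 = s := by
    intro s hs
    obtain ⟨t, ht⟩ := IsAlgClosed.exists_pow_nat_eq s (n := 2) (by norm_num)
    exact ⟨t, fun h => hs (by rw [← ht, h]; ring), ht⟩
  have huu : ∀ (s : ℂ) Ω, F (eta m) (stdCurv κ (s • Ω)) ![iu m, iu m]
      = s * F (eta m) (stdCurv κ Ω) ![iu m, iu m] := by
    intro s Ω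
    refine congrFun (hext (fun s => F (eta m) (stdCurv κ (s • Ω)) ![iu m, iu m])
      (fun s => s * F (eta m) (stdCurv κ Ω) ![iu m, iu m]) (hcont _ _ _) (by fun_prop)
      fun s hs => ?_) s
    obtain ⟨t, ht, rfl⟩ := hsq s hs
    simp only [natural_boost hF ht, bu]
    ring
  -- Boost weight zero: the component is constant in `s` and is evaluated at `s = 0`.
  have hzero : ∀ Ω i j, (∀ t, t ≠ 0 → boost m t i * boost m t j = 1) →
      F (eta m) (stdCurv κ Ω) ![i, j] = K * eta m i j := by
    intro Ω i j hb
    have := congrFun (hext (fun s => F (eta m) (stdCurv κ (s • Ω)) ![i, j])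
      (fun s => F (eta m) (stdCurv κ Ω) ![i, j]) (hcont _ _ _) (by fun_prop)
      fun s hs => by
        obtain ⟨t, ht, rfl⟩ := hsq s hs
        simp only [natural_boost hF ht, hb t ht, one_mul]) 0
    simp only [zero_smul, h0] at this
    exact this.symm
  -- Odd boost weight: `t = -1` leaves `Ω` unchanged but reverses the sign.
  have hodd : ∀ Ω i j, boost m (-1) i * boost m (-1) j = -1 →
      F (eta m) (stdCurv κ Ω) ![i, j] = 0 := by
    intro Ω i j hb
    have := natural_boost hF (t := -1) (by norm_num) κ Ω i j
    rw [hb] at this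
    norm_num at this
    linear_combination (1 / 2) * this
  -- Weight -2: s F(sΩ) = F(Ω) for all `s`, and `s = 0` gives zero.
  have hvv : ∀ Ω, F (eta m) (stdCurv κ Ω) ![iv m, iv m] = 0 := by
    intro Ω
    have := congrFun (hext (fun s => s * F (eta m) (stdCurv κ (s • Ω)) ![iv m, iv m])
      (fun s => F (eta m) (stdCurv κ Ω) ![iv m, iv m]) (continuous_id.mul (hcont _ _ _))
      (by fun_prop) fun s hs => by
        obtain ⟨t, ht, rfl⟩ := hsq s hs
        simp only [natural_boost hF ht, bv]
        field_simp) 0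
    simpa using this.symm
  have hlin : ∀ Ω, F (eta m) (stdCurv κ Ω) ![iu m, iu m]
      = fderiv ℂ (fun Ω => F (eta m) (stdCurv κ Ω) ![iu m, iu m]) 0 Ω :=
    eq_fderiv_of_homogeneous (f := fun Ω => F (eta m) (stdCurv κ Ω) ![iu m, iu m])
      (differentiable_stdCurv hF κ _ 0) huu
  refine ⟨K, _, fun Ω => (hlin Ω).symm, fun Ω i j => ?_⟩
  rw [← hlin]
  have eu : ∀ i : Idx m, i ≠ iv m → eta m i (iu m) = 0 ∧ eta m (iu m) i = 0 := by
    rintro ⟨α, i⟩ h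
    by_cases hα : α = 0
    · subst hα
      fin_cases i <;> simp [eta, blk] at h ⊢
    · simp [eta, blk, hα, Ne.symm hα]
  have ev : ∀ i : Idx m, i ≠ iu m → eta m i (iv m) = 0 ∧ eta m (iv m) i = 0 := by
    rintro ⟨α, i⟩ h
    by_cases hα : α = 0
    · subst hα
      fin_cases i <;> simp [eta, blk] at h ⊢
    · simp [eta, blk, hα, Ne.symm hα]
  by_cases hiu : i = iu m
  · subst hiu
    by_cases hju : j = iu m
    · subst hju
      simp [nullSq, eta, blk]
    · have hn : nullSq m (iu m) j = 0 := by simp [nullSq, hju]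
      rw [hn, mul_zero, add_zero]
      by_cases hjv : j = iv m
      · subst hjv
        exact hzero Ω _ _ fun t ht => by rw [bu, bv, mul_inv_cancel₀ ht]
      · rw [hodd Ω _ _ (by rw [bu, b1 _ j hju hjv]; ring), (eu j hjv).2, mul_zero]
  · have hn : nullSq m i j = 0 := by simp [nullSq, hiu]
    rw [hn, mul_zero, add_zero]
    by_cases hiv : i = iv m
    · subst hiv
      by_cases hju : j = iu m
      · subst hju
        exact hzero Ω _ _ fun t ht => by rw [bu, bv, inv_mul_cancel₀ ht]
      · rw [(ev j hju).2, mul_zero]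
        by_cases hjv : j = iv m
        · subst hjv; exact hvv Ω
        · exact hodd Ω _ _ (by rw [bv, b1 _ j hju hjv]; norm_num)
    · by_cases hju : j = iu m
      · subst hju
        rw [hodd Ω _ _ (by rw [bu, b1 _ i hiu hiv]; ring), (eu i hiv).1, mul_zero]
      · by_cases hjv : j = iv m
        · subst hjv
          rw [hodd Ω _ _ (by rw [bv, b1 _ i hiu hiv]; norm_num), (ev i hiu).1, mul_zero]
        · exact hzero Ω _ _ fun t ht => by rw [b1 _ i hiu hiv, b1 _ j hju hjv, one_mul]

theorem eta_transversal (i j : Idx m) (hi : i ≠ iu m ∧ i ≠ iv m) :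
    eta m i j = if i = j then 1 else 0 := by
  obtain ⟨α, i⟩ := i
  obtain ⟨β, j⟩ := j
  by_cases h : α = β
  · subst h
    by_cases hα : α = 0
    · subst hα
      fin_cases i <;> fin_cases j <;> simp [eta, blk] at hi ⊢
    · simp [eta, blk, hα, Matrix.one_apply]
  · simp [eta, blk, h]

theorem eta_symm (i j : Idx m) : eta m i j = eta m j i := by
  obtain ⟨α, i⟩ := i
  obtain ⟨β, j⟩ := j
  by_cases h : α = β
  · subst h
    by_cases hα : α = 0
    · subst hα
      fin_cases i <;> fin_cases j <;> simp [eta, blk]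
    · simp [eta, blk, hα, Matrix.one_apply, eq_comm]
  · simp [eta, blk, h, Ne.symm h]

/-- The values of natural tensors of rank 2 in the standard frame. -/
theorem natural_structure (hF : IsNatural F) (κ : ℂ) : ∃ K a b : ℂ, ∀ Ω i j,
    F (eta m) (stdCurv κ Ω) ![i, j] = K * eta m i j
      + (a * Ω (iz m) (iz m) + b * ∑ α ∈ Finset.univ.erase (0 : Fin (m + 1)), ∑ k, Ω (α, k) (α, k))
        * nullSq m i j := by
  obtain ⟨K, φ, hφ, hstd⟩ := natural_std hF κ
  -- Signed permutations that respect the blocks and fix both null vectors leave the standard form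
  -- and the (u,u) component unchanged, hence also `φ`.
  have hinv : ∀ (d : Idx m → ℂ) (σ : Equiv.Perm (Idx m)) (τ : Fin (m + 1) → Fin (m + 1)),
      (∀ i, d i * d i = 1) → d (iu m) = 1 → d (iv m) = 1 → Function.Injective τ →
      (∀ i, (σ i).1 = τ i.1) → σ (iu m) = iu m → σ (iv m) = iv m →
      ∀ Ω, φ (fun i j => d i * d j * Ω (σ i) (σ j)) = φ Ω := by
    intro d σ τ hd hdu hdv hτ hσ hu hv Ω
    have hd0 : ∀ i, d i ≠ 0 := fun i h => by simpa [h] using hd i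
    have hu' : ∀ i, σ i = iu m ↔ i = iu m := fun i =>
      ⟨fun h => σ.injective (h.trans hu.symm), fun h => h ▸ hu⟩
    have hv' : ∀ i, σ i = iv m ↔ i = iv m := fun i =>
      ⟨fun h => σ.injective (h.trans hv.symm), fun h => h ▸ hv⟩
    have he : mono d σ * eta m * (mono d σ).transpose = eta m := by
      ext i j
      rw [mono_sandwich]
      by_cases hi : i ≠ iu m ∧ i ≠ iv m
      · rw [eta_transversal i j hi, eta_transversal (σ i) (σ j) (by simpa [hu', hv'] using hi)]
        by_cases h : i = j
        · subst h; simp [hd]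
        · simp [h]
      · by_cases hj : j ≠ iu m ∧ j ≠ iv m
        · rw [eta_symm i, eta_symm (σ i), eta_transversal j i hj,
            eta_transversal (σ j) (σ i) (by simpa [hu', hv'] using hj)]
          by_cases h : j = i
          · subst h; simp [hd]
          · simp [h]
        · have hi : i = iu m ∨ i = iv m := by by_contra! h; exact hi h
          have hj : j = iu m ∨ j = iv m := by by_contra! h; exact hj h
          rcases hi with rfl | rfl <;> rcases hj with rfl | rfl <;> simp [hu, hv, hdu, hdv]
    have h := natural_mono hF hd0 hτ hσ he hu' hv' κ Ω (iu m) (iu m)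
    rw [hu, hdu] at h
    rw [hφ, hφ]
    simpa using h
  set E : Idx m → Idx m → Idx m → Idx m → ℂ := fun a b i j => if i = a ∧ j = b then 1 else 0 with hE
  -- The standard curvature sees only the transversal components of `Ω`.
  have hmask : ∀ Ω : Idx m → Idx m → ℂ, mask Ω = 0 → φ Ω = 0 := by
    intro Ω hΩ
    rw [hφ, stdCurv, hΩ]
    have h1 : stdCurv κ (0 : Idx m → Idx m → ℂ) = bcurv κ (eta m) + KN (nullSq m) 0 := by
      rw [stdCurv]; congr 2; ext i j; simp [mask]
    rw [← h1, ← hφ, map_zero]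
  -- Reversing the sign of basis vector `a` negates `E a b`; if `a` is a null direction the masked
  -- form is already zero.
  have hoff : ∀ a b, a ≠ b → φ (E a b) = 0 := by
    intro a b hab
    by_cases ha : a ≠ iu m ∧ a ≠ iv m
    · have := hinv (fun i => if i = a then -1 else 1) 1 id (fun i => by split_ifs <;> norm_num)
        (by simp [ha.1.symm]) (by simp [ha.2.symm]) Function.injective_id (fun _ => rfl) rfl rfl
        (E a b)
      have e : (fun i j => (if i = a then (-1 : ℂ) else 1) * (if j = a then -1 else 1) *
          E a b ((1 : Equiv.Perm (Idx m)) i) ((1 : Equiv.Perm (Idx m)) j)) = -E a b := by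
        funext i j
        simp only [hE, Equiv.Perm.coe_one, id_eq, Pi.neg_apply]
        by_cases h : i = a ∧ j = b
        · simp [h, hab.symm]
        · simp [h]
      rw [e, map_neg] at this
      linear_combination (-1 / 2) * this
    · refine hmask _ ?_
      ext i j
      simp only [mask, hE, Matrix.of_apply, Matrix.zero_apply]
      split_ifs with h1 h2
      · exact absurd (h2.1 ▸ h1.1) ha
      · rfl
      · rfl
  have hE' : ∀ (σ : Equiv.Perm (Idx m)) a, (fun i j => (1 : ℂ) * 1 * E (σ a) (σ a) (σ i) (σ j)) = E a a := by
    intro σ a; funext i j; simp [hE]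
  -- Two moves: exchange the blocks, then exchange two vectors inside one block. Block 0 cannot take
  -- part, because it carries the null directions.
  have hdiag : ∀ a b : Idx m, a.1 ≠ 0 → b.1 ≠ 0 → φ (E a a) = φ (E b b) := by
    rintro ⟨α, i⟩ ⟨β, j⟩ hα hβ
    have h1 := hinv (fun _ => 1) (Equiv.prodCongr (Equiv.swap α β) (Equiv.refl _))
      (Equiv.swap α β) (fun _ => by norm_num) rfl rfl (Equiv.injective _) (fun _ => rfl)
      (Prod.ext (Equiv.swap_apply_of_ne_of_ne (Ne.symm hα) (Ne.symm hβ)) rfl)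
      (Prod.ext (Equiv.swap_apply_of_ne_of_ne (Ne.symm hα) (Ne.symm hβ)) rfl) (E (β, i) (β, i))
    have h2 := hinv (fun _ => 1) (Equiv.swap (β, i) (β, j)) id (fun _ => by norm_num) rfl rfl
      Function.injective_id (fun k => by
        rw [Equiv.swap_apply_def]; split_ifs <;> simp [*])
      (Equiv.swap_apply_of_ne_of_ne (by simp [Ne.symm hβ]) (by simp [Ne.symm hβ]))
      (Equiv.swap_apply_of_ne_of_ne (by simp [Ne.symm hβ]) (by simp [Ne.symm hβ])) (E (β, j) (β, j))
    have e1 := hE' (Equiv.prodCongr (Equiv.swap α β) (Equiv.refl _)) (α, i)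
    have e2 := hE' (Equiv.swap (β, i) (β, j)) (β, i)
    rw [Equiv.swap_apply_left] at e2
    have e3 : (Equiv.prodCongr (Equiv.swap α β) (Equiv.refl (Fin 3))) (α, i) = (β, i) :=
      Prod.ext (Equiv.swap_apply_left α β) rfl
    rw [e3] at e1
    rw [e1] at h1
    rw [e2] at h2
    rw [h1, h2]
  have hzero : ∀ a, (a = iu m ∨ a = iv m) → φ (E a a) = 0 := by
    intro a ha
    refine hmask _ ?_
    ext i j
    simp only [mask, hE, Matrix.of_apply, Matrix.zero_apply]
    split_ifs with h1 h2
    · exact absurd (h2.1 ▸ h1.1) (by rcases ha with rfl | rfl <;> simp)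
    · rfl
    · rfl
  have hexp : ∀ Ω : Idx m → Idx m → ℂ, φ Ω = ∑ a, Ω a a * φ (E a a) := by
    intro Ω
    have : Ω = ∑ a, ∑ b, Ω a b • E a b := by
      funext i j
      simp only [Finset.sum_apply, Pi.smul_apply, hE, smul_eq_mul]
      rw [Finset.sum_eq_single i, Finset.sum_eq_single j]
      · simp
      · intro b _ hb; simp [hb.symm]
      · simp
      · intro a _ ha; simp [ha.symm]
      · simp
    conv_lhs => rw [this]
    simp only [map_sum, map_smul, smul_eq_mul]
    refine Finset.sum_congr rfl fun a _ => Finset.sum_eq_single a (fun b _ hb => ?_) (by simp)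
    rw [hoff a b hb.symm, mul_zero]
  -- Any vector of a nonzero block would serve for `b`; if `m = 0` the sum it multiplies is empty,
  -- and the value is irrelevant.
  refine ⟨K, φ (E (iz m) (iz m)), φ (E (Fin.last m, 0) (Fin.last m, 0)), fun Ω i j => ?_⟩
  rw [hstd, hexp, Fintype.sum_prod_type, ← Finset.add_sum_erase _ _ (Finset.mem_univ (0 : Fin (m + 1)))]
  congr 2
  congr 1
  · rw [Fin.sum_univ_three, hzero (0, 0) (Or.inl rfl), hzero (0, 1) (Or.inr rfl)]
    ring
  · simp only [Finset.mul_sum]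
    refine Finset.sum_congr rfl fun α hα => Finset.sum_congr rfl fun k _ => ?_
    have hα : α ≠ 0 := Finset.ne_of_mem_erase hα
    have hlast : Fin.last m ≠ 0 := by
      intro h
      exact hα (Fin.ext (by
        have := congrArg Fin.val h
        have h2 := α.isLt
        simp at this ⊢
        omega))
    rw [hdiag (α, k) (Fin.last m, 0) hα hlast, mul_comm]

end Structure

/-! ### The adapted frame and the structure of rank-2 curvature polynomials -/

section Frame

variable {m : ℕ} {lam : ℝ}

/-- The scale factors of the frame. -/
def scale (lam : ℝ) (p : Idx m → ℝ) (i : Idx m) : ℝ :=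
  if i.1 = 0 then √(-2 / lam) / p (iz m) else
    √(-2 / lam) * ![1, Real.sinh (p (i.1, 0)), Real.sinh (p (i.1, 0)) * Real.sin (p (i.1, 1))] i.2

/-- The frame: the coordinate vectors in terms of the standard frame. -/
def frame (lam : ℝ) (H : (Idx m → ℝ) → ℝ) (p : Idx m → ℝ) : Matrix (Idx m) (Idx m) ℝ :=
  blk fun α => if α = 0 then
      !![1, H p / 2, 0; 0, 1, 0; 0, 2 * p (iv m) / p (iz m), √(-2 / lam) / p (iz m)]
    else Matrix.diagonal fun i => scale lam p (α, i)

/-- The matrix of the metric in a null frame. -/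
def etaReal (m : ℕ) : Matrix (Idx m) (Idx m) ℝ :=
  blk fun α => if α = 0 then !![0, 1, 0; 1, 0, 0; 0, 0, 1] else 1

theorem map_etaReal : (etaReal m).map Complex.ofReal = eta m := by
  ext ⟨α, i⟩ ⟨β, j⟩
  by_cases h : α = β
  · subst h
    by_cases hα : α = 0
    · subst hα
      fin_cases i <;> fin_cases j <;> simp [etaReal, eta, blk]
    · simp [etaReal, eta, blk, hα, Matrix.one_apply]
      split_ifs <;> simp
  · simp [etaReal, eta, blk, h]

theorem scale_ne_zero (hlam : lam < 0) {p : Idx m → ℝ} (hp : p ∈ chart m) (i : Idx m) :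
    scale lam p i ≠ 0 := by
  have h0 : √(-2 / lam) ≠ 0 :=
    (Real.sqrt_pos.mpr (div_pos_of_neg_of_neg (by norm_num) hlam)).ne'
  obtain ⟨α, i⟩ := i
  by_cases hα : α = 0
  · simpa [scale, hα, h0] using hp.1
  · have := hp.2 α hα
    fin_cases i <;> simp [scale, hα, h0, this]

theorem sq_sqrt_lam (hlam : lam < 0) : √(-2 / lam) * √(-2 / lam) = -2 / lam :=
  Real.mul_self_sqrt (div_pos_of_neg_of_neg (by norm_num) hlam).le

theorem frame_mul (hlam : lam < 0) (H : (Idx m → ℝ) → ℝ) {p : Idx m → ℝ} (hp : p ∈ chart m) :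
    frame lam H p * etaReal m * (frame lam H p).transpose = kgt m lam H p := by
  have hs := sq_sqrt_lam hlam
  have hz := hp.1
  rw [frame, etaReal, blk_transpose, blk_mul, blk_mul, kgt_eq_blk]
  congr 1
  funext α
  by_cases hα : α = 0
  · simp only [hα, if_true]
    have e : √(-2 / lam) / p (iz m) * (√(-2 / lam) / p (iz m)) = -2 / (lam * p (iz m) ^ 2) := by
      rw [div_mul_div_comm, hs]; field_simp
    ext i j
    fin_cases i <;> fin_cases j <;>
      simp [Matrix.mul_apply, Fin.sum_univ_three, lorentzBlock, e]
  · simp only [hα, if_false, Matrix.mul_one, Matrix.diagonal_transpose, Matrix.diagonal_mul_diagonal]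
    ext i j
    fin_cases i <;> fin_cases j <;> simp [hyperbolicBlock, scale, hα, hs]
    · linear_combination Real.sinh (p (α, 0)) ^ 2 * hs
    · linear_combination Real.sinh (p (α, 0)) ^ 2 * Real.sin (p (α, 1)) ^ 2 * hs

theorem isUnit_det_frame (hlam : lam < 0) (H : (Idx m → ℝ) → ℝ) {p : Idx m → ℝ} (hp : p ∈ chart m) :
    IsUnit (frame lam H p).det := by
  have h := isUnit_det_kgt hlam.ne H hp
  rw [← frame_mul hlam H hp, Matrix.det_mul, Matrix.det_mul] at h
  exact isUnit_of_mul_isUnit_left (isUnit_of_mul_isUnit_left h)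

theorem frame_transversal (H : (Idx m → ℝ) → ℝ) (p : Idx m → ℝ) (a i : Idx m)
    (hi : i ≠ iu m ∧ i ≠ iv m) : frame lam H p a i = if a = i then scale lam p i else 0 := by
  obtain ⟨α, a⟩ := a
  obtain ⟨β, i⟩ := i
  by_cases h : α = β
  · subst h
    by_cases hα : α = 0
    · subst hα
      fin_cases i <;> fin_cases a <;> simp [frame, blk, scale] at hi ⊢
    · simp [frame, blk, hα, Matrix.diagonal_apply]
      split_ifs with h
      · rw [h]
      · rfl
  · simp [frame, blk, h]

theorem frame_iu (H : (Idx m → ℝ) → ℝ) (p : Idx m → ℝ) (a : Idx m) :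
    frame lam H p a (iu m) = ell a := by
  obtain ⟨α, a⟩ := a
  by_cases hα : α = 0
  · subst hα
    fin_cases a <;> simp [frame, blk, ell]
  · simp [frame, blk, ell, hα]

/-- The transversal form `Ω` in the standard frame. -/
def OmFrame (lam : ℝ) (H : (Idx m → ℝ) → ℝ) (p : Idx m → ℝ) (i j : Idx m) : ℂ :=
  ((Om lam H p i j / (scale lam p i * scale lam p j) : ℝ) : ℂ)

/-- The trace of `Ω` over the blocks other than block `0`. -/
def tr1 (lam : ℝ) (H : (Idx m → ℝ) → ℝ) (p : Idx m → ℝ) : ℝ :=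
  -(1 / 2) * ∑ α ∈ Finset.univ.erase (0 : Fin (m + 1)), blockBox (kgt m lam H) α H p

namespace Admissible

variable {H : (Idx m → ℝ) → ℝ} {p : Idx m → ℝ}

theorem act_frame_nullSq (H : (Idx m → ℝ) → ℝ) (p : Idx m → ℝ) :
    (frame lam H p).map Complex.ofReal * nullSq m * ((frame lam H p).map Complex.ofReal).transpose
      = (ellell (m := m)).map Complex.ofReal := by
  ext a b
  rw [← bil_rows, bil, Finset.sum_eq_single (iu m), Finset.sum_eq_single (iu m)]
  · simp [nullSq, ellell, frame_iu]
  · intro j _ hj; simp [nullSq, hj]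
  · simp
  · intro i _ hi; simp [nullSq, hi]
  · simp

theorem act_frame_mask (h : Admissible H p) (hlam : lam < 0) :
    (frame lam H p).map Complex.ofReal * mask (OmFrame lam H p) *
        ((frame lam H p).map Complex.ofReal).transpose
      = (Om lam H p).map Complex.ofReal := by
  ext a b
  have h1 : ∀ i j, mask (OmFrame lam H p) i j * (frame lam H p a i : ℂ) * (frame lam H p b j : ℂ)
      = if i = a ∧ j = b then (Om lam H p a b : ℂ) else 0 := by
    intro i j
    by_cases hi : i ≠ iu m ∧ i ≠ iv m
    · by_cases hj : j ≠ iu m ∧ j ≠ iv m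
      · rw [frame_transversal H p a i hi, frame_transversal H p b j hj]
        by_cases hia : i = a
        · by_cases hjb : j = b
          · subst hia hjb
            have h1 : (scale lam p i : ℂ) ≠ 0 :=
              Complex.ofReal_ne_zero.mpr (scale_ne_zero hlam h.chart i)
            have h2 : (scale lam p j : ℂ) ≠ 0 :=
              Complex.ofReal_ne_zero.mpr (scale_ne_zero hlam h.chart j)
            have hm : mask (OmFrame lam H p) i j = OmFrame lam H p i j := by
              simp only [mask, Matrix.of_apply]
              rw [if_pos ⟨hi, hj⟩]
            rw [hm, if_pos rfl, if_pos rfl, if_pos ⟨rfl, rfl⟩, OmFrame]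
            push_cast
            field_simp
          · simp [hjb, Ne.symm hjb]
        · simp [hia, Ne.symm hia]
      · have h0 : mask (OmFrame lam H p) i j = 0 := by simp [mask, hj]
        rw [h0, zero_mul, zero_mul]
        split_ifs with hc
        · rw [← hc.2]
          have hj' : j = iu m ∨ j = iv m := by by_contra! hh; exact hj hh
          rcases hj' with rfl | rfl
          · simp [Om_iu_right]
          · simp [h.Om_iv_right hlam.ne]
        · rfl
    · have h0 : mask (OmFrame lam H p) i j = 0 := by
        simp only [mask, Matrix.of_apply]; rw [if_neg fun hh => hi hh.1]
      rw [h0, zero_mul, zero_mul]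
      split_ifs with hc
      · rw [← hc.1]
        have hi' : i = iu m ∨ i = iv m := by by_contra! hh; exact hi hh
        rcases hi' with rfl | rfl
        · simp [Om_iu_left]
        · simp [h.Om_iv_left hlam.ne]
      · rfl
  rw [← bil_rows, bil]
  simp only [Matrix.map_apply, h1]
  rw [Finset.sum_eq_single a, Finset.sum_eq_single b]
  · simp
  · intro j _ hj; simp [hj]
  · simp
  · intro i _ hi; simp [hi]
  · simp

/-- The frame preserves the blocks and carries `eta` to the metric, the null square to `du²` and the
masked `OmFrame` to `Om`, so each summand of `stdCurv` goes to the matching summand of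
`riemann_kgt`. -/
theorem act_frame_stdCurv (h : Admissible H p) (hlam : lam < 0) :
    act ((frame lam H p).map Complex.ofReal) (stdCurv ((lam / 2 : ℝ) : ℂ) (OmFrame lam H p))
      = fun J => (riemann (kgt m lam H) p J : ℂ) := by
  have hG := frame_mul hlam H h.chart
  have hG' : (frame lam H p).map Complex.ofReal * eta m *
      ((frame lam H p).map Complex.ofReal).transpose = (kgt m lam H p).map Complex.ofReal := by
    rw [← hG, ← map_etaReal]
    have e : ∀ M : Matrix (Idx m) (Idx m) ℝ, M.map Complex.ofReal = Complex.ofRealHom.mapMatrix M :=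
      fun M => rfl
    rw [← Matrix.transpose_map]
    simp only [e, map_mul]
  have hb : (frame lam H p).map Complex.ofReal = blk fun α =>
      ((if α = 0 then
        !![1, H p / 2, 0; 0, 1, 0; 0, 2 * p (iv m) / p (iz m), √(-2 / lam) / p (iz m)]
      else Matrix.diagonal fun i => scale lam p (α, i)) : Matrix (Fin 3) (Fin 3) ℝ).map
        Complex.ofReal := by
    ext i j
    simp only [frame, blk, Matrix.map_apply, Matrix.of_apply]
    split_ifs <;> simp
  rw [stdCurv, act_add, act_KN, act_frame_nullSq, h.act_frame_mask hlam, act_bcurv (τ := id)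
    Function.injective_id (by rw [hb]; exact fun i j => blk_ne_zero i j), hG']
  funext J
  rw [h.riemann_kgt hlam.ne]
  simp only [Pi.add_apply, KN, bcurv, Matrix.map_apply]
  split_ifs <;> push_cast <;> ring

theorem OmFrame_iz (h : Admissible H p) (hlam : lam < 0) :
    OmFrame lam H p (iz m) (iz m) = (tr0 lam H p : ℂ) := by
  have hs := sq_sqrt_lam hlam
  have hz := h.chart.1
  have hl := hlam.ne
  rw [OmFrame, tr0]
  congr 1
  have : scale lam p (iz m) * scale lam p (iz m) = -2 / lam / p (iz m) ^ 2 := by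
    simp only [scale, if_true]
    rw [div_mul_div_comm, hs]; ring
  rw [this]
  field_simp

/-- On the hyperbolic blocks the metric is diagonal, so dividing by squared scale factors is
contracting with the inverse metric. -/
theorem sum_OmFrame (h : Admissible H p) (hlam : lam < 0) :
    ∑ α ∈ Finset.univ.erase (0 : Fin (m + 1)), ∑ k, OmFrame lam H p (α, k) (α, k)
      = (tr1 lam H p : ℂ) := by
  have hs := sq_sqrt_lam hlam
  have hl := hlam.ne
  simp only [tr1, Finset.mul_sum, OmFrame, ← Complex.ofReal_sum]
  congr 1
  refine Finset.sum_congr rfl fun α hα => ?_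
  have hα : α ≠ 0 := Finset.ne_of_mem_erase hα
  have hc := h.chart.2 α hα
  rw [blockBox, inv_kgt hlam.ne H h.chart, Finset.mul_sum]
  refine Finset.sum_congr rfl fun k _ => ?_
  have h1 : ∀ j, kgtInv m lam H p (α, k) (α, j)
      = if j = k then (scale lam p (α, k) * scale lam p (α, k))⁻¹ else 0 := by
    intro j
    have e : √(-2 / lam) ^ 2 = -2 / lam := by rw [sq, hs]
    fin_cases k <;> fin_cases j <;> simp [kgtInv, blk, hα, hypInv, scale, -mul_inv_rev]
    · rw [hs]; field_simp
    · rw [show √(-2 / lam) * Real.sinh (p (α, 0)) * (√(-2 / lam) * Real.sinh (p (α, 0)))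
        = √(-2 / lam) ^ 2 * Real.sinh (p (α, 0)) ^ 2 by ring, e]
      have := hc.1
      field_simp
    · rw [show √(-2 / lam) * (Real.sinh (p (α, 0)) * Real.sin (p (α, 1))) *
          (√(-2 / lam) * (Real.sinh (p (α, 0)) * Real.sin (p (α, 1))))
        = √(-2 / lam) ^ 2 * (Real.sinh (p (α, 0)) ^ 2 * Real.sin (p (α, 1)) ^ 2) by ring, e]
      have := hc.1
      have := hc.2
      field_simp
  simp only [h1, ite_mul, zero_mul, Finset.sum_ite_eq', Finset.mem_univ, if_true]
  simp [Om, preOm, hα, zet]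
  ring

end Admissible

/-- Rank 2 tensors built from the metric and the curvature. -/
theorem curvPoly_structure (hlam : lam < 0) {H : (Idx m → ℝ) → ℝ} {T : TField (Idx m) 2}
    (hT : CurvPoly (kgt m lam H) 0 2 T) : ∃ K a b : ℝ, ∀ p, Admissible H p → ∀ i j,
      T p ![i, j] = K * kgt m lam H p i j
        + (a * Admissible.tr0 lam H p + b * tr1 lam H p) * (ell i * ell j) := by
  obtain ⟨F, hF, hFT⟩ := hT.exists_natural
  obtain ⟨K, a, b, hK⟩ := natural_structure hF ((lam / 2 : ℝ) : ℂ)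
  -- The complex constants depend only on the polynomial and on λ, not on the point. As the tensor,
  -- the metric and both traces are real, taking real parts is harmless.
  refine ⟨K.re, a.re, b.re, fun p h i j => ?_⟩
  have hG : (frame lam H p).map Complex.ofReal * eta m *
      ((frame lam H p).map Complex.ofReal).transpose = (kgt m lam H p).map Complex.ofReal := by
    rw [← frame_mul hlam H h.chart, ← map_etaReal, ← Matrix.transpose_map]
    have e : ∀ M : Matrix (Idx m) (Idx m) ℝ, M.map Complex.ofReal = Complex.ofRealHom.mapMatrix M :=
      fun M => rfl
    simp only [e, map_mul]
  have hdet : IsUnit ((frame lam H p).map Complex.ofReal).det := by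
    have e : ((frame lam H p).map Complex.ofReal).det = Complex.ofRealHom (frame lam H p).det :=
      (RingHom.map_det Complex.ofRealHom _).symm
    rw [e]
    exact (isUnit_det_frame hlam H h.chart).map _
  have h1 : F (eta m) (stdCurv ((lam / 2 : ℝ) : ℂ) (OmFrame lam H p))
      = K • matT (eta m) + (a * Admissible.tr0 lam H p + b * tr1 lam H p) • matT (nullSq m) := by
    funext I
    have hI : I = ![I 0, I 1] := by funext k; fin_cases k <;> rfl
    rw [hI, hK, h.OmFrame_iz hlam, h.sum_OmFrame hlam]
    simp [matT]
  have h2 := hF.equivariant _ (eta m) (stdCurv ((lam / 2 : ℝ) : ℂ) (OmFrame lam H p)) hdet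
  rw [h.act_frame_stdCurv hlam, hG, h1, act_add, act_smul, act_smul, act_matT, act_matT, hG,
    Admissible.act_frame_nullSq] at h2
  have h3 := congrFun h2 ![i, j]
  rw [hFT] at h3
  have h4 := congrArg Complex.re h3
  simpa [matT, ellell] using h4

end Frame

/-! ### Conservation of `K g + f du²` -/

section Conserved

variable {m : ℕ} {lam : ℝ} {H : (Idx m → ℝ) → ℝ}

theorem nabla_two {ι : Type} [Fintype ι] [DecidableEq ι] (g : MetricField ι) (T : TField ι 2)
    (p : ι → ℝ) (a b c : ι) :
    nabla g T p ![a, b, c] = pd c (fun q => T q ![a, b]) p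
      - (∑ d, christoffel g d c a p * T p ![d, b] + ∑ d, christoffel g d c b p * T p ![a, d]) := by
  have h0 : (Fin.init ![a, b, c] : Fin 2 → ι) = ![a, b] := by
    funext k; fin_cases k <;> rfl
  have h1 : ∀ d, Function.update ![a, b] 0 d = ![d, b] := fun d => by
    funext k; fin_cases k <;> rfl
  have h2 : ∀ d, Function.update ![a, b] 1 d = ![a, d] := fun d => by
    funext k; fin_cases k <;> rfl
  unfold nabla
  rw [h0, Fin.sum_univ_two]
  simp only [h1, h2]
  rfl

theorem nabla_metricT {ι : Type} [Fintype ι] [DecidableEq ι] {g : MetricField ι} {p : ι → ℝ}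
    (h : RegularAt g p) (a b c : ι) :
    pd c (fun q => g q a b) p
      - (∑ d, christoffel g d c a p * g p d b + ∑ d, christoffel g d c b p * g p a d) = 0 := by
  have hs := h.symm.self_of_nhds
  have hd := h.det.self_of_nhds
  rw [h.pd_metric, ← sum_mul_christoffel hd, ← sum_mul_christoffel hd]
  simp only [mul_comm (christoffel _ _ _ _ _), hs _ b]
  ring

theorem ell_iu : ell (iu m) = 1 := by simp [ell]

theorem sum_mul_ell (X : Idx m → ℝ) : ∑ d, X d * ell d = X (iu m) := by simp [ell]

/-- The metric is parallel. The derivative of f du² consists of `df` and `dz` terms; its divergence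
pairs `du` with `df`, with `du` or with `dz`, giving `∂_v f` or zero. Hence the du² coefficient may
be any function independent of `v`. -/
theorem isConservedOn_of_eq {U : Set (Idx m → ℝ)} (hU : IsOpen U) (hlam : lam ≠ 0)
    (hadm : ∀ p ∈ U, Admissible H p) {T : TField (Idx m) 2} {K : ℝ} {f : (Idx m → ℝ) → ℝ}
    (hT : ∀ p ∈ U, ∀ i j, T p ![i, j] = K * kgt m lam H p i j + f p * (ell i * ell j))
    (hf : ∀ p ∈ U, DifferentiableAt ℝ f p) (hfv : ∀ p ∈ U, pd (iv m) f p = 0) :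
    IsConservedOn (kgt m lam H) T U := by
  intro p hp a
  have h := hadm p hp
  have hreg := h.regularAt hlam
  have hz := h.chart.1
  have key : ∀ b c, nabla (kgt m lam H) T p ![a, b, c] = ell a * (ell b * pd c f p)
      + f p / p (iz m) * zet a * (ell b * ell c)
      + 2 * f p / p (iz m) * ell a * (ell b * zet c)
      + f p / p (iz m) * ell a * (zet b * ell c) := by
    intro b c
    have h0 : pd c (fun q => T q ![a, b]) p
        = K * pd c (fun q => kgt m lam H q a b) p + pd c f p * (ell a * ell b) := by
      have e : (fun q => T q ![a, b])
          =ᶠ[𝓝 p] fun q => K * kgt m lam H q a b + (ell a * ell b) * f q := by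
        filter_upwards [hU.mem_nhds hp] with q hq
        rw [hT q hq]; ring
      rw [pd_congr e, pd_add ((hreg.diff a b).const_mul K) ((hf p hp).const_mul _),
        pd_const_mul _ (hreg.diff a b), pd_const_mul _ (hf p hp)]
      ring
    have h1 : ∀ a b, ∑ d, christoffel (kgt m lam H) d c a p * T p ![d, b]
        = K * ∑ d, christoffel (kgt m lam H) d c a p * kgt m lam H p d b
          + f p * ell b * christoffel (kgt m lam H) (iu m) c a p := by
      intro a b
      rw [← sum_mul_ell fun d => christoffel (kgt m lam H) d c a p, Finset.mul_sum, Finset.mul_sum,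
        ← Finset.sum_add_distrib]
      refine Finset.sum_congr rfl fun d _ => ?_
      rw [hT p hp]; ring
    have h2 : ∑ d, christoffel (kgt m lam H) d c b p * T p ![a, d]
        = K * ∑ d, christoffel (kgt m lam H) d c b p * kgt m lam H p a d
          + f p * ell a * christoffel (kgt m lam H) (iu m) c b p := by
      rw [← sum_mul_ell fun d => christoffel (kgt m lam H) d c b p, Finset.mul_sum, Finset.mul_sum,
        ← Finset.sum_add_distrib]
      refine Finset.sum_congr rfl fun d _ => ?_
      rw [hT p hp]; ring
    rw [nabla_two, h0, h1, h2, christoffel_iu h hlam, christoffel_iu h hlam]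
    linear_combination K * nabla_metricT hreg a b c
  have hW : ∀ X Y : Idx m → ℝ, ∑ b, X b * ∑ c, kgtInv m lam H p b c * Y c
      = ip (kgtInv m lam H p) X Y := fun X Y => by
    simp only [ip, Finset.mul_sum]
    exact Finset.sum_congr rfl fun _ _ => Finset.sum_congr rfl fun _ _ => by ring
  rw [inv_kgt hlam H h.chart]
  simp only [key, mul_add, mul_left_comm (kgtInv m lam H p _ _), Finset.sum_add_distrib,
    ← Finset.mul_sum]
  rw [hW, hW, hW, hW, ip_kgtInv_comm (X := zet), ip_kgtInv_ell, ip_kgtInv_ell, ip_kgtInv_ell,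
    hfv p hp]
  simp [ell, zet]

theorem isSymmOn_of_eq {U : Set (Idx m → ℝ)} {T : TField (Idx m) 2} {K : ℝ}
    {f : (Idx m → ℝ) → ℝ}
    (hT : ∀ p ∈ U, ∀ i j, T p ![i, j] = K * kgt m lam H p i j + f p * (ell i * ell j)) :
    IsSymmOn T U := by
  intro p hp a b
  rw [hT p hp, hT p hp, kgt_symm, mul_comm (ell a)]

end Conserved

/-! ### The Ricci tensor and the squared Riemann tensor as curvature polynomials -/

section Quadratic

variable {ι : Type} [Fintype ι]

theorem curvPoly_riemann [DecidableEq ι] (g : MetricField ι) : CurvPoly g 0 4 (riemann g) :=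
  CurvPoly.curv (g := g) (k := 0) 0 le_rfl

/-- The Ricci tensor as a contraction of the Riemann tensor. -/
theorem exists_curvPoly_ricci [DecidableEq ι] (g : MetricField ι) : ∃ T : TField ι 2, CurvPoly g 0 2 T ∧
    ∀ p b d, T p ![b, d] = ∑ a, ∑ e, (g p)⁻¹ a e * riemann g p ![e, b, a, d] := by
  -- Contraction acts on the last two slots: with slots ordered (b, d, a, e), the permutation reads
  -- off (e, b, a, d).
  let σ : Equiv.Perm (Fin 4) := ⟨![3, 0, 2, 1], ![1, 3, 2, 0], by decide, by decide⟩
  refine ⟨_, ((curvPoly_riemann g).perm σ).contract, fun p b d => ?_⟩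
  refine Finset.sum_congr rfl fun a _ => Finset.sum_congr rfl fun e _ => ?_
  congr 2
  funext i
  fin_cases i <;> rfl

/-- The square of the Riemann tensor. -/
def riemannSq [DecidableEq ι] (g : MetricField ι) (p : ι → ℝ) (a b : ι) : ℝ :=
  ∑ c, ∑ c', (g p)⁻¹ c c' * ∑ d, ∑ d', (g p)⁻¹ d d' * ∑ e, ∑ e', (g p)⁻¹ e e' *
    (riemann g p ![a, c, d, e] * riemann g p ![b, c', d', e'])

theorem exists_curvPoly_riemannSq [DecidableEq ι] (g : MetricField ι) : ∃ T : TField ι 2, CurvPoly g 0 2 T ∧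
    ∀ p a b, T p ![a, b] = riemannSq g p a b := by
  -- With slots ordered (a, b, c, c', d, d', e, e'), the even places feed the first factor and the
  -- odd places the second; the pairs are then contracted from the right.
  let σ : Equiv.Perm (Fin 8) :=
    ⟨![0, 2, 4, 6, 1, 3, 5, 7], ![0, 4, 1, 5, 2, 6, 3, 7], by decide, by decide⟩
  have h1 := ((curvPoly_riemann g).mul (curvPoly_riemann g)).perm σ
  refine ⟨_, (CurvPoly.contract (r := 2) (CurvPoly.contract (r := 4)
    (CurvPoly.contract (r := 6) h1))), fun p a b => ?_⟩
  refine Finset.sum_congr rfl fun c _ => Finset.sum_congr rfl fun c' _ => ?_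
  congr 1

theorem sum_tensor_mul (W : Matrix ι ι ℝ) (x s y t : ι → ℝ) :
    ∑ d, ∑ d', W d d' * ∑ e, ∑ e', W e e' * ((x d * s e) * (y d' * t e'))
      = ip W x y * ip W s t := by
  have : ∀ d d', ∑ e, ∑ e', W e e' * ((x d * s e) * (y d' * t e')) = x d * y d' * ip W s t := by
    intro d d'
    simp only [ip, Finset.mul_sum]
    exact Finset.sum_congr rfl fun _ _ => Finset.sum_congr rfl fun _ _ => by ring
  simp only [this]
  conv_rhs => rw [ip]
  simp only [Finset.sum_mul]
  exact Finset.sum_congr rfl fun _ _ => Finset.sum_congr rfl fun _ _ => by ring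

theorem sum_wedge_mul (W : Matrix ι ι ℝ) (x s y t x' s' y' t' : ι → ℝ) :
    ∑ d, ∑ d', W d d' * ∑ e, ∑ e', W e e' *
      ((x d * s e - s d * x e + (y d * t e - t d * y e))
        * (x' d' * s' e' - s' d' * x' e' + (y' d' * t' e' - t' d' * y' e')))
      = 2 * (ip W x x' * ip W s s' - ip W x s' * ip W s x'
        + (ip W x y' * ip W s t' - ip W x t' * ip W s y')
        + (ip W y x' * ip W t s' - ip W y s' * ip W t x')
        + (ip W y y' * ip W t t' - ip W y t' * ip W t y')) := by
  simp only [add_mul, sub_mul, mul_add, mul_sub, Finset.sum_add_distrib, Finset.sum_sub_distrib,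
    sum_tensor_mul]
  ring

/-- Bilinearity: this is the value of the quadratic contraction on the vector `e_i + t e_j`. -/
theorem quadratic_eq {A : ι → ι → ι → ι → ℝ} (W : Matrix ι ι ℝ) (t : ℝ) (i j : ι) (S : ι → ι → ℝ)
    (hS : ∀ a b, S a b = ∑ c, ∑ c', W c c' * ∑ d, ∑ d', W d d' * ∑ e, ∑ e', W e e' *
      (A a c d e * A b c' d' e')) :
    S i i + t * S i j + t * S j i + t ^ 2 * S j j
      = ∑ c, ∑ c', W c c' * ∑ d, ∑ d', W d d' * ∑ e, ∑ e', W e e' *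
        ((A i c d e + t * A j c d e) * (A i c' d' e' + t * A j c' d' e')) := by
  simp only [hS, Finset.mul_sum, ← Finset.sum_add_distrib]
  refine Finset.sum_congr rfl fun _ _ => Finset.sum_congr rfl fun _ _ => Finset.sum_congr rfl
    fun _ _ => Finset.sum_congr rfl fun _ _ => Finset.sum_congr rfl fun _ _ =>
    Finset.sum_congr rfl fun _ _ => by ring

end Quadratic

/-! ### The squared Riemann tensor on the null vector `∂_u - (H/2) ∂_v` -/

section Evaluation

variable {m : ℕ} {lam : ℝ} {H : (Idx m → ℝ) → ℝ} {p : Idx m → ℝ}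

/-- The one-form dual to the null vector `∂_u - (H/2) ∂_v`. -/
def nul (lam : ℝ) (H : (Idx m → ℝ) → ℝ) (p : Idx m → ℝ) (a : Idx m) : ℝ :=
  kgt m lam H p (iu m) a - H p / 2 * kgt m lam H p (iv m) a

theorem ip_kgtInv_kgt (h : Admissible H p) (hlam : lam ≠ 0) (a : Idx m) (s : Idx m → ℝ) :
    ip (kgtInv m lam H p) s (kgt m lam H p a) = s a := by
  have h1 : ∀ b, ∑ c, kgtInv m lam H p b c * kgt m lam H p a c = if b = a then 1 else 0 := by
    intro b
    simp_rw [kgt_symm H p a]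
    rw [← Matrix.mul_apply, h.kgtInv_mul hlam, Matrix.one_apply]
  have : ∀ b, ∑ c, kgtInv m lam H p b c * s b * kgt m lam H p a c = s b * if b = a then 1 else 0 := by
    intro b
    rw [← h1, Finset.mul_sum]
    exact Finset.sum_congr rfl fun _ _ => by ring
  simp [ip, this]

theorem ip_kgtInv_nul (h : Admissible H p) (hlam : lam ≠ 0) (s : Idx m → ℝ) :
    ip (kgtInv m lam H p) s (nul lam H p) = s (iu m) - H p / 2 * s (iv m) := by
  have : nul lam H p = kgt m lam H p (iu m) + (-(H p / 2)) • kgt m lam H p (iv m) := by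
    funext a; simp [nul]; ring
  rw [this, ip_add_right, ip_smul_right, ip_kgtInv_kgt h hlam, ip_kgtInv_kgt h hlam]
  ring

theorem nul_iu : nul lam H p (iu m) = H p / 2 := by
  simp [nul, kgt, lorentzBlock]; ring

theorem nul_iv : nul lam H p (iv m) = 1 := by
  simp [nul, kgt, lorentzBlock]

theorem nul_of_ne {a : Idx m} (ha : a.1 ≠ 0) : nul lam H p a = 0 := by
  simp [nul, kgt, Ne.symm ha]

/-- The rows of the metric of block `0`. -/
def row0 (lam : ℝ) (H : (Idx m → ℝ) → ℝ) (p : Idx m → ℝ) (c : Idx m) : Idx m → ℝ :=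
  if c.1 = 0 then kgt m lam H p c else 0

/-- Inserting the null vector turns each of the two parts of the curvature into a wedge product in
the last two indices, a form whose square `sum_wedge_mul` evaluates. The block part involves block 0
only. -/
theorem riemann_nul (h : Admissible H p) (hlam : lam ≠ 0) (c d e : Idx m) :
    riemann (kgt m lam H) p ![iu m, c, d, e]
        + -(H p / 2) * riemann (kgt m lam H) p ![iv m, c, d, e]
      = ((lam / 2) • nul lam H p) d * row0 lam H p c e - row0 lam H p c d * ((lam / 2) • nul lam H p) e
        + (ell d * Om lam H p c e - Om lam H p c d * ell e) := by
  rw [h.riemann_kgt hlam, h.riemann_kgt hlam]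
  have h1 := Admissible.Om_iu_left (lam := lam) (H := H) (p := p)
  have h2 := h.Om_iv_left hlam
  have hv : ell (iv m) = 0 := by simp [ell]
  have h3 : bcurv (lam / 2) (kgt m lam H p) ![iu m, c, d, e]
      + -(H p / 2) * bcurv (lam / 2) (kgt m lam H p) ![iv m, c, d, e]
      = lam / 2 * (nul lam H p d * row0 lam H p c e - nul lam H p e * row0 lam H p c d) := by
    by_cases hc : c.1 = 0
    · by_cases hd : d.1 = 0
      · by_cases he : e.1 = 0
        · simp [bcurv, row0, hc, hd, he, nul]
          ring
        · have : kgt m lam H p c e = 0 := by simp [kgt, hc, Ne.symm he]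
          simp [bcurv, row0, hc, he, nul_of_ne, this]
      · have : kgt m lam H p c d = 0 := by simp [kgt, hc, Ne.symm hd]
        simp [bcurv, row0, hc, hd, nul_of_ne, this]
    · simp [bcurv, row0, hc, Ne.symm hc]
  simp only [KN, ellell, Matrix.of_apply, Matrix.cons_val, h1, h2, hv, ell_iu, Pi.smul_apply,
    smul_eq_mul]
  linear_combination h3

theorem ip_row0 (h : Admissible H p) (hlam : lam ≠ 0) (c : Idx m) (s : Idx m → ℝ) :
    ip (kgtInv m lam H p) s (row0 lam H p c) = if c.1 = 0 then s c else 0 := by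
  unfold row0
  split_ifs
  · exact ip_kgtInv_kgt h hlam c s
  · simp [ip]

theorem sum_block_zero (h : Admissible H p) (hlam : lam ≠ 0) :
    ∑ c, ∑ c', kgtInv m lam H p c c' * (if c.1 = 0 then Om lam H p c' c else 0)
      = Admissible.tr0 lam H p := by
  have h1 := h.Om_iv_left hlam
  have h2 := h.Om_iv_right hlam
  have h3 := Admissible.Om_iu_left (lam := lam) (H := H) (p := p)
  have h4 := Admissible.Om_iu_right (lam := lam) (H := H) (p := p)
  rw [Fintype.sum_prod_type, Finset.sum_eq_single 0]
  · simp only [if_true]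
    have : ∀ i, ∑ c', kgtInv m lam H p (0, i) c' * Om lam H p c' (0, i)
        = ∑ j, kgtInv m lam H p (0, i) (0, j) * Om lam H p (0, j) (0, i) := by
      intro i
      rw [kgtInv, sum_blk_mul]
      simp [blk]
    simp only [this, Fin.sum_univ_three, h1, h2, h3, h4, Admissible.tr0]
    simp [kgtInv, blk, lorInv]
  · intro α _ hα; simp [hα]
  · simp

/-- The metric vanishes on this vector and `du` equals 1, so the left side is the du² coefficient of
the squared Riemann tensor. It isolates `tr0`, which the Ricci tensor sees only together with `tr1`.
-/
theorem riemannSq_nul (h : Admissible H p) (hlam : lam ≠ 0) :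
    riemannSq (kgt m lam H) p (iu m) (iu m)
      + -(H p / 2) * riemannSq (kgt m lam H) p (iu m) (iv m)
      + -(H p / 2) * riemannSq (kgt m lam H) p (iv m) (iu m)
      + (-(H p / 2)) ^ 2 * riemannSq (kgt m lam H) p (iv m) (iv m)
      = 2 * lam * Admissible.tr0 lam H p := by
  have hv : ell (iv m) = 0 := by simp [ell]
  rw [quadratic_eq (A := fun a b c d => riemann (kgt m lam H) p ![a, b, c, d]) (kgt m lam H p)⁻¹ _ _ _
    (riemannSq (kgt m lam H) p) fun a b => rfl, inv_kgt hlam H h.chart]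
  have h1 := h.Om_iv_left hlam
  have h2 := h.Om_iv_right hlam
  have h3 := Admissible.Om_iu_left (lam := lam) (H := H) (p := p)
  have h4 := Admissible.Om_iu_right (lam := lam) (H := H) (p := p)
  have e1 : ∀ c, ip (kgtInv m lam H p) (row0 lam H p c) (nul lam H p) = nul lam H p c := by
    intro c
    rw [ip_kgtInv_comm, ip_row0 h hlam]
    split_ifs with hc
    · rfl
    · rw [nul_of_ne hc]
  have e2 : ∀ c, ip (kgtInv m lam H p) (row0 lam H p c) ell = ell c := by
    intro c
    rw [ip_kgtInv_comm, ip_row0 h hlam]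
    split_ifs with hc
    · rfl
    · have : c ≠ iu m := fun h => hc (by rw [h])
      simp [ell, this]
  have e3 : ∀ c, ip (kgtInv m lam H p) (Om lam H p c) (nul lam H p) = 0 := by
    intro c; rw [ip_kgtInv_nul h hlam, h2, h4]; ring
  have e4 : ∀ c, ip (kgtInv m lam H p) (Om lam H p c) ell = 0 := by
    intro c; rw [ip_kgtInv_comm, ip_kgtInv_ell, h2]
  have e5 : ip (kgtInv m lam H p) (nul lam H p) (nul lam H p) = 0 := by
    rw [ip_kgtInv_nul h hlam, nul_iu, nul_iv]; ring
  have e6 : ip (kgtInv m lam H p) (nul lam H p) ell = 1 := by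
    rw [ip_kgtInv_comm, ip_kgtInv_ell, nul_iv]
  have e7 : ip (kgtInv m lam H p) (ell (m := m)) ell = 0 := by rw [ip_kgtInv_ell, hv]
  -- Terms quadratic in `Om` die because `du` is null. The block part squared leaves only a multiple
  -- of `nul ⊗ nul`, whose trace vanishes. The cross terms pair `nul` with `du` and rows of block 0
  -- with `Om`, giving the block-0 trace twice.
  have key : ∀ c c', kgtInv m lam H p c c' * (∑ d, ∑ d', kgtInv m lam H p d d' *
      ∑ e, ∑ e', kgtInv m lam H p e e' *
        ((riemann (kgt m lam H) p ![iu m, c, d, e]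
            + -(H p / 2) * riemann (kgt m lam H) p ![iv m, c, d, e])
          * (riemann (kgt m lam H) p ![iu m, c', d', e']
            + -(H p / 2) * riemann (kgt m lam H) p ![iv m, c', d', e'])))
      = -(lam ^ 2 / 2) * (kgtInv m lam H p c c' * nul lam H p c * nul lam H p c')
        + lam * (kgtInv m lam H p c c' * (if c.1 = 0 then Om lam H p c' c else 0))
        + lam * (kgtInv m lam H p c c' * (if c'.1 = 0 then Om lam H p c c' else 0)) := by
    intro c c'
    simp only [riemann_nul h hlam]
    rw [sum_wedge_mul]
    simp only [ip_smul_left, ip_smul_right]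
    rw [ip_kgtInv_comm (X := nul lam H p) (Y := row0 lam H p c'),
      ip_kgtInv_comm (X := nul lam H p) (Y := Om lam H p c'),
      ip_kgtInv_comm (X := ell) (Y := row0 lam H p c'),
      ip_kgtInv_comm (X := ell) (Y := Om lam H p c'),
      ip_kgtInv_comm (X := ell) (Y := nul lam H p),
      ip_kgtInv_comm (X := row0 lam H p c) (Y := Om lam H p c')]
    simp only [e1, e2, e3, e4, e5, e6, e7, ip_row0 h hlam]
    ring
  simp only [key, Finset.sum_add_distrib, ← Finset.mul_sum]
  rw [sum_block_zero h hlam]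
  have hs : ∑ c, ∑ c', kgtInv m lam H p c c' * (if c'.1 = 0 then Om lam H p c c' else 0)
      = Admissible.tr0 lam H p := by
    rw [Finset.sum_comm, ← sum_block_zero h hlam]
    refine Finset.sum_congr rfl fun a _ => Finset.sum_congr rfl fun b _ => ?_
    rw [← inv_kgt hlam H h.chart, (h.regularAt hlam).inv_symm]
  have h0 : ∑ c, ∑ c', kgtInv m lam H p c c' * nul lam H p c * nul lam H p c' = 0 := e5
  rw [hs, h0]
  ring

end Evaluation

/-! ### Independence of a coordinate and integration along coordinate lines -/

section Lines

variable {m : ℕ} {U : Set (Idx m → ℝ)} {f : (Idx m → ℝ) → ℝ} {i : Idx m}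

theorem IndepOn.pd (hU : IsOpen U) (hf : IndepOn i f U)
    (hd : ∀ p ∈ U, DifferentiableAt ℝ f p) (j : Idx m) : IndepOn i (KGT.pd j f) U := by
  intro p hp q hq hpq
  have h1 : ∀ p ∈ U, HasLineDerivAt ℝ f (KGT.pd j f p) p (Pi.single j 1) := fun p hp =>
    (hd p hp).hasFDerivAt.hasLineDerivAt _
  have hmem : ∀ p ∈ U, ∀ᶠ t in 𝓝 (0 : ℝ), p + t • Pi.single j (1 : ℝ) ∈ U := by
    intro p hp
    have hcont : ContinuousAt (fun t : ℝ => p + t • (Pi.single j (1 : ℝ) : Idx m → ℝ)) 0 := by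
      fun_prop
    exact hcont.preimage_mem_nhds (by simpa using hU.mem_nhds hp)
  have h2 : HasLineDerivAt ℝ f (KGT.pd j f q) p (Pi.single j 1) := by
    have h3 : HasDerivAt (fun t : ℝ => f (q + t • (Pi.single j (1 : ℝ) : Idx m → ℝ)))
      (KGT.pd j f q) 0 := h1 q hq
    refine h3.congr_of_eventuallyEq ?_
    filter_upwards [hmem p hp, hmem q hq] with t h1 h2
    refine hf _ h1 _ h2 fun k hk => ?_
    simp [hpq k hk]
  exact (h1 p hp).unique h2

theorem hasDerivAt_comp_update {p : Idx m → ℝ} {t : ℝ}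
    (hd : DifferentiableAt ℝ f (Function.update p i t)) :
    HasDerivAt (fun s => f (Function.update p i s)) (KGT.pd i f (Function.update p i t)) t :=
  hd.hasFDerivAt.comp_hasDerivAt t (hasDerivAt_update p i t)

theorem isOpen_line (hU : IsOpen U) (p : Idx m → ℝ) (i : Idx m) :
    IsOpen {t : ℝ | Function.update p i t ∈ U} :=
  hU.preimage (continuous_const.update i continuous_id)

/-- A vanishing derivative gives constancy only on connected pieces of a line, hence the condition
that the lines meet `U` in intervals. -/
theorem indepOn_of_pd_eq_zero (hU : IsOpen U)
    (hline : ∀ p ∈ U, {t : ℝ | Function.update p i t ∈ U}.OrdConnected)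
    (hd : ∀ p ∈ U, DifferentiableAt ℝ f p) (h0 : ∀ p ∈ U, KGT.pd i f p = 0) : IndepOn i f U := by
  intro p hp q hq hpq
  have hder : ∀ t ∈ {t : ℝ | Function.update p i t ∈ U},
      HasDerivAt (fun s => f (Function.update p i s)) 0 t := fun t ht => by
    have := hasDerivAt_comp_update (hd _ ht)
    rwa [h0 _ ht] at this
  have hq' : Function.update p i (q i) = q := by
    funext j
    by_cases hj : j = i
    · subst hj; simp
    · simp [hj, hpq j hj]
  have h := (isOpen_line hU p i).is_const_of_deriv_eq_zero (hline p hp).isPreconnected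
    (fun t ht => (hder t ht).differentiableAt.differentiableWithinAt)
    (fun t ht => (hder t ht).deriv) (x := p i) (y := q i) (by simpa using hp) (by simpa [hq'] using hq)
  simpa [hq'] using h

end Lines

/-! ### The two partial traces, universality and the form of `H` -/

section Main

variable {m : ℕ} {lam : ℝ} {U : Set (Idx m → ℝ)} {H : (Idx m → ℝ) → ℝ}

theorem iv_ne_iz : iz m ≠ iv m := by simp

theorem tr0_eq {p : Idx m → ℝ} (h : Admissible H p) (hlam : lam ≠ 0) :
    Admissible.tr0 lam H p = lam / 4 * (p (iz m) ^ 2 * pd (iz m) (pd (iz m) H) p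
      + 3 * p (iz m) * pd (iz m) H p) := by
  have hz := h.chart.1
  rw [Admissible.tr0, h.Om_iz_iz hlam]
  field_simp
  ring

theorem differentiableAt_pd_pd {p : Idx m → ℝ} (h : Admissible H p) (i j : Idx m) :
    DifferentiableAt ℝ (pd i (pd j H)) p :=
  differentiableAt_pd ((h.contDiffAt_pd j).of_le (by norm_cast))

theorem differentiableAt_pd' {p : Idx m → ℝ} (h : Admissible H p) (i : Idx m) :
    DifferentiableAt ℝ (pd i H) p := (h.contDiffAt_pd i).differentiableAt (by simp)

theorem differentiableAt_tr0 {p : Idx m → ℝ} (h : Admissible H p) (hlam : lam ≠ 0) :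
    DifferentiableAt ℝ (Admissible.tr0 lam H) p := by
  have e : Admissible.tr0 lam H =ᶠ[𝓝 p] fun p => lam / 4 * (p (iz m) ^ 2 * pd (iz m) (pd (iz m) H) p
      + 3 * p (iz m) * pd (iz m) H p) := by
    filter_upwards [h.eventually] with q hq using tr0_eq hq hlam
  refine DifferentiableAt.congr_of_eventuallyEq ?_ e
  have h1 := differentiableAt_pd_pd h (iz m) (iz m)
  have h2 := differentiableAt_pd' h (iz m)
  have h3 : DifferentiableAt ℝ (fun q : Idx m → ℝ => q (iz m)) p := differentiableAt_apply _ _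
  exact (((h3.pow 2).mul h1).add ((h3.const_mul 3).mul h2)).const_mul _

theorem indepOn_tr0 (hU : IsOpen U) (hlam : lam ≠ 0) (hadm : ∀ p ∈ U, Admissible H p)
    (hHv : IndepOn (iv m) H U) : IndepOn (iv m) (Admissible.tr0 lam H) U := by
  have h1 := hHv.pd hU (fun p hp => (hadm p hp).diff) (iz m)
  have h2 := h1.pd hU (fun p hp => differentiableAt_pd' (hadm p hp) _) (iz m)
  intro p hp q hq hpq
  rw [tr0_eq (hadm p hp) hlam, tr0_eq (hadm q hq) hlam, h1 p hp q hq hpq, h2 p hp q hq hpq,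
    hpq _ iv_ne_iz]

theorem differentiableAt_tr1 {p : Idx m → ℝ} (h : Admissible H p) (hlam : lam ≠ 0) :
    DifferentiableAt ℝ (tr1 lam H) p := by
  have hreg := h.regularAt hlam
  refine (DifferentiableAt.fun_sum fun α _ => ?_).const_mul _
  refine DifferentiableAt.fun_sum fun i _ => DifferentiableAt.fun_sum fun j _ => ?_
  refine (differentiableAt_inv hreg.det.self_of_nhds hreg.diff _ _).mul ?_
  exact (differentiableAt_pd_pd h _ _).sub (DifferentiableAt.fun_sum fun c _ =>
    (hreg.diff_christoffel c _ _).mul (differentiableAt_pd' h c))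

/-- Only coordinates and derivatives of block `α` occur here, which makes `tr1` independent of `v`.
-/
theorem hess_block {p : Idx m → ℝ} (h : Admissible H p) (hlam : lam ≠ 0) {α : Fin (m + 1)}
    (hα : α ≠ 0) (i j : Fin 3) : hess (kgt m lam H) H (α, i) (α, j) p
      = pd (α, i) (pd (α, j) H) p - ip (hypInv lam (p (α, 0)) (p (α, 1)))
        (fun k => blockGam 0 1 (tabF lam α (p (α, 0))) (tabG α (p (α, 1))) i j k)
        (fun k => pd (α, k) H p) := by
  have hl : ∀ k, ell (m := m) (α, k) = 0 := fun k => by simp [ell, hα]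
  rw [h.hess_eq hlam, kgtInv, ip_blk, Finset.sum_eq_single α]
  · simp only [bgGam_eq, hα, and_self, if_true, if_false, hl]
    simp [crdF, crdG, hα]
  · intro β _ hβ
    simp [bgGam_eq, hβ, ip]
  · simp

theorem indepOn_tr1 (hU : IsOpen U) (hlam : lam ≠ 0) (hadm : ∀ p ∈ U, Admissible H p)
    (hHv : IndepOn (iv m) H U) : IndepOn (iv m) (tr1 lam H) U := by
  have h1 := hHv.pd hU (fun p hp => (hadm p hp).diff)
  have h2 := fun j => (h1 j).pd hU (fun p hp => differentiableAt_pd' (hadm p hp) _)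
  intro p hp q hq hpq
  rw [tr1, tr1]
  congr 1
  refine Finset.sum_congr rfl fun α hα => ?_
  have hα : α ≠ 0 := Finset.ne_of_mem_erase hα
  have hc : ∀ k, p (α, k) = q (α, k) := fun k => hpq _ (by simp [hα])
  simp only [blockBox, inv_kgt hlam H (hadm p hp).chart, inv_kgt hlam H (hadm q hq).chart,
    hess_block (hadm p hp) hlam hα, hess_block (hadm q hq) hlam hα, kgtInv, blk, Matrix.of_apply,
    if_true, hα, if_false, hc]
  simp only [h1 _ p hp q hq hpq, h2 _ _ p hp q hq hpq]

theorem trF_eq_tr0_add_tr1 {p : Idx m → ℝ} (h : Admissible H p) (hlam : lam ≠ 0) :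
    trF (kgtInv m lam H p) (Om lam H p) = Admissible.tr0 lam H p + tr1 lam H p := by
  rw [h.trF_Om hlam, tr1]; ring

theorem kgt_iu_iv (p : Idx m → ℝ) : kgt m lam H p (iu m) (iv m) = 1 := by
  rw [kgt_symm, kgt_iv_iu]

/-- On a universal metric, the part of a conserved tensor along `ℓ ⊗ ℓ` vanishes. -/
theorem IsUniversalOn.coeff_eq_zero (huniv : IsUniversalOn (kgt m lam H) 0 U) (hU : IsOpen U)
    (hlam : lam ≠ 0) (hadm : ∀ p ∈ U, Admissible H p) {T : TField (Idx m) 2}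
    (hTc : CurvPoly (kgt m lam H) 0 2 T) {K : ℝ} {f : (Idx m → ℝ) → ℝ}
    (hT : ∀ p ∈ U, ∀ i j, T p ![i, j] = K * kgt m lam H p i j + f p * (ell i * ell j))
    (hf : ∀ p ∈ U, DifferentiableAt ℝ f p) (hfv : IndepOn (iv m) f U) {p : Idx m → ℝ}
    (hp : p ∈ U) : f p = 0 := by
  obtain ⟨K', hK'⟩ := huniv T hTc (isSymmOn_of_eq hT) (isConservedOn_of_eq hU hlam hadm hT hf
    fun p hp => pd_eq_zero_of_indep hU hfv hp (hf p hp))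
  -- The (u,v) component, where `du²` vanishes and the metric is 1, identifies the two constants;
  -- the (u,u) component then leaves `f`.
  have h1 := hK' p hp (iu m) (iv m)
  have h2 := hK' p hp (iu m) (iu m)
  have hv : ell (iv m) = 0 := by simp [ell]
  rw [hT p hp, kgt_iu_iv, hv] at h1
  rw [hT p hp, ell_iu] at h2
  have h3 : K = K' := by linarith
  rw [h3] at h2
  linarith

/-- Applied to the squared Riemann tensor: the structure theorem supplies the shape, and evaluation
on the null vector identifies the du² coefficient as 2λ `tr0`. -/
theorem tr0_eq_zero_of_isUniversalOn (huniv : IsUniversalOn (kgt m lam H) 0 U) (hU : IsOpen U)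
    (hlam : lam < 0) (hadm : ∀ p ∈ U, Admissible H p) (hHv : IndepOn (iv m) H U)
    {p : Idx m → ℝ} (hp : p ∈ U) : Admissible.tr0 lam H p = 0 := by
  obtain ⟨T, hTc, hT⟩ := exists_curvPoly_riemannSq (kgt m lam H)
  obtain ⟨K, a, b, hK⟩ := curvPoly_structure hlam hTc
  have key : ∀ p ∈ U, ∀ i j, T p ![i, j] = K * kgt m lam H p i j
      + 2 * lam * Admissible.tr0 lam H p * (ell i * ell j) := by
    intro p hp i j
    have h := riemannSq_nul (hadm p hp) hlam.ne
    have hv : ell (iv m) = 0 := by simp [ell]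
    have hvv : kgt m lam H p (iv m) (iv m) = 0 := kgt_iv H p _ (by simp)
    have huu : kgt m lam H p (iu m) (iu m) = H p := by simp [kgt, lorentzBlock]
    simp only [← hT, hK p (hadm p hp), ell_iu, hv, kgt_iu_iv, kgt_iv_iu, hvv, huu] at h
    rw [hK p (hadm p hp), ← h]
    ring
  have h := huniv.coeff_eq_zero hU hlam.ne hadm hTc (f := fun p => 2 * lam * Admissible.tr0 lam H p)
    key (fun p hp => (differentiableAt_tr0 (hadm p hp) hlam.ne).const_mul _)
    (fun p hp q hq hpq => by
      simp only [indepOn_tr0 hU hlam.ne hadm hHv p hp q hq hpq]) hp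
  simpa [hlam.ne] using h

/-- Applied to the Ricci tensor, whose du² coefficient is the full trace. -/
theorem trF_eq_zero_of_isUniversalOn (huniv : IsUniversalOn (kgt m lam H) 0 U) (hU : IsOpen U)
    (hlam : lam ≠ 0) (hadm : ∀ p ∈ U, Admissible H p) (hHv : IndepOn (iv m) H U)
    {p : Idx m → ℝ} (hp : p ∈ U) : Admissible.tr0 lam H p + tr1 lam H p = 0 := by
  obtain ⟨T, hTc, hT⟩ := exists_curvPoly_ricci (kgt m lam H)
  refine huniv.coeff_eq_zero hU hlam hadm hTc (K := lam)
    (f := fun p => Admissible.tr0 lam H p + tr1 lam H p) (fun p hp i j => ?_)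
    (fun p hp => (differentiableAt_tr0 (hadm p hp) hlam).add (differentiableAt_tr1 (hadm p hp) hlam))
    (fun p hp q hq hpq => ?_) hp
  · have h := hadm p hp
    rw [hT, inv_kgt hlam H h.chart, ← h.ricci_eq hlam, h.ricci_kgt hlam, trF_eq_tr0_add_tr1 h hlam]
  · simp only [indepOn_tr0 hU hlam hadm hHv p hp q hq hpq, indepOn_tr1 hU hlam hadm hHv p hp q hq hpq]

theorem hasZForm_of_tr0_eq_zero (hU : IsOpen U) (hlam : lam ≠ 0)
    (hadm : ∀ p ∈ U, Admissible H p) (hHv : IndepOn (iv m) H U)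
    (hline : ∀ p ∈ U, {t : ℝ | Function.update p (iz m) t ∈ U}.OrdConnected)
    (h0 : ∀ p ∈ U, Admissible.tr0 lam H p = 0) : HasZForm H U := by
  have hz : ∀ p : Idx m → ℝ, DifferentiableAt ℝ (fun q : Idx m → ℝ => q (iz m)) p := fun p =>
    differentiableAt_apply _ _
  have hdz := fun p hp => differentiableAt_pd' (hadm p hp) (iz m)
  have hv := hHv.pd hU (fun p hp => (hadm p hp).diff) (iz m)
  have hpz : ∀ p : Idx m → ℝ, pd (iz m) (fun q => q (iz m)) p = 1 := fun p => by
    simpa using pd_comp_coord (i := iz m) (j := iz m) (p := p) (hasDerivAt_id (p (iz m)))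
  have hode : ∀ p ∈ U, p (iz m) * pd (iz m) (pd (iz m) H) p = -3 * pd (iz m) H p := by
    intro p hp
    have h1 := h0 p hp
    have hz := (hadm p hp).chart.1
    rw [tr0_eq (hadm p hp) hlam] at h1
    have h2 : lam / 4 * p (iz m) * (p (iz m) * pd (iz m) (pd (iz m) H) p
      + 3 * pd (iz m) H p) = 0 := by linear_combination h1
    have h3 := (mul_eq_zero.mp h2).resolve_left (by simp [hlam, hz])
    linarith
  have hd1 : ∀ p ∈ U, DifferentiableAt ℝ (fun q => q (iz m) * pd (iz m) H q) p := fun p hp =>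
    (hz p).mul (hdz p hp)
  have hz3 : ∀ p : Idx m → ℝ, DifferentiableAt ℝ (fun q : Idx m → ℝ => q (iz m) ^ 3) p :=
    fun p => (hz p).pow 3
  have hd3 : ∀ p ∈ U, DifferentiableAt ℝ (fun q => q (iz m) ^ 3 * pd (iz m) H q) p := fun p hp =>
    (hz3 p).mul (hdz p hp)
  -- If H = h₀ + h₁/z² then H_z = -2 h₁/z³; solving for h₁ and h₀ gives these witnesses. Their
  -- z-derivatives vanish by the equation z H_zz = -3 H_z.
  refine ⟨fun p => H p + 1 / 2 * (p (iz m) * pd (iz m) H p),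
    fun p => -(1 / 2) * (p (iz m) ^ 3 * pd (iz m) H p), ?_, ?_, ?_, ?_, ?_⟩
  · intro p hp q hq hpq
    simp only [hHv p hp q hq hpq, hv p hp q hq hpq, hpq _ iv_ne_iz]
  · refine indepOn_of_pd_eq_zero hU hline (fun p hp => (hadm p hp).diff.add
      ((hd1 p hp).const_mul _)) fun p hp => ?_
    rw [pd_add (hadm p hp).diff ((hd1 p hp).const_mul _), pd_const_mul _ (hd1 p hp), pd_mul (hz p) (hdz p hp), hpz, hode p hp]
    ring
  · intro p hp q hq hpq
    simp only [hv p hp q hq hpq, hpq _ iv_ne_iz]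
  · have hp3 : ∀ p : Idx m → ℝ, pd (iz m) (fun q => q (iz m) ^ 3) p = 3 * p (iz m) ^ 2 := fun p => by
      simpa using pd_comp_coord (i := iz m) (j := iz m) (p := p) (hasDerivAt_pow 3 (p (iz m)))
    refine indepOn_of_pd_eq_zero hU hline (fun p hp =>
      (hd3 p hp).const_mul _) fun p hp => ?_
    rw [pd_const_mul _ (hd3 p hp), pd_mul (hz3 p) (hdz p hp), hp3]
    linear_combination (-(1 / 2) * p (iz m) ^ 2) * hode p hp
  · intro p hp
    have hz := (hadm p hp).chart.1
    field_simp
    ring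

theorem tr0_eq_zero_of_hasZForm (hU : IsOpen U) (hlam : lam ≠ 0)
    (hadm : ∀ p ∈ U, Admissible H p) (hform : HasZForm H U) {p : Idx m → ℝ} (hp : p ∈ U) :
    Admissible.tr0 lam H p = 0 := by
  obtain ⟨h₀, h₁, -, hz0, -, hz1, hH⟩ := hform
  have hline : ∀ p ∈ U, ∀ᶠ t in 𝓝 (p (iz m)), Function.update p (iz m) t ∈ U := fun p hp =>
    (isOpen_line hU p (iz m)).mem_nhds (by simpa using hp)
  have hup : ∀ (p : Idx m → ℝ) (t : ℝ) (j : Idx m), j ≠ iz m → Function.update p (iz m) t j = p j :=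
    fun p t j hj => Function.update_of_ne hj _ _
  have h1 : ∀ p ∈ U, pd (iz m) H p = -2 * h₁ p / p (iz m) ^ 3 := by
    intro p hp
    have hz := (hadm p hp).chart.1
    have hd := hasDerivAt_comp_update (f := H) (p := p) (i := iz m) (t := p (iz m))
      (by simpa using (hadm p hp).diff)
    rw [Function.update_eq_self] at hd
    -- Since h₀ and h₁ are not assumed differentiable, the formula is differentiated only along the
    -- z-line, where both are constant.
    have e : (fun t => H (Function.update p (iz m) t)) =ᶠ[𝓝 (p (iz m))]
        fun t => h₀ p + h₁ p / t ^ 2 := by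
      filter_upwards [hline p hp] with t ht
      rw [hH _ ht, hz0 _ ht p hp (hup p t), hz1 _ ht p hp (hup p t), Function.update_self]
    have hd' := (((hasDerivAt_const (p (iz m)) (h₁ p)).div (hasDerivAt_pow 2 (p (iz m)))
      (pow_ne_zero 2 hz)).const_add (h₀ p))
    have := hd.unique (hd'.congr_of_eventuallyEq e)
    rw [this]
    field_simp
    simp
    ring
  have hz := (hadm p hp).chart.1
  have h2 : pd (iz m) (pd (iz m) H) p = 6 * h₁ p / p (iz m) ^ 4 := by
    have hd := hasDerivAt_comp_update (f := pd (iz m) H) (p := p) (i := iz m) (t := p (iz m))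
      (by simpa using differentiableAt_pd' (hadm p hp) (iz m))
    rw [Function.update_eq_self] at hd
    have e : (fun t => pd (iz m) H (Function.update p (iz m) t)) =ᶠ[𝓝 (p (iz m))]
        fun t => -2 * h₁ p / t ^ 3 := by
      filter_upwards [hline p hp] with t ht
      rw [h1 _ ht, hz1 _ ht p hp (hup p t), Function.update_self]
    have hd' := (hasDerivAt_const (p (iz m)) (-2 * h₁ p)).div (hasDerivAt_pow 3 (p (iz m)))
      (pow_ne_zero 3 hz)
    have := hd.unique (hd'.congr_of_eventuallyEq e)
    rw [this]
    field_simp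
    simp
    ring
  rw [tr0_eq (hadm p hp) hlam, h1 p hp, h2]
  field_simp
  ring

end Main

end KGT

end

theorem mainTheorem10 (m : ℕ) (hm : 1 ≤ m) (lam : ℝ) (hlam : lam < 0)
    (U : Set (KGT.Idx m → ℝ)) (hU : IsOpen U) (hUc : U ⊆ KGT.chart m)
    (H : (KGT.Idx m → ℝ) → ℝ) (hH : ContDiffOn ℝ ∞ H U) (hHv : KGT.IndepOn (KGT.iv m) H U) :
    -- the Weyl tensor is of genuine type II, with the non-recurrent mWAND `∂_v`
    (∀ p ∈ U, KGT.IsTypeII (KGT.kgt m lam H) p ∧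
      KGT.IsMWAND (KGT.kgt m lam H) p (KGT.dv m p) ∧
      ∀ f : (KGT.Idx m → ℝ) → ℝ, DifferentiableAt ℝ f p → f p ≠ 0 →
        ¬ KGT.IsRecurrentAt (KGT.kgt m lam H) (fun q => f q • KGT.dv m q) p) ∧
    -- sufficiency
    ((∀ p ∈ U, ∑ α ∈ Finset.univ.erase (0 : Fin (m + 1)),
          KGT.blockBox (KGT.kgt m lam H) α H p = 0) →
      KGT.HasZForm H U →
        (∀ p ∈ U, KGT.box (KGT.kgt m lam H) H p
          - 2 * lam * p (KGT.iz m) * KGT.pd (KGT.iz m) H p = 0) ∧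
        (∀ p ∈ U, ∀ a b, KGT.ricci (KGT.kgt m lam H) a b p = lam * KGT.kgt m lam H p a b) ∧
        KGT.IsUniversalOn (KGT.kgt m lam H) 0 U) ∧
    -- necessity
    ((∀ p ∈ U, {t : ℝ | Function.update p (KGT.iz m) t ∈ U}.OrdConnected) →
      KGT.IsUniversalOn (KGT.kgt m lam H) 0 U →
        (∀ p ∈ U, KGT.box (KGT.kgt m lam H) H p
          - 2 * lam * p (KGT.iz m) * KGT.pd (KGT.iz m) H p = 0) ∧
        (∀ p ∈ U, ∀ a b, KGT.ricci (KGT.kgt m lam H) a b p = lam * KGT.kgt m lam H p a b) ∧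
        (∀ p ∈ U, ∑ α ∈ Finset.univ.erase (0 : Fin (m + 1)),
          KGT.blockBox (KGT.kgt m lam H) α H p = 0) ∧
        KGT.HasZForm H U) := by
  have hadm : ∀ p ∈ U, KGT.Admissible H p := fun p hp => KGT.admissible hU hUc hH hHv hp
  have hne := hlam.ne
  -- The scalar condition and the Einstein equation both express the vanishing of tr Ω.
  have hbox : (∀ p ∈ U, KGT.Admissible.tr0 lam H p + KGT.tr1 lam H p = 0) →
      (∀ p ∈ U, KGT.box (KGT.kgt m lam H) H p
          - 2 * lam * p (KGT.iz m) * KGT.pd (KGT.iz m) H p = 0) ∧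
        ∀ p ∈ U, ∀ a b, KGT.ricci (KGT.kgt m lam H) a b p = lam * KGT.kgt m lam H p a b := by
    intro h0
    refine ⟨fun p hp => ?_, fun p hp a b => ?_⟩
    · have h1 := (hadm p hp).trF_Om_eq_box hne
      rw [KGT.trF_eq_tr0_add_tr1 (hadm p hp) hne, h0 p hp] at h1
      linarith
    · rw [(hadm p hp).ricci_kgt hne, KGT.trF_eq_tr0_add_tr1 (hadm p hp) hne, h0 p hp]
      ring
  refine ⟨fun p hp => ⟨KGT.isTypeII_kgt hm (hadm p hp) hlam, KGT.isMWAND_dv hm (hadm p hp) hne,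
    fun f _ hf => KGT.not_isRecurrentAt (hadm p hp) hne hf⟩, fun hsum hform => ?_,
    fun hline huniv => ?_⟩
  · have h0 : ∀ p ∈ U, KGT.Admissible.tr0 lam H p = 0 := fun p hp =>
      KGT.tr0_eq_zero_of_hasZForm hU hne hadm hform hp
    have h1 : ∀ p ∈ U, KGT.tr1 lam H p = 0 := fun p hp => by rw [KGT.tr1, hsum p hp, mul_zero]
    obtain ⟨hb, hr⟩ := hbox fun p hp => by rw [h0 p hp, h1 p hp, add_zero]
    -- With both traces zero, the structure theorem turns every rank-2 curvature polynomial into `K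
    -- g`.
    refine ⟨hb, hr, fun T hT _ _ => ?_⟩
    obtain ⟨K, a, b, hK⟩ := KGT.curvPoly_structure hlam hT
    refine ⟨K, fun p hp i j => ?_⟩
    rw [hK p (hadm p hp), h0 p hp, h1 p hp]
    ring
  · have h0 : ∀ p ∈ U, KGT.Admissible.tr0 lam H p = 0 := fun p hp =>
      KGT.tr0_eq_zero_of_isUniversalOn huniv hU hlam hadm hHv hp
    have h1 : ∀ p ∈ U, KGT.Admissible.tr0 lam H p + KGT.tr1 lam H p = 0 := fun p hp =>
      KGT.trF_eq_zero_of_isUniversalOn huniv hU hne hadm hHv hp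
    obtain ⟨hb, hr⟩ := hbox h1
    refine ⟨hb, hr, fun p hp => ?_, KGT.hasZForm_of_tr0_eq_zero hU hne hadm hHv hline h0⟩
    have h2 := h1 p hp
    rw [h0 p hp, KGT.tr1] at h2
    linarith
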